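/- Let $d\ge 3$ be an integer, let $\mathbb{T}^d=\mathbb{R}^d/\mathbb{Z}^d$ be the flat torus, let $\varepsilon>0$, and let $\bar\rho\in C^\infty(\mathbb{T}^d)$ be real-valued with $\int_{\mathbb{T}^d}\bar\rho\,dx=0$. Then there exist a density and a vector field $$\rho\in C\big([0,1];L^1(\mathbb{T}^d)\big),\qquad u\in C\big([0,1]\times\mathbb{T}^d;\mathbb{R}^d\big)\cap\bigcap_{1\le p<d-1}C\big([0,1];W^{1,p}(\mathbb{T}^d;\mathbb{R}^d)\big)$$ such that $(\rho,u)$ is a weak solution of $$\partial_t\rho+\operatorname{div}(\rho u)=0,\qquad \operatorname{div}u=0,$$ that is, for every test function $\varphi\in C_c^\infty\big((0,1)\times\mathbb{T}^d\big)$, $$\int_0^1\!\!\int_{\mathbb{T}^d}\rho\,(\partial_t\varphi+u\cdot\nabla\varphi)\,dx\,dt=0,\qquad \int_0^1\!\!\int_{\mathbb{T}^d}u\cdot\nabla\varphi\,dx\,dt=0,$$ and such that $\rho(0)=0$ and $\rho(1)=\bar\rho$ as elements of $L^1(\mathbb{T}^d)$, and $$\max_{(t,x)\in[0,1]\times\mathbb{T}^d}|u(t,x)|\le\varepsilon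 .$$ -/

import Mathlib

open MeasureTheory Topology Set
open scoped ENNReal ContDiff unitInterval

noncomputable section

/-- The flat torus `ℝᵈ / ℤᵈ`; its `volume` is the product of the Lebesgue measures of total mass one
on the circles `ℝ / ℤ`. -/
abbrev Torus (d : ℕ) : Type := UnitAddTorus (Fin d)

/-- The quotient map `ℝᵈ → ℝᵈ / ℤᵈ`. -/
def Torus.proj (d : ℕ) (y : Fin d → ℝ) : Torus d := fun i => (y i : UnitAddCircle)

/-- `f` is `C^∞` on the torus: its periodic lift to `ℝᵈ` is. -/
def SmoothOnTorus {d : ℕ} (f : Torus d → ℝ) : Prop :=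
  ContDiff ℝ ∞ (fun y : Fin d → ℝ => f (Torus.proj d y))

/-- The classical partial derivative `∂ᵢ f` of a function on the torus. -/
def torusPartial {d : ℕ} (i : Fin d) (f : Torus d → ℝ) (x : Torus d) : ℝ :=
  deriv (fun h : ℝ => f (x + Pi.single i (h : UnitAddCircle))) 0

/-- The function `g` is the weak `i`-th partial derivative of `f` on the torus. It is used only for
`f` and `g` in some `Lᵖ`, `p ≥ 1`, so that both integrals converge. -/
def IsWeakPartial {d : ℕ} (i : Fin d) (f g : Torus d → ℝ) : Prop :=
  ∀ φ : Torus d → ℝ, SmoothOnTorus φ →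
    ∫ x, f x * torusPartial i φ x = -∫ x, g x * φ x

theorem Torus.isOpenQuotientMap_proj (d : ℕ) : IsOpenQuotientMap (Torus.proj d) :=
  IsOpenQuotientMap.piMap (fun _ : Fin d => QuotientAddGroup.isOpenQuotientMap_mk)

theorem SmoothOnTorus.continuous {d : ℕ} {φ : Torus d → ℝ} (h : SmoothOnTorus φ) :
    Continuous φ :=
  (Torus.isOpenQuotientMap_proj d).isQuotientMap.continuous_iff.2 (ContDiff.continuous h)

theorem torusPartial_proj {d : ℕ} {φ : Torus d → ℝ} (hφ : SmoothOnTorus φ) (i : Fin d)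
    (y : Fin d → ℝ) :
    torusPartial i φ (Torus.proj d y) =
      fderiv ℝ (fun y : Fin d → ℝ => φ (Torus.proj d y)) y (Pi.single i 1) := by
  have hd : DifferentiableAt ℝ (fun y : Fin d → ℝ => φ (Torus.proj d y)) y :=
    (ContDiff.differentiable hφ (by simp)) y
  rw [← hd.lineDeriv_eq_fderiv]
  unfold torusPartial lineDeriv
  congr 1
  funext h
  congr 1
  funext j
  by_cases hj : j = i
  · subst hj
    simp [Torus.proj]
  · simp [Torus.proj, hj]

theorem SmoothOnTorus.continuous_torusPartial {d : ℕ} {φ : Torus d → ℝ} (h : SmoothOnTorus φ)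
    (i : Fin d) : Continuous (torusPartial i φ) := by
  refine (Torus.isOpenQuotientMap_proj d).isQuotientMap.continuous_iff.2 ?_
  have : torusPartial i φ ∘ Torus.proj d = fun y =>
      fderiv ℝ (fun y : Fin d → ℝ => φ (Torus.proj d y)) y (Pi.single i 1) :=
    funext fun y => torusPartial_proj h i y
  rw [this]
  exact (ContDiff.continuous_fderiv h (by simp)).clm_apply continuous_const

theorem integrable_Lp_mul {d : ℕ} {p : ℝ≥0∞} [hp : Fact (1 ≤ p)]
    (f : Lp ℝ p (volume : Measure (Torus d))) {ψ : Torus d → ℝ} (hψ : Continuous ψ) :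
    Integrable (fun x => f x * ψ x) := by
  have hf : Integrable f := (Lp.memLp f).integrable hp.out
  obtain ⟨C, hC⟩ := isCompact_univ.exists_bound_of_continuousOn hψ.continuousOn
  exact hf.mul_bdd hψ.aestronglyMeasurable (Filter.Eventually.of_forall fun x => hC x trivial)

/-- The Sobolev space `W^{1,p}` of real functions on the torus, `1 ≤ p ≤ ∞`: the pairs `(f, ∇f)` with
`f ∈ Lᵖ` whose weak gradient `∇f` is in `Lᵖ`. Since weak gradients are unique, such a pair is the
same as the function `f`. The norm is `max (‖f‖_p) (maxᵢ ‖∂ᵢ f‖_p)`, which is equivalent to the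
other usual norms. -/
def SobolevW1 (d : ℕ) (p : ℝ≥0∞) [Fact (1 ≤ p)] :
    Submodule ℝ (Lp ℝ p (volume : Measure (Torus d)) ×
      (Fin d → Lp ℝ p (volume : Measure (Torus d)))) where
  carrier := {w | ∀ i, IsWeakPartial i w.1 (w.2 i)}
  zero_mem' := by
    intro i φ _
    have h1 : ∀ ψ : Torus d → ℝ,
        ∫ x, (0 : Lp ℝ p (volume : Measure (Torus d))) x * ψ x = 0 := by
      intro ψ
      rw [integral_eq_zero_of_ae]
      filter_upwards [Lp.coeFn_zero ℝ p (volume : Measure (Torus d))] with x hx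
      rw [hx]
      simp
    simp only [Prod.fst_zero, Prod.snd_zero, Pi.zero_apply, h1, neg_zero]
  add_mem' := by
    intro v w hv hw i φ hφ
    have key : ∀ (f g : Lp ℝ p (volume : Measure (Torus d))) (ψ : Torus d → ℝ), Continuous ψ →
        ∫ x, (f + g) x * ψ x = (∫ x, f x * ψ x) + ∫ x, g x * ψ x := by
      intro f g ψ hψ
      rw [← integral_add (integrable_Lp_mul f hψ) (integrable_Lp_mul g hψ)]
      refine integral_congr_ae ?_
      filter_upwards [Lp.coeFn_add f g] with x hx
      rw [hx, Pi.add_apply, add_mul]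
    simp only [Prod.fst_add, Prod.snd_add, Pi.add_apply]
    rw [key _ _ _ (hφ.continuous_torusPartial i), key _ _ _ hφ.continuous, hv i φ hφ, hw i φ hφ]
    ring
  smul_mem' := by
    intro c w hw i φ hφ
    have key : ∀ (f : Lp ℝ p (volume : Measure (Torus d))) (ψ : Torus d → ℝ),
        ∫ x, (c • f) x * ψ x = c * ∫ x, f x * ψ x := by
      intro f ψ
      rw [← integral_const_mul]
      refine integral_congr_ae ?_
      filter_upwards [Lp.coeFn_smul c f] with x hx
      simp [hx, mul_assoc]
    simp only [Prod.smul_fst, Prod.smul_snd, Pi.smul_apply]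
    rw [key, key, hw i φ hφ]
    ring

/-- The vector field `u` belongs to `C([0,1]; W^{1,p})`: each component does, that is, it is given by
a continuous curve in the Sobolev space. -/
def InCW1 {d : ℕ} (p : ℝ≥0∞) [Fact (1 ≤ p)] (u : I × Torus d → EuclideanSpace ℝ (Fin d)) : Prop :=
  ∀ i : Fin d, ∃ U : C(I, SobolevW1 d p),
    ∀ t : I, (U t).1.1 =ᵐ[volume] fun x => u (t, x) i

/-- `φ` is a test function on `(0,1) × 𝕋ᵈ`: smooth, with compact support in the open time interval. -/
structure IsTestFunction {d : ℕ} (φ : ℝ × Torus d → ℝ) : Prop where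
  smooth : ContDiff ℝ ∞ (fun z : ℝ × (Fin d → ℝ) => φ (z.1, Torus.proj d z.2))
  hasCompactSupport : HasCompactSupport φ
  tsupport_subset : tsupport φ ⊆ Ioo (0 : ℝ) 1 ×ˢ univ

/-- `∂ₜ φ` at `(t, x)`. -/
def timeDeriv {d : ℕ} (φ : ℝ × Torus d → ℝ) (t : ℝ) (x : Torus d) : ℝ :=
  deriv (fun s => φ (s, x)) t

/-- `u · ∇φ` at `(t, x)`. -/
def transportTerm {d : ℕ} (u : I × Torus d → EuclideanSpace ℝ (Fin d)) (φ : ℝ × Torus d → ℝ)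
    (t : I) (x : Torus d) : ℝ :=
  ∑ i : Fin d, u (t, x) i * torusPartial i (fun y => φ ((t : ℝ), y)) x

/-- `(ρ, u)` solves `∂ₜ ρ + div (ρ u) = 0`, `div u = 0` in the sense of distributions on
`(0,1) × 𝕋ᵈ`. -/
structure IsWeakSolution {d : ℕ} (ρ : C(I, Lp ℝ 1 (volume : Measure (Torus d))))
    (u : C(I × Torus d, EuclideanSpace ℝ (Fin d))) : Prop where
  continuity_eq : ∀ φ : ℝ × Torus d → ℝ, IsTestFunction φ →
    ∫ t : I, ∫ x : Torus d, ρ t x * (timeDeriv φ t x + transportTerm u φ t x) = 0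
  div_eq_zero : ∀ φ : ℝ × Torus d → ℝ, IsTestFunction φ →
    ∫ t : I, ∫ x : Torus d, transportTerm u φ t x = 0

end

/-!
The solution is the limit of a convex integration scheme. Its approximations are smooth solutions
of `∂ₜρ + div (ρu) = -div R`, `div u = 0` with a defect `R` (`DefectSolution`), and one step
(`exists_perturbation`) makes the `L¹` norm of the defect as small as desired by adding to `u` and
`ρ` families of pipes. A pipe (`PipeProfile`) is a shear flow `W` in a coordinate direction `j`,
independent of `xⱼ` and supported in a tube of radius `1/μ`, together with a density `Θ` in the
same tube with `∫ Θ W = 1`. As `W` is bounded by one and the cross section of the tube has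
dimension `d - 1`, the gradient of `W` is small in `Lᵖ` for `p < d - 1`, while `Θ` is bounded in
`L¹` uniformly in `μ`. Adding `η W(n ·)` to the field and `η⁻¹ a Θ(n ·)` to the density, where `R
= a eⱼ`, produces the flux `a Θ W eⱼ`, whose mean part cancels the defect.

Two difficulties remain. The new density is large in `L¹` only through `η⁻¹ ‖R‖₁`, but it must be
transported by the old field `u`, and the pipes must not meet each other. For this the defect is
cut by a partition of unity in the space of velocities (`exists_velocity_partition`), so that on
each piece `u` is nearly a constant `c`, and every pipe is moved with its constant velocity `c`.
Over a short time interval the pipes hardly move; as `d ≥ 3`, two tubes around lines with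
different phases are disjoint, and they remain so. A partition of unity in time
(`exists_time_cutoffs`) of short period `τ` allows to move each pipe back to its initial position
while its coefficient vanishes. Thus the density of a pipe never meets the field of another one.

All errors are written explicitly as divergences (`PipeSystem.error`). This uses that `Θ` is a
derivative `∂ₖH` with `‖H‖₁ ≲ 1/μ` and that `Θ W - 1` is the divergence of a field `G` which is
independent of `xⱼ`, as provided by `exists_antidivergence`. The errors are small
(`PipeSystem.integral_error_le`) when the accuracy of the velocities, the frequency `n`, the
switching time `τ` and the concentration `μ` are chosen in this order (`exists_parameters`).

Iterating the step with `η` decaying like `2^{-q}` and the defect like `4^{-q}`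
(`exists_approximation`), the densities converge in `C([0,1]; L¹)` and the fields uniformly and in
`C([0,1]; W^{1,p})` for all `p < d - 1`. Since the perturbations vanish near the times `0` and
`1`, the end values of the initial approximation, `0` and `ρbar`, are kept.
-/

/-! ### Smooth functions of time and a point of the torus -/

/-- `f` is `C^∞` on `ℝ × 𝕋ᵈ`: its lift to `ℝ × ℝᵈ`, periodic in space, is. -/
def SmoothInTime {d : ℕ} (f : ℝ → Torus d → ℝ) : Prop :=
  ContDiff ℝ ∞ (fun z : ℝ × (Fin d → ℝ) => f z.1 (Torus.proj d z.2))

/-- The classical time derivative of a function on `ℝ × 𝕋ᵈ`. -/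
noncomputable def timePartial {d : ℕ} (f : ℝ → Torus d → ℝ) (t : ℝ) (x : Torus d) : ℝ :=
  deriv (fun s => f s x) t

instance UnitAddCircle.isProbabilityMeasure_volume :
    IsProbabilityMeasure (volume : Measure UnitAddCircle) := ⟨UnitAddCircle.measure_univ⟩

instance Torus.isProbabilityMeasure_volume (d : ℕ) :
    IsProbabilityMeasure (volume : Measure (Torus d)) :=
  inferInstanceAs (IsProbabilityMeasure (Measure.pi fun _ : Fin d =>
    (volume : Measure UnitAddCircle)))

theorem Torus.proj_surjective (d : ℕ) : Function.Surjective (Torus.proj d) :=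
  (Torus.isOpenQuotientMap_proj d).surjective

theorem Torus.proj_add (d : ℕ) (y z : Fin d → ℝ) :
    Torus.proj d (y + z) = Torus.proj d y + Torus.proj d z := by
  funext i; simp [Torus.proj]

theorem Torus.proj_sub (d : ℕ) (y z : Fin d → ℝ) :
    Torus.proj d (y - z) = Torus.proj d y - Torus.proj d z := by
  funext i; simp [Torus.proj]

theorem Torus.proj_nsmul (d : ℕ) (n : ℕ) (y : Fin d → ℝ) :
    Torus.proj d ((n : ℝ) • y) = n • Torus.proj d y := by
  funext i
  simp only [Torus.proj, Pi.smul_apply, smul_eq_mul, ← nsmul_eq_mul]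
  exact AddCircle.coe_nsmul (1 : ℝ)

theorem Torus.proj_smul_single (d : ℕ) (i : Fin d) (h : ℝ) :
    Torus.proj d (h • Pi.single i 1) = Pi.single i (h : UnitAddCircle) := by
  funext j
  by_cases hj : j = i
  · subst hj; simp [Torus.proj]
  · simp [Torus.proj, hj]

/-- Every point of the torus has a representative in the unit cube. -/
theorem Torus.exists_proj_eq {d : ℕ} (x : Torus d) :
    ∃ y : Fin d → ℝ, ‖y‖ ≤ 1 ∧ Torus.proj d y = x := by
  obtain ⟨z, rfl⟩ := Torus.proj_surjective d x
  refine ⟨fun i => Int.fract (z i), ?_, ?_⟩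
  · refine (pi_norm_le_iff_of_nonneg zero_le_one).2 fun i => ?_
    rw [Real.norm_eq_abs, abs_of_nonneg (Int.fract_nonneg _)]
    exact (Int.fract_lt_one _).le
  · funext i
    change ((Int.fract (z i) : ℝ) : AddCircle (1 : ℝ)) = (z i : AddCircle (1 : ℝ))
    rw [← sub_eq_zero, ← AddCircle.coe_sub, AddCircle.coe_eq_zero_iff]
    exact ⟨-⌊z i⌋, by rw [Int.fract]; simp⟩

section Calculus

variable {d : ℕ} {f g : Torus d → ℝ}

theorem SmoothOnTorus.const (c : ℝ) : SmoothOnTorus (fun _ : Torus d => c) := contDiff_const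

theorem SmoothOnTorus.add (hf : SmoothOnTorus f) (hg : SmoothOnTorus g) :
    SmoothOnTorus (fun x => f x + g x) := ContDiff.add hf hg

theorem SmoothOnTorus.sub (hf : SmoothOnTorus f) (hg : SmoothOnTorus g) :
    SmoothOnTorus (fun x => f x - g x) := ContDiff.sub hf hg

theorem SmoothOnTorus.mul (hf : SmoothOnTorus f) (hg : SmoothOnTorus g) :
    SmoothOnTorus (fun x => f x * g x) := ContDiff.mul hf hg

theorem SmoothOnTorus.hasDerivAt (hf : SmoothOnTorus f) (i : Fin d) (x : Torus d) (h : ℝ) :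
    HasDerivAt (fun h : ℝ => f (x + Pi.single i (h : UnitAddCircle)))
      (torusPartial i f (x + Pi.single i (h : UnitAddCircle))) h := by
  obtain ⟨y, rfl⟩ := Torus.proj_surjective d x
  have key : ∀ h : ℝ, Torus.proj d y + Pi.single i (h : UnitAddCircle) =
      Torus.proj d (y + h • Pi.single i 1) := fun h => by
    rw [Torus.proj_add, Torus.proj_smul_single]
  simp only [key]
  rw [torusPartial_proj hf]
  have h1 := ((ContDiff.differentiable hf (by simp)) (y + h • Pi.single i 1)).hasFDerivAt
  have h2 : HasDerivAt (fun h : ℝ => y + h • (Pi.single i 1 : Fin d → ℝ)) (Pi.single i 1) h := by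
    simpa using ((hasDerivAt_id h).smul_const (Pi.single i 1 : Fin d → ℝ)).const_add y
  exact h1.comp_hasDerivAt h h2

theorem SmoothOnTorus.hasDerivAt_zero (hf : SmoothOnTorus f) (i : Fin d) (x : Torus d) :
    HasDerivAt (fun h : ℝ => f (x + Pi.single i (h : UnitAddCircle))) (torusPartial i f x) 0 := by
  simpa using hf.hasDerivAt i x 0

theorem torusPartial_eq_of_hasDerivAt {i : Fin d} {x : Torus d} {c : ℝ}
    (h : HasDerivAt (fun h : ℝ => f (x + Pi.single i (h : UnitAddCircle))) c 0) :
    torusPartial i f x = c := h.deriv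

theorem torusPartial_const (i : Fin d) (c : ℝ) (x : Torus d) :
    torusPartial i (fun _ => c) x = 0 := by simp [torusPartial]

theorem torusPartial_add (hf : SmoothOnTorus f) (hg : SmoothOnTorus g) (i : Fin d) (x : Torus d) :
    torusPartial i (fun x => f x + g x) x = torusPartial i f x + torusPartial i g x :=
  torusPartial_eq_of_hasDerivAt ((hf.hasDerivAt_zero i x).add (hg.hasDerivAt_zero i x))

theorem torusPartial_sub (hf : SmoothOnTorus f) (hg : SmoothOnTorus g) (i : Fin d) (x : Torus d) :
    torusPartial i (fun x => f x - g x) x = torusPartial i f x - torusPartial i g x :=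
  torusPartial_eq_of_hasDerivAt ((hf.hasDerivAt_zero i x).sub (hg.hasDerivAt_zero i x))

theorem torusPartial_mul (hf : SmoothOnTorus f) (hg : SmoothOnTorus g) (i : Fin d) (x : Torus d) :
    torusPartial i (fun x => f x * g x) x =
      torusPartial i f x * g x + f x * torusPartial i g x := by
  have h := ((hf.hasDerivAt_zero i x).mul (hg.hasDerivAt_zero i x)).deriv
  simp only [AddCircle.coe_zero, Pi.single_zero, add_zero] at h
  exact h

theorem torusPartial_const_mul (c : ℝ) (hf : SmoothOnTorus f) (i : Fin d) (x : Torus d) :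
    torusPartial i (fun x => c * f x) x = c * torusPartial i f x :=
  torusPartial_eq_of_hasDerivAt ((hf.hasDerivAt_zero i x).const_mul c)

theorem torusPartial_sum {ι : Type*} {s : Finset ι} {f : ι → Torus d → ℝ}
    (hf : ∀ k ∈ s, SmoothOnTorus (f k)) (i : Fin d) (x : Torus d) :
    torusPartial i (fun x => ∑ k ∈ s, f k x) x = ∑ k ∈ s, torusPartial i (f k) x :=
  torusPartial_eq_of_hasDerivAt (HasDerivAt.fun_sum fun k hk => (hf k hk).hasDerivAt_zero i x)

theorem SmoothOnTorus.torusPartial (hf : SmoothOnTorus f) (i : Fin d) :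
    SmoothOnTorus (torusPartial i f) := by
  have : (fun y => _root_.torusPartial i f (Torus.proj d y)) = fun y =>
      fderiv ℝ (fun y : Fin d → ℝ => f (Torus.proj d y)) y (Pi.single i 1) :=
    funext fun y => torusPartial_proj hf i y
  unfold SmoothOnTorus
  rw [this]
  exact (ContDiff.fderiv_right hf (m := ∞) (by simp)).clm_apply contDiff_const

theorem SmoothOnTorus.integrable (hf : SmoothOnTorus f) : Integrable f :=
  hf.continuous.integrable_of_hasCompactSupport (HasCompactSupport.of_compactSpace f)

theorem Torus.integrable_of_continuous (hf : Continuous f) : Integrable f :=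
  hf.integrable_of_hasCompactSupport (HasCompactSupport.of_compactSpace f)

/-- The integral of a derivative over the torus vanishes, by invariance under translations. -/
theorem integral_torusPartial (hf : SmoothOnTorus f) (i : Fin d) :
    ∫ x, torusPartial i f x = 0 := by
  obtain ⟨C, hC⟩ := isCompact_univ.exists_bound_of_continuousOn
    (hf.continuous_torusPartial i).continuousOn
  set F : ℝ → Torus d → ℝ := fun h x => f (x + Pi.single i (h : UnitAddCircle)) with hF
  set F' : ℝ → Torus d → ℝ := fun h x => torusPartial i f (x + Pi.single i (h : UnitAddCircle))
    with hF'
  have hshift : ∀ h : ℝ, Continuous fun x : Torus d => x + Pi.single i (h : UnitAddCircle) :=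
    fun h => by fun_prop
  have hFc : ∀ h, Continuous (F h) := fun h => hf.continuous.comp (hshift h)
  have hFc' : ∀ h, Continuous (F' h) := fun h => (hf.continuous_torusPartial i).comp (hshift h)
  have hb : ∀ x, ∀ h ∈ (univ : Set ℝ), ‖F' h x‖ ≤ C := fun x h _ => hC _ trivial
  have hd : ∀ x, ∀ h ∈ (univ : Set ℝ), HasDerivAt (fun h => F h x) (F' h x) h :=
    fun x h _ => hf.hasDerivAt i x h
  have h2 : HasDerivAt (fun h => ∫ x, F h x) (∫ x, F' 0 x) 0 :=
    (hasDerivAt_integral_of_dominated_loc_of_deriv_le (bound := fun _ => C) Filter.univ_mem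
      (Filter.Eventually.of_forall fun h => (hFc h).aestronglyMeasurable)
      ((hFc 0).integrable_of_hasCompactSupport (HasCompactSupport.of_compactSpace _))
      (hFc' 0).aestronglyMeasurable (Filter.Eventually.of_forall hb)
      (integrable_const _) (Filter.Eventually.of_forall hd)).2
  have h1 : (fun h => ∫ x, F h x) = fun _ => ∫ x, f x :=
    funext fun h => integral_add_right_eq_self f (Pi.single i (h : UnitAddCircle))
  have h0 : F' 0 = torusPartial i f := by simp [hF']
  rw [h1, h0] at h2
  exact h2.unique (hasDerivAt_const _ _)

theorem integral_torusPartial_mul (hf : SmoothOnTorus f) (hg : SmoothOnTorus g) (i : Fin d) :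
    ∫ x, torusPartial i f x * g x = -∫ x, f x * torusPartial i g x := by
  have h := integral_torusPartial (hf.mul hg) i
  simp only [torusPartial_mul hf hg] at h
  rw [integral_add ((hf.torusPartial i).mul hg).integrable
    (hf.mul (hg.torusPartial i)).integrable] at h
  linarith

end Calculus

section SpaceTime

variable {d : ℕ} {f g : ℝ → Torus d → ℝ}

theorem SmoothInTime.const (c : ℝ) : SmoothInTime (fun (_ : ℝ) (_ : Torus d) => c) :=
  contDiff_const

theorem SmoothInTime.add (hf : SmoothInTime f) (hg : SmoothInTime g) :
    SmoothInTime (fun t x => f t x + g t x) := ContDiff.add hf hg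

theorem SmoothInTime.sub (hf : SmoothInTime f) (hg : SmoothInTime g) :
    SmoothInTime (fun t x => f t x - g t x) := ContDiff.sub hf hg

theorem SmoothInTime.neg (hf : SmoothInTime f) : SmoothInTime (fun t x => -f t x) :=
  ContDiff.neg hf

theorem SmoothInTime.mul (hf : SmoothInTime f) (hg : SmoothInTime g) :
    SmoothInTime (fun t x => f t x * g t x) := ContDiff.mul hf hg

theorem SmoothInTime.const_mul (c : ℝ) (hf : SmoothInTime f) :
    SmoothInTime (fun t x => c * f t x) := contDiff_const.mul hf

theorem SmoothInTime.sum {ι : Type*} {s : Finset ι} {f : ι → ℝ → Torus d → ℝ}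
    (hf : ∀ i ∈ s, SmoothInTime (f i)) : SmoothInTime (fun t x => ∑ i ∈ s, f i t x) :=
  ContDiff.sum hf

theorem SmoothInTime.of_time {a : ℝ → ℝ} (ha : ContDiff ℝ ∞ a) :
    SmoothInTime (fun t (_ : Torus d) => a t) := ha.comp contDiff_fst

theorem SmoothInTime.of_space {a : Torus d → ℝ} (ha : SmoothOnTorus a) :
    SmoothInTime (fun _ x => a x) :=
  ContDiff.comp (g := fun y : Fin d → ℝ => a (Torus.proj d y)) ha contDiff_snd

theorem SmoothInTime.comp_pi {u : Fin d → ℝ → Torus d → ℝ} {χ : (Fin d → ℝ) → ℝ}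
    (hχ : ContDiff ℝ ∞ χ) (hu : ∀ i, SmoothInTime (u i)) :
    SmoothInTime (fun t x => χ (fun i => u i t x)) :=
  hχ.comp (contDiff_pi.2 hu)

theorem SmoothInTime.slice (hf : SmoothInTime f) (t : ℝ) : SmoothOnTorus (f t) :=
  ContDiff.comp (g := fun z : ℝ × (Fin d → ℝ) => f z.1 (Torus.proj d z.2)) hf
    (contDiff_prodMk_right t)

theorem SmoothInTime.continuous (hf : SmoothInTime f) :
    Continuous (fun z : ℝ × Torus d => f z.1 z.2) :=
  ((IsOpenQuotientMap.id (X := ℝ)).prodMap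
    (Torus.isOpenQuotientMap_proj d)).isQuotientMap.continuous_iff.2 (ContDiff.continuous hf)

theorem SmoothInTime.hasDerivAt (hf : SmoothInTime f) (t : ℝ) (x : Torus d) :
    HasDerivAt (fun s => f s x) (timePartial f t x) t := by
  obtain ⟨y, rfl⟩ := Torus.proj_surjective d x
  have : Differentiable ℝ (fun s => f s (Torus.proj d y)) :=
    (ContDiff.comp (g := fun z : ℝ × (Fin d → ℝ) => f z.1 (Torus.proj d z.2)) hf
      (contDiff_prodMk_left y)).differentiable (by simp)
  exact (this t).hasDerivAt

theorem timePartial_proj (hf : SmoothInTime f) (t : ℝ) (y : Fin d → ℝ) :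
    timePartial f t (Torus.proj d y) =
      fderiv ℝ (fun z : ℝ × (Fin d → ℝ) => f z.1 (Torus.proj d z.2)) (t, y) (1, 0) := by
  have h1 := ((ContDiff.differentiable hf (by simp)) (t, y)).hasFDerivAt
  have h2 : HasDerivAt (fun s : ℝ => (s, y)) ((1 : ℝ), (0 : Fin d → ℝ)) t :=
    (hasDerivAt_id t).prodMk (hasDerivAt_const t y)
  exact (h1.comp_hasDerivAt t h2).deriv

theorem torusPartial_slice_proj (hf : SmoothInTime f) (i : Fin d) (t : ℝ) (y : Fin d → ℝ) :
    torusPartial i (f t) (Torus.proj d y) =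
      fderiv ℝ (fun z : ℝ × (Fin d → ℝ) => f z.1 (Torus.proj d z.2)) (t, y) (0, Pi.single i 1) := by
  have h1 := ((ContDiff.differentiable hf (by simp)) (t, y)).hasFDerivAt
  have h2 : HasFDerivAt (fun y : Fin d → ℝ => (t, y))
      ((0 : (Fin d → ℝ) →L[ℝ] ℝ).prod (.id ℝ _)) y :=
    (hasFDerivAt_const t y).prodMk (hasFDerivAt_id y)
  have h3 : HasFDerivAt (fun y => f t (Torus.proj d y)) _ y := h1.comp y h2
  rw [torusPartial_proj (hf.slice t), h3.fderiv]
  simp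

theorem SmoothInTime.timePartial (hf : SmoothInTime f) : SmoothInTime (timePartial f) := by
  have : (fun z : ℝ × (Fin d → ℝ) => _root_.timePartial f z.1 (Torus.proj d z.2)) = fun z =>
      fderiv ℝ (fun z : ℝ × (Fin d → ℝ) => f z.1 (Torus.proj d z.2)) z (1, 0) :=
    funext fun z => timePartial_proj hf z.1 z.2
  unfold SmoothInTime
  rw [this]
  exact (ContDiff.fderiv_right hf (m := ∞) (by simp)).clm_apply contDiff_const

theorem SmoothInTime.torusPartial (hf : SmoothInTime f) (i : Fin d) :
    SmoothInTime (fun t => torusPartial i (f t)) := by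
  have : (fun z : ℝ × (Fin d → ℝ) => _root_.torusPartial i (f z.1) (Torus.proj d z.2)) = fun z =>
      fderiv ℝ (fun z : ℝ × (Fin d → ℝ) => f z.1 (Torus.proj d z.2)) z (0, Pi.single i 1) :=
    funext fun z => torusPartial_slice_proj hf i z.1 z.2
  unfold SmoothInTime
  rw [this]
  exact (ContDiff.fderiv_right hf (m := ∞) (by simp)).clm_apply contDiff_const

/-- Partial derivatives in time and in space commute. -/
theorem timePartial_torusPartial (hf : SmoothInTime f) (i : Fin d) (t : ℝ) (x : Torus d) :
    timePartial (fun t => torusPartial i (f t)) t x = torusPartial i (timePartial f t) x := by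
  obtain ⟨y, rfl⟩ := Torus.proj_surjective d x
  rw [timePartial_proj (hf.torusPartial i), torusPartial_slice_proj hf.timePartial]
  set F := fun z : ℝ × (Fin d → ℝ) => f z.1 (Torus.proj d z.2) with hF
  have e1 : (fun z : ℝ × (Fin d → ℝ) => torusPartial i (f z.1) (Torus.proj d z.2)) = fun z =>
      fderiv ℝ F z (0, Pi.single i 1) := funext fun z => torusPartial_slice_proj hf i z.1 z.2
  have e2 : (fun z : ℝ × (Fin d → ℝ) => timePartial f z.1 (Torus.proj d z.2)) = fun z =>
      fderiv ℝ F z (1, 0) := funext fun z => timePartial_proj hf z.1 z.2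
  have hd : DifferentiableAt ℝ (fderiv ℝ F) (t, y) :=
    (ContDiff.fderiv_right hf (m := ∞) (by simp)).differentiable (by simp) (t, y)
  rw [e1, e2, fderiv_clm_apply hd (by fun_prop), fderiv_clm_apply hd (by fun_prop)]
  have hs : IsSymmSndFDerivAt ℝ F (t, y) :=
    (ContDiff.contDiffAt hf).isSymmSndFDerivAt
      (by simpa using WithTop.coe_le_coe.2 (le_top : (2 : ℕ∞) ≤ ⊤))
  simpa using hs.eq (1, 0) (0, Pi.single i 1)

/-- Partial derivatives in space commute. -/
theorem torusPartial_comm {f : Torus d → ℝ} (hf : SmoothOnTorus f) (i j : Fin d) (x : Torus d) :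
    torusPartial i (torusPartial j f) x = torusPartial j (torusPartial i f) x := by
  obtain ⟨y, rfl⟩ := Torus.proj_surjective d x
  rw [torusPartial_proj (hf.torusPartial j), torusPartial_proj (hf.torusPartial i)]
  set F := fun y : Fin d → ℝ => f (Torus.proj d y) with hF
  have e : ∀ i, (fun y : Fin d → ℝ => torusPartial i f (Torus.proj d y)) = fun y =>
      fderiv ℝ F y (Pi.single i 1) := fun i => funext fun y => torusPartial_proj hf i y
  have hd : DifferentiableAt ℝ (fderiv ℝ F) y :=
    (ContDiff.fderiv_right hf (m := ∞) (by simp)).differentiable (by simp) y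
  rw [e, e, fderiv_clm_apply hd (by fun_prop), fderiv_clm_apply hd (by fun_prop)]
  have hs : IsSymmSndFDerivAt ℝ F y := (ContDiff.contDiffAt hf).isSymmSndFDerivAt
      (by simpa using WithTop.coe_le_coe.2 (le_top : (2 : ℕ∞) ≤ ⊤))
  simpa using hs.eq (Pi.single i 1) (Pi.single j 1)

theorem timePartial_add (hf : SmoothInTime f) (hg : SmoothInTime g) (t : ℝ) (x : Torus d) :
    timePartial (fun t x => f t x + g t x) t x = timePartial f t x + timePartial g t x :=
  ((hf.hasDerivAt t x).add (hg.hasDerivAt t x)).deriv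

theorem timePartial_mul (hf : SmoothInTime f) (hg : SmoothInTime g) (t : ℝ) (x : Torus d) :
    timePartial (fun t x => f t x * g t x) t x =
      timePartial f t x * g t x + f t x * timePartial g t x := by
  exact ((hf.hasDerivAt t x).mul (hg.hasDerivAt t x)).deriv

theorem timePartial_const_mul (c : ℝ) (hf : SmoothInTime f) (t : ℝ) (x : Torus d) :
    timePartial (fun t x => c * f t x) t x = c * timePartial f t x :=
  ((hf.hasDerivAt t x).const_mul c).deriv

theorem timePartial_sum {ι : Type*} {s : Finset ι} {f : ι → ℝ → Torus d → ℝ}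
    (hf : ∀ k ∈ s, SmoothInTime (f k)) (t : ℝ) (x : Torus d) :
    timePartial (fun t x => ∑ k ∈ s, f k t x) t x = ∑ k ∈ s, timePartial (f k) t x :=
  (HasDerivAt.fun_sum fun k hk => (hf k hk).hasDerivAt t x).deriv

theorem SmoothInTime.exists_bound (hf : SmoothInTime f) :
    ∃ C, 0 ≤ C ∧ ∀ t ∈ Icc (0 : ℝ) 1, ∀ x, |f t x| ≤ C := by
  obtain ⟨C, hC⟩ := (isCompact_Icc (a := (0 : ℝ)) (b := 1)).prod
    (isCompact_univ (X := Torus d)) |>.exists_bound_of_continuousOn hf.continuous.continuousOn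
  refine ⟨max C 0, le_max_right _ _, fun t ht x => ?_⟩
  exact (hC (t, x) ⟨ht, trivial⟩).trans (le_max_left _ _)

/-- A smooth function is Lipschitz in space, uniformly in the times `0 ≤ t ≤ 1`. -/
theorem SmoothInTime.exists_lipschitz (hf : SmoothInTime f) :
    ∃ L, 0 ≤ L ∧ ∀ t ∈ Icc (0 : ℝ) 1, ∀ (x : Torus d) (v : Fin d → ℝ), ‖v‖ ≤ 1 →
      |f t (x + Torus.proj d v) - f t x| ≤ L * ‖v‖ := by
  set F := fun z : ℝ × (Fin d → ℝ) => f z.1 (Torus.proj d z.2) with hF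
  have hc : Continuous (fun z => fderiv ℝ F z) := ContDiff.continuous_fderiv hf (by simp)
  set K : Set (ℝ × (Fin d → ℝ)) := Icc (0 : ℝ) 1 ×ˢ Metric.closedBall 0 2 with hK
  obtain ⟨C, hC⟩ := (isCompact_Icc.prod (isCompact_closedBall _ _) : IsCompact K)
    |>.exists_bound_of_continuousOn hc.continuousOn
  have hconv : Convex ℝ K := (convex_Icc _ _).prod (convex_closedBall _ _)
  refine ⟨max C 0, le_max_right _ _, fun t ht x v hv => ?_⟩
  obtain ⟨y, hy, rfl⟩ := Torus.exists_proj_eq x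
  have h1 : ((t, y) : ℝ × (Fin d → ℝ)) ∈ K := ⟨ht, by simpa using hy.trans one_le_two⟩
  have h2 : ((t, y + v) : ℝ × (Fin d → ℝ)) ∈ K :=
    ⟨ht, by simpa using (norm_add_le y v).trans (by linarith)⟩
  have := hconv.norm_image_sub_le_of_norm_fderiv_le
    (fun z _ => (ContDiff.differentiable hf (by simp)) z)
    (fun z hz => (hC z hz).trans (le_max_left C 0)) h1 h2
  simpa [hF, Torus.proj_add, Prod.norm_def] using this

end SpaceTime

/-! ### Inverting the divergence on the torus -/

section Antidivergence

variable {d : ℕ}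

/-- `f` does not depend on the coordinate `x_j`. -/
def InvariantAlong (j : Fin d) (f : Torus d → ℝ) : Prop :=
  ∀ (x : Torus d) (s : UnitAddCircle), f (x + Pi.single j s) = f x

theorem InvariantAlong.torusPartial_eq_zero {j : Fin d} {f : Torus d → ℝ}
    (h : InvariantAlong j f) (x : Torus d) : torusPartial j f x = 0 := by
  simp [torusPartial, h x]

/-- The average of `f` against the weight `K` along the `k`-th coordinate circle through `x`. -/
noncomputable def lineAverage (K : ℝ → ℝ) (k : Fin d) (f : Torus d → ℝ) (x : Torus d) : ℝ :=
  ∫ h in (0 : ℝ)..1, K h * f (x + Pi.single k (h : UnitAddCircle))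

theorem continuous_add_single (k : Fin d) :
    Continuous fun z : Torus d × ℝ => z.1 + Pi.single k (z.2 : UnitAddCircle) := by
  have h1 : Continuous fun z : Torus d × ℝ => (z.2 : UnitAddCircle) :=
    (AddCircle.continuous_mk' (1 : ℝ)).comp continuous_snd
  exact continuous_fst.add ((continuous_single k).comp h1)

theorem SmoothOnTorus.lineAverage {K : ℝ → ℝ} (hK : Continuous K) (k : Fin d) {f : Torus d → ℝ}
    (hf : SmoothOnTorus f) : SmoothOnTorus (lineAverage K k f) := by
  -- a compactly supported cutoff equal to one on `[-1, 1]` turns the average into a convolution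
  let χ : ContDiffBump (0 : ℝ) := ⟨1, 2, one_pos, one_lt_two⟩
  set F := fun y : Fin d → ℝ => f (Torus.proj d y) with hF
  have hFs : ContDiff ℝ ∞ F := hf
  have key := contDiffOn_convolution_right_with_param_comp (𝕜 := ℝ) (n := ⊤) (μ := volume)
    (ContinuousLinearMap.mul ℝ ℝ) (s := univ) (v := fun _ : Fin d → ℝ => (0 : ℝ))
    (f := (Ioc (0 : ℝ) 1).indicator K)
    (g := fun (y : Fin d → ℝ) (s : ℝ) => χ s * F (y - s • Pi.single k 1))
    (k := Metric.closedBall 0 2) contDiffOn_const isOpen_univ (isCompact_closedBall _ _)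
    (fun p x _ hx => by
      have : χ x = 0 := χ.zero_of_le_dist (by
        rw [Metric.mem_closedBall, not_le] at hx
        exact hx.le)
      simp [this])
    ((hK.locallyIntegrable).indicator measurableSet_Ioc)
    (by
      apply ContDiff.contDiffOn
      have h1 : ContDiff ℝ ∞ fun z : (Fin d → ℝ) × ℝ => z.1 - z.2 • (Pi.single k 1 : Fin d → ℝ) :=
        contDiff_fst.sub (contDiff_snd.smul contDiff_const)
      exact (χ.contDiff.comp contDiff_snd).mul (hFs.comp h1))
  rw [contDiffOn_univ] at key
  unfold SmoothOnTorus
  convert key using 1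
  funext y
  simp only [_root_.lineAverage, convolution_def, ContinuousLinearMap.mul_apply', zero_sub]
  rw [intervalIntegral.integral_of_le zero_le_one, ← integral_indicator measurableSet_Ioc]
  congr 1
  funext h
  by_cases hh : h ∈ Ioc (0 : ℝ) 1
  · have : χ (-h) = 1 := χ.one_of_mem_closedBall (by
      simp only [Metric.mem_closedBall, dist_zero_right, norm_neg, Real.norm_eq_abs]
      exact abs_le.2 ⟨by linarith [hh.1], hh.2⟩)
    simp only [indicator_of_mem hh, this, one_mul, hF, neg_smul, sub_neg_eq_add, Torus.proj_add,
      Torus.proj_smul_single]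
  · simp [indicator_of_notMem hh]

theorem InvariantAlong.lineAverage {K : ℝ → ℝ} {j k : Fin d} {f : Torus d → ℝ}
    (h : InvariantAlong j f) : InvariantAlong j (lineAverage K k f) := by
  intro x s
  simp only [_root_.lineAverage, add_right_comm x (Pi.single j s), h _ s]

theorem invariantAlong_lineAverage_one (k : Fin d) (f : Torus d → ℝ) :
    InvariantAlong k (lineAverage (fun _ => 1) k f) := by
  have key : ∀ x, lineAverage (fun _ => 1) k f x = ∫ h : UnitAddCircle, f (x + Pi.single k h) := by
    intro x
    simp only [lineAverage, one_mul]
    simpa using UnitAddCircle.intervalIntegral_preimage 0 fun h => f (x + Pi.single k h)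
  intro x s
  simp only [key, add_assoc, ← Pi.single_add]
  exact integral_add_left_eq_self (μ := (volume : Measure UnitAddCircle))
    (fun h : UnitAddCircle => f (x + Pi.single k h)) s

/-- The weight `h - 1/2` gives the periodic primitive of `f` minus its average. -/
theorem torusPartial_lineAverage {f : Torus d → ℝ} (hf : SmoothOnTorus f) (k : Fin d)
    (x : Torus d) : torusPartial k (lineAverage (fun h => h - 1 / 2) k f) x =
      f x - lineAverage (fun _ => 1) k f x := by
  set φ : ℝ → ℝ := fun r => f (x + Pi.single k (r : UnitAddCircle)) with hφ
  have hc : Continuous φ := hf.continuous.comp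
    ((continuous_add_single k).comp (continuous_const.prodMk continuous_id))
  have hper : Function.Periodic φ 1 := fun r => by
    simp only [hφ]
    congr 3
    exact AddCircle.coe_add_period 1 r
  set A : ℝ := ∫ h in (0 : ℝ)..1, φ h with hA
  set Q : ℝ → ℝ := fun s => ∫ r in (0 : ℝ)..s, r * φ r with hQ
  have hqc : Continuous fun r : ℝ => r * φ r := continuous_id.mul hc
  have hQd : ∀ s, HasDerivAt Q (s * φ s) s := fun s =>
    intervalIntegral.integral_hasDerivAt_right (hqc.intervalIntegrable _ _)
      hqc.aestronglyMeasurable.stronglyMeasurableAtFilter hqc.continuousAt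
  have e : ∀ s : ℝ, lineAverage (fun h => h - 1 / 2) k f (x + Pi.single k (s : UnitAddCircle)) =
      Q (s + 1) - Q s - (s + 1 / 2) * A := by
    intro s
    have h1 : lineAverage (fun h => h - 1 / 2) k f (x + Pi.single k (s : UnitAddCircle)) =
        ∫ h in (0 : ℝ)..1, (fun r => r * φ r - (s + 1 / 2) * φ r) (s + h) := by
      unfold lineAverage
      congr 1
      funext h
      simp only [hφ, add_assoc, ← Pi.single_add, ← AddCircle.coe_add]
      ring
    have h2 : ∫ r in s..(s + 1), φ r = A := by
      rw [hper.intervalIntegral_add_eq s 0, zero_add]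
    have h3 : IntervalIntegrable (fun r => (s + 1 / 2) * φ r) volume s (s + 1) :=
      (continuous_const.mul hc).intervalIntegrable _ _
    rw [h1, intervalIntegral.integral_comp_add_left (fun r => r * φ r - (s + 1 / 2) * φ r),
      add_zero, intervalIntegral.integral_sub (hqc.intervalIntegrable _ _) h3,
      intervalIntegral.integral_const_mul, h2,
      ← intervalIntegral.integral_interval_sub_left (hqc.intervalIntegrable 0 (s + 1))
        (hqc.intervalIntegrable 0 s)]
  apply torusPartial_eq_of_hasDerivAt
  simp only [e]
  have h1 : HasDerivAt (fun s => Q (s + 1)) ((0 + 1) * φ (0 + 1)) 0 :=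
    (hQd (0 + 1)).comp_add_const 0 1
  have h2 := (h1.sub (hQd 0)).sub (((hasDerivAt_id (0 : ℝ)).add_const (1 / 2)).mul_const A)
  have h3 : φ (0 + 1) = f x := by
    rw [hper 0]; simp [hφ]
  have h4 : lineAverage (fun _ => 1) k f x = A := by simp [lineAverage, hA, hφ]
  rw [h4]
  have h5 : HasDerivAt (fun s => Q (s + 1) - Q s - (s + 1 / 2) * A) _ 0 := h2
  convert h5 using 1
  rw [h3]
  ring

theorem integrable_lineAverage_kernel {K : ℝ → ℝ} (hK : Continuous K) (k : Fin d)
    {f : Torus d → ℝ} (hf : Continuous f) :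
    Integrable (fun z : Torus d × ℝ => K z.2 * f (z.1 + Pi.single k (z.2 : UnitAddCircle)))
      (volume.prod (volume.restrict (Ioc (0 : ℝ) 1))) := by
  have hc : Continuous (fun z : Torus d × ℝ =>
      K z.2 * f (z.1 + Pi.single k (z.2 : UnitAddCircle))) :=
    (hK.comp continuous_snd).mul (hf.comp (continuous_add_single k))
  have h1 := (isCompact_univ (X := Torus d)).prod (isCompact_Icc (a := (0 : ℝ)) (b := 1))
  have h2 : IntegrableOn (fun z : Torus d × ℝ =>
      K z.2 * f (z.1 + Pi.single k (z.2 : UnitAddCircle))) (univ ×ˢ Icc (0 : ℝ) 1)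
      (volume.prod volume) := hc.continuousOn.integrableOn_compact h1
  rw [IntegrableOn, ← Measure.prod_restrict, Measure.restrict_univ] at h2
  exact h2.mono_measure (Measure.prod_mono le_rfl (Measure.restrict_mono Ioc_subset_Icc_self le_rfl))

theorem integral_lineAverage {K : ℝ → ℝ} (hK : Continuous K) (k : Fin d) {f : Torus d → ℝ}
    (hf : Continuous f) :
    ∫ x, lineAverage K k f x = (∫ h in (0 : ℝ)..1, K h) * ∫ x, f x := by
  simp only [lineAverage, intervalIntegral.integral_of_le zero_le_one]
  rw [integral_integral_swap (integrable_lineAverage_kernel hK k hf), ← integral_mul_const]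
  congr 1
  funext h
  rw [integral_const_mul]
  congr 1
  exact integral_add_right_eq_self f (Pi.single k (h : UnitAddCircle))

theorem integral_abs_lineAverage_le {K : ℝ → ℝ} (hK : Continuous K)
    (hK1 : ∀ h ∈ Icc (0 : ℝ) 1, |K h| ≤ 1) (k : Fin d) {f : Torus d → ℝ} (hf : SmoothOnTorus f) :
    ∫ x, |lineAverage K k f x| ≤ ∫ x, |f x| := by
  have hfa : Continuous fun x => |f x| := hf.continuous.abs
  have h1 : ∀ x, |lineAverage K k f x| ≤ lineAverage (fun _ => 1) k (fun x => |f x|) x := by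
    intro x
    have hc : ∀ {g : Torus d → ℝ}, Continuous g →
        Continuous fun h : ℝ => g (x + Pi.single k (h : UnitAddCircle)) := fun hg =>
      hg.comp ((continuous_add_single k).comp (continuous_const.prodMk continuous_id))
    refine (intervalIntegral.abs_integral_le_integral_abs zero_le_one).trans ?_
    refine intervalIntegral.integral_mono_on zero_le_one
      ((hK.mul (hc hf.continuous)).abs.intervalIntegrable _ _)
      ((continuous_const.mul (hc hfa)).intervalIntegrable _ _) fun h hh => ?_
    rw [abs_mul]
    exact mul_le_mul_of_nonneg_right (hK1 h hh) (abs_nonneg _)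
  calc ∫ x, |lineAverage K k f x|
      ≤ ∫ x, lineAverage (fun _ => 1) k (fun x => |f x|) x := by
        refine integral_mono (hf.lineAverage hK k).integrable.abs ?_ h1
        have := (integrable_lineAverage_kernel (K := fun _ => 1) continuous_const k hfa)
          |>.integral_prod_left
        have e : lineAverage (fun _ => 1) k (fun x => |f x|) = fun x =>
            ∫ h in Ioc (0 : ℝ) 1, 1 * |f (x + Pi.single k (h : UnitAddCircle))| :=
          funext fun x => intervalIntegral.integral_of_le zero_le_one
        rw [e]
        exact this
    _ = ∫ x, |f x| := by
        rw [integral_lineAverage continuous_const k hfa]; simp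

/-- Removing the averages over the coordinates in `S` one after the other writes a smooth function
as a divergence plus a function independent of these coordinates. -/
theorem exists_antidivergence_finset (S : Finset (Fin d)) {f : Torus d → ℝ}
    (hf : SmoothOnTorus f) : ∃ (V : Fin d → Torus d → ℝ) (g : Torus d → ℝ),
      (∀ i, SmoothOnTorus (V i)) ∧ SmoothOnTorus g ∧
      (∀ x, ∑ i, torusPartial i (V i) x + g x = f x) ∧
      (∀ i, ∫ x, |V i x| ≤ ∫ x, |f x|) ∧ ∫ x, |g x| ≤ ∫ x, |f x| ∧ ∫ x, g x = ∫ x, f x ∧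
      (∀ j ∈ S, InvariantAlong j g) ∧ (∀ i ∉ S, V i = 0) ∧
      (∀ j, InvariantAlong j f →
        (∀ i, InvariantAlong j (V i)) ∧ InvariantAlong j g) := by
  induction S using Finset.induction_on with
  | empty =>
    refine ⟨fun _ _ => 0, f, fun _ => SmoothOnTorus.const 0, hf, fun x => ?_, fun i => ?_, le_rfl,
      rfl, by simp, fun _ _ => rfl, fun j hj => ⟨fun _ _ _ => rfl, hj⟩⟩
    · simp [torusPartial_const]
    · simpa using integral_nonneg fun x => abs_nonneg (f x)
  | insert k S hk ih =>
    obtain ⟨V, g, hV, hg, hdiv, hVb, hgb, hgm, hginv, hV0, hinv⟩ := ih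
    have hK : Continuous fun h : ℝ => h - 1 / 2 := by fun_prop
    have hK1 : ∀ h ∈ Icc (0 : ℝ) 1, |h - 1 / 2| ≤ 1 := fun h hh =>
      abs_le.2 ⟨by linarith [hh.1], by linarith [hh.2]⟩
    refine ⟨Function.update V k (lineAverage (fun h => h - 1 / 2) k g),
      lineAverage (fun _ => 1) k g, fun i => ?_, hg.lineAverage continuous_const k, fun x => ?_,
      fun i => ?_, ?_, ?_, fun j hj => ?_, fun i hi => ?_, fun j hj => ⟨fun i => ?_, ?_⟩⟩
    · by_cases hi : i = k
      · subst hi; simpa using hg.lineAverage hK i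
      · simpa [Function.update_of_ne hi] using hV i
    · rw [← hdiv x, Fintype.sum_eq_add_sum_compl k, Fintype.sum_eq_add_sum_compl k]
      have h1 : ∑ i ∈ {k}ᶜ, torusPartial i
          (Function.update V k (lineAverage (fun h => h - 1 / 2) k g) i) x =
          ∑ i ∈ {k}ᶜ, torusPartial i (V i) x := by
        refine Finset.sum_congr rfl fun i hi => ?_
        rw [Function.update_of_ne (by simpa using hi)]
      rw [h1, Function.update_self, torusPartial_lineAverage hg, hV0 k hk]
      have : torusPartial k (0 : Torus d → ℝ) x = 0 := torusPartial_const k 0 x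
      rw [this]; ring
    · by_cases hi : i = k
      · subst hi
        simpa using (integral_abs_lineAverage_le hK hK1 i hg).trans hgb
      · simpa [Function.update_of_ne hi] using hVb i
    · exact (integral_abs_lineAverage_le continuous_const (by simp) k hg).trans hgb
    · rw [integral_lineAverage continuous_const k hg.continuous]; simpa using hgm
    · rcases Finset.mem_insert.1 hj with rfl | hj
      · exact invariantAlong_lineAverage_one j g
      · exact (hginv j hj).lineAverage
    · rw [Finset.mem_insert, not_or] at hi
      rw [Function.update_of_ne hi.1, hV0 i hi.2]
    · by_cases hi : i = k
      · subst hi; simpa using (hinv j hj).2.lineAverage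
      · simpa [Function.update_of_ne hi] using (hinv j hj).1 i
    · exact (hinv j hj).2.lineAverage

theorem eq_of_forall_invariantAlong {g : Torus d → ℝ} (h : ∀ j, InvariantAlong j g)
    (x : Torus d) : g x = g 0 := by
  have key : ∀ s : Finset (Fin d), g (∑ j ∈ s, Pi.single j (x j)) = g 0 := by
    intro s
    induction s using Finset.induction_on with
    | empty => simp
    | insert k s hk ih => rw [Finset.sum_insert hk, add_comm, h k, ih]
  simpa [Finset.univ_sum_single] using key Finset.univ

/-- A smooth function of mean zero is a divergence, with bounds in `L¹`. If it does not depend on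
`x_j`, neither does the vector field. -/
theorem exists_antidivergence {f : Torus d → ℝ} (hf : SmoothOnTorus f) (h0 : ∫ x, f x = 0) :
    ∃ V : Fin d → Torus d → ℝ, (∀ i, SmoothOnTorus (V i)) ∧
      (∀ x, ∑ i, torusPartial i (V i) x = f x) ∧
      (∀ i, ∫ x, |V i x| ≤ ∫ x, |f x|) ∧
      (∀ j, InvariantAlong j f → ∀ i, InvariantAlong j (V i)) := by
  obtain ⟨V, g, hV, hg, hdiv, hVb, hgb, hgm, hginv, hV0, hinv⟩ :=
    exists_antidivergence_finset Finset.univ hf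
  have hconst : ∀ x, g x = g 0 :=
    eq_of_forall_invariantAlong fun j => hginv j (Finset.mem_univ j)
  have hg0 : g 0 = 0 := by
    have : ∫ x, g x = g 0 := by simp [hconst]
    rw [← this, hgm, h0]
  refine ⟨V, hV, fun x => ?_, hVb, fun j hj => (hinv j hj).1⟩
  simpa [hconst x, hg0] using hdiv x

end Antidivergence

/-! ### Concentrated periodic profiles -/

/-- The function `y ↦ g (μ y)` on `[-1/2, 1/2]`, extended periodically: for `g` supported near the
origin, a copy of `g` concentrated at scale `1 / μ` on the circle. -/
noncomputable def concentrate (μ : ℝ) (g : ℝ → ℝ) : UnitAddCircle → ℝ :=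
  Function.Periodic.lift (f := fun y : ℝ => g (μ * (y - round y))) (c := (1 : ℝ)) fun y => by
    simp [round_add_one]

theorem concentrate_coe (μ : ℝ) (g : ℝ → ℝ) (y : ℝ) :
    concentrate μ g (y : UnitAddCircle) = g (μ * (y - round y)) := rfl

theorem concentrate_mul (μ : ℝ) (g h : ℝ → ℝ) (x : UnitAddCircle) :
    concentrate μ (fun y => g y * h y) x = concentrate μ g x * concentrate μ h x := by
  induction x using QuotientAddGroup.induction_on; rfl

theorem concentrate_abs (μ : ℝ) (g : ℝ → ℝ) (x : UnitAddCircle) :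
    concentrate μ (fun y => |g y|) x = |concentrate μ g x| := by
  induction x using QuotientAddGroup.induction_on; rfl

section Concentrate

variable {μ : ℝ} {g : ℝ → ℝ}

theorem concentrate_eq (hμ : 1 ≤ μ) (hg : ∀ y, 1 / 4 ≤ |y| → g y = 0) {y : ℝ} {n : ℤ}
    (hy : |y - (n : ℝ)| < 3 / 4) : concentrate μ g (y : UnitAddCircle) = g (μ * (y - n)) := by
  rw [concentrate_coe]
  have hz : ∀ z : ℝ, 1 / 4 ≤ |z| → g (μ * z) = 0 := fun z hz => hg _ (by
    rw [abs_mul, abs_of_pos (by linarith)]; nlinarith [abs_nonneg z])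
  by_cases hn : round y = n
  · rw [hn]
  · have h1 : (1 : ℝ) ≤ |(round y : ℝ) - n| := by
      have : (1 : ℤ) ≤ |round y - n| := Int.one_le_abs (sub_ne_zero.2 hn)
      exact_mod_cast this
    have h2 := abs_sub_round y
    have h3 : |(round y : ℝ) - n| ≤ |y - round y| + |y - n| := by
      rw [abs_sub_comm y (round y)]; exact abs_sub_le _ _ _
    rw [hz _ (by linarith), hz _ (by linarith)]

theorem exists_abs_sub_lt (y : ℝ) : ∃ n : ℤ, ∀ᶠ z : ℝ in 𝓝 y, |z - (n : ℝ)| < 3 / 4 := by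
  refine ⟨round y, ?_⟩
  have h1 : Continuous fun z : ℝ => |z - round y| := by fun_prop
  have h2 : |y - round y| < 3 / 4 := (abs_sub_round y).trans_lt (by norm_num)
  exact h1.continuousAt.eventually_lt continuousAt_const h2

theorem contDiff_concentrate (hμ : 1 ≤ μ) (hg : ∀ y, 1 / 4 ≤ |y| → g y = 0)
    (hs : ContDiff ℝ ∞ g) : ContDiff ℝ ∞ fun y : ℝ => concentrate μ g (y : UnitAddCircle) := by
  rw [contDiff_iff_contDiffAt]
  intro y
  obtain ⟨n, hn⟩ := exists_abs_sub_lt y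
  have : ContDiff ℝ ∞ fun z : ℝ => g (μ * (z - n)) :=
    hs.comp (contDiff_const.mul (contDiff_id.sub contDiff_const))
  exact this.contDiffAt.congr_of_eventuallyEq (hn.mono fun z hz => concentrate_eq hμ hg hz)

theorem hasDerivAt_concentrate (hμ : 1 ≤ μ) (hg : ∀ y, 1 / 4 ≤ |y| → g y = 0)
    (hg' : ∀ y, 1 / 4 ≤ |y| → deriv g y = 0) (hs : ContDiff ℝ ∞ g) (y : ℝ) :
    HasDerivAt (fun y : ℝ => concentrate μ g (y : UnitAddCircle))
      (μ * concentrate μ (deriv g) (y : UnitAddCircle)) y := by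
  obtain ⟨n, hn⟩ := exists_abs_sub_lt y
  have h1 : HasDerivAt (fun z : ℝ => g (μ * (z - n))) (deriv g (μ * (y - n)) * (μ * 1)) y :=
    ((hs.differentiable (by simp)) _).hasDerivAt.comp y
      (((hasDerivAt_id y).sub_const (n : ℝ)).const_mul μ)
  rw [concentrate_eq hμ hg' hn.self_of_nhds, mul_comm]
  rw [mul_one] at h1
  exact h1.congr_of_eventuallyEq (hn.mono fun z hz => concentrate_eq hμ hg hz)

theorem integral_concentrate (hμ : 1 ≤ μ) (hg : ∀ y, 1 / 4 ≤ |y| → g y = 0) :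
    ∫ x, concentrate μ g x = μ⁻¹ * ∫ y, g y := by
  have h0 : (0 : ℝ) < μ := by linarith
  rw [← UnitAddCircle.intervalIntegral_preimage (-(1 / 2)) (concentrate μ g)]
  have h1 : ∫ a in (-(1 / 2) : ℝ)..(-(1 / 2) + 1), concentrate μ g (a : UnitAddCircle) =
      ∫ a in (-(1 / 2) : ℝ)..(-(1 / 2) + 1), g (μ * a) := by
    refine intervalIntegral.integral_congr fun a ha => ?_
    rw [uIcc_of_le (by norm_num)] at ha
    have := concentrate_eq (n := 0) hμ hg (y := a)
      (by rw [Int.cast_zero, sub_zero, abs_lt]; constructor <;> linarith [ha.1, ha.2])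
    simpa using this
  rw [h1, intervalIntegral.integral_comp_mul_left _ h0.ne', smul_eq_mul]
  congr 1
  refine intervalIntegral.integral_eq_integral_of_support_subset fun y hy => ?_
  have h2 : |y| < 1 / 4 := by
    by_contra h
    exact hy (hg y (not_lt.1 h))
  rw [abs_lt] at h2
  constructor <;> nlinarith [h2.1, h2.2]

theorem norm_lt_of_concentrate_ne_zero (hμ : 1 ≤ μ) (hg : ∀ y, 1 / 4 ≤ |y| → g y = 0)
    {x : UnitAddCircle} (hx : concentrate μ g x ≠ 0) : ‖x‖ < μ⁻¹ := by
  have h0 : (0 : ℝ) < μ := by linarith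
  induction x using QuotientAddGroup.induction_on with
  | H y =>
    change concentrate μ g (y : UnitAddCircle) ≠ 0 at hx
    change ‖(y : UnitAddCircle)‖ < μ⁻¹
    rw [UnitAddCircle.norm_eq]
    rw [concentrate_coe] at hx
    have h1 : |μ * (y - round y)| < 1 / 4 := by
      by_contra h
      exact hx (hg _ (not_lt.1 h))
    rw [abs_mul, abs_of_pos h0] at h1
    rw [← one_div, lt_div_iff₀ h0]
    linarith

end Concentrate

/-! ### Products of functions of one coordinate -/

section Tensor

variable {d : ℕ}

/-- The product `x ↦ ∏ᵢ gᵢ(xᵢ)` of functions of one coordinate. -/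
def tensor (g : Fin d → UnitAddCircle → ℝ) (x : Torus d) : ℝ := ∏ i, g i (x i)

theorem smoothOnTorus_tensor {g : Fin d → UnitAddCircle → ℝ}
    (hg : ∀ i, ContDiff ℝ ∞ fun y : ℝ => g i (y : UnitAddCircle)) : SmoothOnTorus (tensor g) := by
  unfold SmoothOnTorus tensor
  exact contDiff_prod fun i _ => (hg i).comp (contDiff_apply ℝ ℝ i)

theorem tensor_mul (g h : Fin d → UnitAddCircle → ℝ) (x : Torus d) :
    tensor (fun i y => g i y * h i y) x = tensor g x * tensor h x := Finset.prod_mul_distrib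

theorem integral_tensor (g : Fin d → UnitAddCircle → ℝ) :
    ∫ x, tensor g x = ∏ i, ∫ y, g i y := integral_fintype_prod_volume_eq_prod _

theorem integral_abs_tensor (g : Fin d → UnitAddCircle → ℝ) :
    ∫ x, |tensor g x| = ∏ i, ∫ y, |g i y| := by
  rw [← integral_tensor fun i y => |g i y|]
  simp [tensor, Finset.abs_prod]

theorem tensor_update_add_single (g : Fin d → UnitAddCircle → ℝ) (k : Fin d) (x : Torus d)
    (s : UnitAddCircle) : tensor g (x + Pi.single k s) =
      g k (x k + s) * ∏ i ∈ {k}ᶜ, g i (x i) := by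
  rw [tensor, Fintype.prod_eq_mul_prod_compl k]
  congr 1
  · simp
  · refine Finset.prod_congr rfl fun i hi => ?_
    have : i ≠ k := by simpa using hi
    simp [this]

theorem invariantAlong_tensor {g : Fin d → UnitAddCircle → ℝ} {j : Fin d} (hj : g j = 1) :
    InvariantAlong j (tensor g) := by
  intro x s
  have h := tensor_update_add_single g j x 0
  rw [Pi.single_zero, add_zero, hj] at h
  rw [tensor_update_add_single, h, hj]
  rfl

theorem torusPartial_tensor {g : Fin d → UnitAddCircle → ℝ} {k : Fin d} {g' : UnitAddCircle → ℝ}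
    (hg : ∀ y : ℝ, HasDerivAt (fun y : ℝ => g k (y : UnitAddCircle)) (g' (y : UnitAddCircle)) y)
    (x : Torus d) : torusPartial k (tensor g) x = tensor (Function.update g k g') x := by
  apply torusPartial_eq_of_hasDerivAt
  simp only [tensor_update_add_single]
  have h1 : tensor (Function.update g k g') x = g' (x k) * ∏ i ∈ {k}ᶜ, g i (x i) := by
    have := tensor_update_add_single (Function.update g k g') k x 0
    rw [Pi.single_zero, add_zero, add_zero, Function.update_self] at this
    rw [this]
    congr 1
    refine Finset.prod_congr rfl fun i hi => ?_
    rw [Function.update_of_ne (by simpa using hi)]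
  rw [h1]
  refine HasDerivAt.mul_const ?_ _
  obtain ⟨y, hy⟩ := QuotientAddGroup.mk_surjective (x k)
  have hy' : x k = (y : UnitAddCircle) := hy.symm
  rw [hy']
  have h2 : HasDerivAt (fun h : ℝ => g k ((y + h : ℝ) : UnitAddCircle))
      (g' ((y + 0 : ℝ) : UnitAddCircle)) 0 := (hg (y + 0)).comp_const_add y 0
  simpa using h2

end Tensor

/-! ### Stationary pipes -/

/-- The one-dimensional profiles: `ψ` for the field, and the derivative of `f` for the density. -/
theorem exists_profile_pair : ∃ ψ f : ℝ → ℝ, ContDiff ℝ ∞ ψ ∧ ContDiff ℝ ∞ f ∧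
    (∀ y, |ψ y| ≤ 1) ∧ (∀ y, 1 / 5 < |y| → ψ y = 0) ∧ (∀ y, 1 / 5 < |y| → f y = 0) ∧
    ∫ y, deriv f y * ψ y = 1 := by
  let ψ : ContDiffBump (0 : ℝ) := ⟨1 / 10, 1 / 5, by norm_num, by norm_num⟩
  have hψ0 : ∀ y : ℝ, 1 / 5 < |y| → ψ y = 0 := fun y hy =>
    ψ.zero_of_le_dist (by rw [dist_zero_right]; exact hy.le)
  have hψs : ContDiff ℝ ∞ ψ := ψ.contDiff
  have hd0 : ∀ y : ℝ, 1 / 5 < |y| → deriv ψ y = 0 := fun y hy => by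
    have : ∀ᶠ z in 𝓝 y, ψ z = 0 :=
      (continuous_abs.continuousAt.eventually_const_lt hy).mono fun z hz => hψ0 z hz
    rw [Filter.EventuallyEq.deriv_eq (f := fun _ => (0 : ℝ)) this]
    simp
  have hds : ContDiff ℝ ∞ (deriv ψ) := ((contDiff_infty_iff_deriv).1 hψs).2
  have hcs : HasCompactSupport (deriv ψ) := ψ.hasCompactSupport.deriv
  set c : ℝ := ∫ y, deriv ψ y * deriv ψ y with hc
  have hcpos : 0 < c := by
    obtain ⟨y, hy⟩ : ∃ y, deriv ψ y ≠ 0 := by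
      by_contra! h
      have h1 := is_const_of_deriv_eq_zero (hψs.differentiable (by simp)) h 0 1
      rw [hψ0 1 (by norm_num), ψ.one_of_mem_closedBall (by simp [ψ.rIn_pos.le])] at h1
      exact one_ne_zero h1
    exact Continuous.integral_pos_of_hasCompactSupport_nonneg_nonzero
      (hds.continuous.mul hds.continuous) hcs.mul_left (fun y => mul_self_nonneg _)
      (mul_self_ne_zero.2 hy)
  refine ⟨ψ, fun y => -c⁻¹ * deriv ψ y, hψs, contDiff_const.mul hds, fun y => ?_, hψ0,
    fun y hy => by simp [hd0 y hy], ?_⟩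
  · rw [abs_of_nonneg ψ.nonneg]; exact ψ.le_one
  · have hfd : Differentiable ℝ (deriv ψ) := hds.differentiable (by simp)
    have h1 : ∫ y, ψ y * deriv (deriv ψ) y = -∫ y, deriv ψ y * deriv ψ y := by
      have hcs2 : HasCompactSupport (deriv (deriv ψ)) := hcs.deriv
      have hdc : Continuous (deriv (deriv ψ)) := (((contDiff_infty_iff_deriv).1 hds).2).continuous
      exact integral_mul_deriv_eq_deriv_mul_of_integrable
        (fun y _ => (hψs.differentiable (by simp) y).hasDerivAt) (fun y _ => (hfd y).hasDerivAt)
        ((hψs.continuous.mul hdc).integrable_of_hasCompactSupport hcs2.mul_left)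
        ((hds.continuous.mul hds.continuous).integrable_of_hasCompactSupport hcs.mul_left)
        ((hψs.continuous.mul hds.continuous).integrable_of_hasCompactSupport hcs.mul_left)
    have h2 : ∀ y, deriv (fun y => -c⁻¹ * deriv ψ y) y * ψ y =
        -c⁻¹ * (ψ y * deriv (deriv ψ) y) := fun y => by
      rw [deriv_const_mul _ (hfd y)]; ring
    simp only [h2]
    rw [integral_const_mul, h1, ← hc]
    field_simp

theorem prod_update_const {d : ℕ} {α β : Type*} [CommMonoid β] (q : α → β) (a b : α) (j : Fin d) :
    ∏ i, q (Function.update (fun _ => a) j b i) = q b * q a ^ (d - 1) := by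
  rw [Fintype.prod_eq_mul_prod_compl j, Function.update_self]
  congr 1
  rw [Finset.prod_congr rfl (g := fun _ => q a) fun i hi => by
    rw [Function.update_of_ne (by simpa using hi)], Finset.prod_const, Finset.card_compl]
  simp

theorem prod_update_update_const {d : ℕ} {α β : Type*} [CommMonoid β] (q : α → β) (a b c : α)
    {j k : Fin d} (hjk : j ≠ k) :
    ∏ i, q (Function.update (Function.update (fun _ => a) j b) k c i) =
      q c * (q b * q a ^ (d - 2)) := by
  rw [Fintype.prod_eq_mul_prod_compl k, Function.update_self]
  congr 1
  rw [← Finset.mul_prod_erase _ _ (a := j) (by simpa using hjk), Function.update_of_ne hjk,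
    Function.update_self]
  congr 1
  rw [Finset.prod_congr rfl (g := fun _ => q a) fun i hi => by
    have h := Finset.mem_erase.1 hi
    rw [Function.update_of_ne (by simpa using h.2), Function.update_of_ne h.1],
    Finset.prod_const, Finset.card_erase_of_mem (by simpa using hjk), Finset.card_compl]
  simp [Nat.sub_sub]

/-- A stationary pipe in the direction `e_j`, of radius `1 / μ`: a shear flow `W e_j` of size one
and a density `Θ` with `∫ Θ W = 1`, of size one in `L¹`, both concentrated near the line where
`x_i = 0` for all `i ≠ j`. The density is the derivative in the direction `e_k` of a function `H`
which is smaller than `Θ` by a factor `μ`, and `G` is a potential for `Θ W - 1`. -/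
structure PipeProfile {d : ℕ} (M μ : ℝ) (j k : Fin d) where
  W : Torus d → ℝ
  Θ : Torus d → ℝ
  H : Torus d → ℝ
  G : Fin d → Torus d → ℝ
  smooth_W : SmoothOnTorus W
  smooth_Θ : SmoothOnTorus Θ
  smooth_H : SmoothOnTorus H
  smooth_G : ∀ i, SmoothOnTorus (G i)
  inv_W : InvariantAlong j W
  inv_Θ : InvariantAlong j Θ
  inv_G : ∀ i, InvariantAlong j (G i)
  partial_H : ∀ x, torusPartial k H x = Θ x
  div_G : ∀ x, ∑ i, torusPartial i (G i) x = Θ x * W x - 1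
  abs_W_le : ∀ x, |W x| ≤ 1
  integral_W_le : ∫ x, |W x| ≤ M * μ⁻¹ ^ (d - 1)
  abs_partial_W_le : ∀ i x, |torusPartial i W x| ≤ M * μ
  integral_partial_W_le : ∀ i, ∫ x, |torusPartial i W x| ≤ M * μ * μ⁻¹ ^ (d - 1)
  integral_Θ_le : ∫ x, |Θ x| ≤ M
  integral_H_le : ∫ x, |H x| ≤ M * μ⁻¹
  integral_G_le : ∀ i, ∫ x, |G i x| ≤ M
  support : ∀ x, W x ≠ 0 ∨ Θ x ≠ 0 ∨ H x ≠ 0 → ∀ i, i ≠ j → ‖x i‖ < μ⁻¹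

theorem tensor_apply_ne_zero {d : ℕ} {g : Fin d → UnitAddCircle → ℝ} {x : Torus d}
    (h : tensor g x ≠ 0) (i : Fin d) : g i (x i) ≠ 0 := fun h0 =>
  h (Finset.prod_eq_zero (Finset.mem_univ i) h0)

theorem abs_tensor_le {d : ℕ} {g : Fin d → UnitAddCircle → ℝ} (hg : ∀ i y, |g i y| ≤ 1)
    (x : Torus d) : |tensor g x| ≤ 1 := by
  rw [tensor, Finset.abs_prod]
  exact Finset.prod_le_one (fun i _ => abs_nonneg _) fun i _ => hg i _

/-- Pipes exist for every radius, with a constant `M` that does not depend on the radius. The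
functions `W`, `Θ`, `H` are products of rescaled profiles in the coordinates other than `x_j`. -/
theorem exists_pipeProfile (d : ℕ) : ∃ M : ℝ, 0 ≤ M ∧ ∀ μ : ℝ, 1 ≤ μ → ∀ j k : Fin d, j ≠ k →
    Nonempty (PipeProfile M μ j k) := by
  obtain ⟨ψ, f, hψ, hf, hψ1, hψ0, hf0, hψf⟩ := exists_profile_pair
  have hderiv0 : ∀ {g : ℝ → ℝ}, (∀ y, 1 / 5 < |y| → g y = 0) → ∀ y, 1 / 5 < |y| → deriv g y = 0 :=
    fun {g} hg y hy => by
      have : ∀ᶠ z in 𝓝 y, g z = 0 :=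
        (continuous_abs.continuousAt.eventually_const_lt hy).mono fun z hz => hg z hz
      rw [Filter.EventuallyEq.deriv_eq (f := fun _ => (0 : ℝ)) this]
      simp
  have hquarter : ∀ {g : ℝ → ℝ}, (∀ y, 1 / 5 < |y| → g y = 0) → ∀ y, 1 / 4 ≤ |y| → g y = 0 :=
    fun hg y hy => hg y (by linarith)
  have hψq := hquarter hψ0
  have hψdq := hquarter (hderiv0 hψ0)
  have hfq := hquarter hf0
  have hfdq := hquarter (hderiv0 hf0)
  have hψd : ContDiff ℝ ∞ (deriv ψ) := ((contDiff_infty_iff_deriv).1 hψ).2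
  have hfd : ContDiff ℝ ∞ (deriv f) := ((contDiff_infty_iff_deriv).1 hf).2
  obtain ⟨s, hs⟩ : ∃ s, ∀ y, |deriv ψ y| ≤ s := by
    refine hψd.continuous.bounded_above_of_compact_support ?_
    exact HasCompactSupport.of_support_subset_isCompact (isCompact_closedBall (0 : ℝ) 1)
      fun y hy => by
        by_contra h
        rw [Metric.mem_closedBall, dist_zero_right, not_le, Real.norm_eq_abs] at h
        exact hy (hψdq y (by linarith))
  have hs0 : 0 ≤ s := (abs_nonneg _).trans (hs 0)
  have hint : ∀ g : ℝ → ℝ, 0 ≤ ∫ y, |g y| := fun g => integral_nonneg fun y => abs_nonneg _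
  have ha0 := hint ψ
  have hb0 := hint (deriv ψ)
  have hc0 := hint (deriv f)
  have he0 := hint f
  set a := ∫ y, |ψ y| with ha
  set b := ∫ y, |deriv ψ y| with hb
  set c := ∫ y, |deriv f y| with hc
  set e := ∫ y, |f y| with he
  have p1 : 0 ≤ a ^ (d - 1) := by positivity
  have p2 : 0 ≤ b * a ^ (d - 2) := by positivity
  have p3 : 0 ≤ c ^ (d - 1) := by positivity
  have p4 : 0 ≤ e * c ^ (d - 2) := by positivity
  refine ⟨a ^ (d - 1) + b * a ^ (d - 2) + s + (c ^ (d - 1) + 1) + e * c ^ (d - 2), by positivity,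
    fun μ hμ j k hjk => ?_⟩
  set M := a ^ (d - 1) + b * a ^ (d - 2) + s + (c ^ (d - 1) + 1) + e * c ^ (d - 2) with hM
  have hμ0 : 0 < μ := by linarith
  have hd2 : d - 1 = d - 2 + 1 := by
    have : j.val ≠ k.val := fun h => hjk (Fin.ext h)
    have := j.isLt; have := k.isLt
    omega
  -- the one-dimensional factors of `W` and of `Θ`
  set A : UnitAddCircle → ℝ := concentrate μ ψ with hA
  set A' : UnitAddCircle → ℝ := fun y => μ * concentrate μ (deriv ψ) y with hA'
  set F : UnitAddCircle → ℝ := concentrate μ f with hF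
  set B : UnitAddCircle → ℝ := fun y => μ * concentrate μ (deriv f) y with hB
  have hAs : ContDiff ℝ ∞ fun y : ℝ => A (y : UnitAddCircle) := contDiff_concentrate hμ hψq hψ
  have hFs : ContDiff ℝ ∞ fun y : ℝ => F (y : UnitAddCircle) := contDiff_concentrate hμ hfq hf
  have hBs : ContDiff ℝ ∞ fun y : ℝ => B (y : UnitAddCircle) :=
    contDiff_const.mul (contDiff_concentrate hμ hfdq hfd)
  have h1s : ContDiff ℝ ∞ fun y : ℝ => (1 : UnitAddCircle → ℝ) (y : UnitAddCircle) :=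
    contDiff_const
  have hAint : ∫ y, |A y| = μ⁻¹ * a := by
    simp only [hA, ← concentrate_abs]
    exact integral_concentrate hμ fun y hy => by simp [hψq y hy]
  have hA'int : ∫ y, |A' y| = b := by
    simp only [hA', abs_mul, ← concentrate_abs]
    rw [integral_const_mul, integral_concentrate hμ fun y hy => by simp [hψdq y hy],
      abs_of_pos hμ0, mul_inv_cancel_left₀ hμ0.ne']
  have hFint : ∫ y, |F y| = μ⁻¹ * e := by
    simp only [hF, ← concentrate_abs]
    exact integral_concentrate hμ fun y hy => by simp [hfq y hy]
  have hBint : ∫ y, |B y| = c := by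
    simp only [hB, abs_mul, ← concentrate_abs]
    rw [integral_const_mul, integral_concentrate hμ fun y hy => by simp [hfdq y hy],
      abs_of_pos hμ0, mul_inv_cancel_left₀ hμ0.ne']
  have hBAint : ∫ y, B y * A y = 1 := by
    simp only [hB, hA, mul_assoc, ← concentrate_mul]
    rw [integral_const_mul, integral_concentrate hμ fun y hy => by simp [hψq y hy],
      mul_inv_cancel_left₀ hμ0.ne', hψf]
  have h1int : ∫ y, |(1 : UnitAddCircle → ℝ) y| = 1 := by simp
  have hA1 : ∀ y, |A y| ≤ 1 := fun y => by
    induction y using QuotientAddGroup.induction_on with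
    | H y => exact hψ1 _
  have hA'1 : ∀ y, |A' y| ≤ s * μ := fun y => by
    induction y using QuotientAddGroup.induction_on with
    | H y =>
      change |μ * _| ≤ _
      rw [abs_mul, abs_of_pos hμ0, mul_comm]
      exact mul_le_mul_of_nonneg_right (hs _) hμ0.le
  set gW := Function.update (fun _ : Fin d => A) j 1 with hgW
  set gΘ := Function.update (fun _ : Fin d => B) j 1 with hgΘ
  set gH := Function.update gΘ k F with hgH
  have hkj : k ≠ j := hjk.symm
  have hgWs : ∀ i, ContDiff ℝ ∞ fun y : ℝ => gW i (y : UnitAddCircle) := fun i => by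
    by_cases hi : i = j
    · subst hi; simpa only [hgW, Function.update_self] using h1s
    · simpa only [hgW, Function.update_of_ne hi] using hAs
  have hgΘs : ∀ i, ContDiff ℝ ∞ fun y : ℝ => gΘ i (y : UnitAddCircle) := fun i => by
    by_cases hi : i = j
    · subst hi; simpa only [hgΘ, Function.update_self] using h1s
    · simpa only [hgΘ, Function.update_of_ne hi] using hBs
  have hgHs : ∀ i, ContDiff ℝ ∞ fun y : ℝ => gH i (y : UnitAddCircle) := fun i => by
    by_cases hi : i = k
    · subst hi; simpa only [hgH, Function.update_self] using hFs
    · simpa only [hgH, Function.update_of_ne hi] using hgΘs i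
  have hWs := smoothOnTorus_tensor hgWs
  have hΘs := smoothOnTorus_tensor hgΘs
  have hHs := smoothOnTorus_tensor hgHs
  have hWj : InvariantAlong j (tensor gW) := invariantAlong_tensor (by simp [hgW])
  have hΘj : InvariantAlong j (tensor gΘ) := invariantAlong_tensor (by simp [hgΘ])
  have hW1 : ∀ x, |tensor gW x| ≤ 1 := abs_tensor_le fun i y => by
    by_cases hi : i = j
    · subst hi; simp [hgW]
    · simpa only [hgW, Function.update_of_ne hi] using hA1 y
  have hΘint : ∫ x, |tensor gΘ x| = c ^ (d - 1) := by
    rw [integral_abs_tensor, hgΘ,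
      prod_update_const (fun g : UnitAddCircle → ℝ => ∫ y, |g y|) B 1 j, h1int, hBint, one_mul]
  have hmean : ∫ x, (tensor gΘ x * tensor gW x - 1) = 0 := by
    rw [integral_sub (hΘs.mul hWs).integrable (integrable_const _)]
    simp only [← tensor_mul, integral_tensor]
    have : ∀ i, ∫ y, gΘ i y * gW i y = 1 := fun i => by
      by_cases hi : i = j
      · subst hi; simp [hgΘ, hgW]
      · simpa only [hgΘ, hgW, Function.update_of_ne hi] using hBAint
    simp [this]
  obtain ⟨G, hG, hdiv, hGint, hGinv⟩ := exists_antidivergence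
    ((hΘs.mul hWs).sub (SmoothOnTorus.const 1)) hmean
  have hGj := hGinv j fun x t => by simp only [hΘj x t, hWj x t]
  have hpart : ∀ i x, i ≠ j →
      torusPartial i (tensor gW) x = tensor (Function.update gW i A') x := fun i x hi => by
    refine torusPartial_tensor (fun y => ?_) x
    simp only [hgW, Function.update_of_ne hi]
    exact hasDerivAt_concentrate hμ hψq hψdq hψ y
  refine ⟨{
    W := tensor gW
    Θ := tensor gΘ
    H := tensor gH
    G := G
    smooth_W := hWs
    smooth_Θ := hΘs
    smooth_H := hHs
    smooth_G := hG
    inv_W := hWj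
    inv_Θ := hΘj
    inv_G := hGj
    partial_H := fun x => ?_
    div_G := hdiv
    abs_W_le := hW1
    integral_W_le := ?_
    abs_partial_W_le := fun i x => ?_
    integral_partial_W_le := fun i => ?_
    integral_Θ_le := by rw [hΘint]; linarith
    integral_H_le := ?_
    integral_G_le := fun i => ?_
    support := ?_ }⟩
  · rw [torusPartial_tensor (g' := B) (fun y => ?_) x]
    · congr 1
      simp only [hgH, Function.update_idem]
      rw [Function.update_eq_self_iff]
      simp [hgΘ, Function.update_of_ne hkj]
    · simp only [hgH, Function.update_self]
      exact hasDerivAt_concentrate hμ hfq hfdq hf y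
  · rw [integral_abs_tensor, hgW,
      prod_update_const (fun g : UnitAddCircle → ℝ => ∫ y, |g y|) A 1 j, h1int, hAint, one_mul,
      mul_pow, mul_comm]
    exact mul_le_mul_of_nonneg_right (by linarith) (by positivity)
  · have hsM : s * μ ≤ M * μ := mul_le_mul_of_nonneg_right (by linarith) hμ0.le
    by_cases hi : i = j
    · subst hi
      rw [hWj.torusPartial_eq_zero, abs_zero]
      exact (mul_nonneg hs0 hμ0.le).trans hsM
    · rw [hpart i x hi, tensor, Finset.abs_prod, Fintype.prod_eq_mul_prod_compl i,
        Function.update_self]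
      refine (mul_le_of_le_one_right (abs_nonneg _) ?_).trans ((hA'1 _).trans hsM)
      refine Finset.prod_le_one (fun l _ => abs_nonneg _) fun l hl => ?_
      rw [Function.update_of_ne (by simpa using hl)]
      by_cases hl : l = j
      · subst hl; simp [hgW]
      · simpa only [hgW, Function.update_of_ne hl] using hA1 _
  · have hnn : 0 ≤ M * μ * μ⁻¹ ^ (d - 1) := by positivity
    by_cases hi : i = j
    · subst hi
      simpa only [hWj.torusPartial_eq_zero, abs_zero, integral_zero] using hnn
    · simp only [hpart i _ hi]
      rw [integral_abs_tensor, hgW,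
        prod_update_update_const (fun g : UnitAddCircle → ℝ => ∫ y, |g y|) A 1 A' (Ne.symm hi),
        h1int, hAint, hA'int, one_mul, mul_pow, hd2, pow_succ]
      calc b * (μ⁻¹ ^ (d - 2) * a ^ (d - 2)) = b * a ^ (d - 2) * μ⁻¹ ^ (d - 2) := by ring
        _ ≤ M * μ⁻¹ ^ (d - 2) := mul_le_mul_of_nonneg_right (by linarith) (by positivity)
        _ = M * μ * (μ⁻¹ ^ (d - 2) * μ⁻¹) := by field_simp
  · rw [integral_abs_tensor, hgH, hgΘ,
      prod_update_update_const (fun g : UnitAddCircle → ℝ => ∫ y, |g y|) B 1 F hjk,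
      h1int, hFint, hBint, one_mul]
    calc μ⁻¹ * e * c ^ (d - 2) = e * c ^ (d - 2) * μ⁻¹ := by ring
      _ ≤ M * μ⁻¹ := mul_le_mul_of_nonneg_right (by linarith) (by positivity)
  · refine (hGint i).trans ?_
    have h1 : ∫ x, |tensor gΘ x * tensor gW x - 1| ≤ ∫ x, (|tensor gΘ x| + 1) := by
      refine integral_mono ((hΘs.mul hWs).sub (SmoothOnTorus.const 1)).integrable.abs
        (hΘs.integrable.abs.add (integrable_const _)) fun x => ?_
      refine (abs_sub _ _).trans ?_
      rw [abs_one, abs_mul]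
      exact add_le_add_left (mul_le_of_le_one_right (abs_nonneg _) (hW1 x)) 1
    rw [integral_add hΘs.integrable.abs (integrable_const _), hΘint] at h1
    have h2 : ∫ _ : Torus d, (1 : ℝ) = 1 := by simp
    linarith
  · intro x hx i hi
    rcases hx with h | h | h
    · have := tensor_apply_ne_zero h i
      simp only [hgW, Function.update_of_ne hi] at this
      exact norm_lt_of_concentrate_ne_zero hμ hψq this
    · have := tensor_apply_ne_zero h i
      simp only [hgΘ, Function.update_of_ne hi] at this
      exact norm_lt_of_concentrate_ne_zero hμ hfdq (right_ne_zero_of_mul this)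
    · have := tensor_apply_ne_zero h i
      by_cases hik : i = k
      · subst hik
        simp only [hgH, Function.update_self] at this
        exact norm_lt_of_concentrate_ne_zero hμ hfq this
      · simp only [hgH, hgΘ, Function.update_of_ne hik, Function.update_of_ne hi] at this
        exact norm_lt_of_concentrate_ne_zero hμ hfdq (right_ne_zero_of_mul this)

/-! ### Oscillating and moving functions -/

section Moving

variable {d : ℕ}

/-- The function `h` on the torus, oscillating at frequency `n` and translated along the path `s`
(measured in the rescaled variable). -/
def moving (n : ℕ) (s : ℝ → Fin d → ℝ) (h : Torus d → ℝ) (t : ℝ) (x : Torus d) : ℝ :=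
  h (n • x - Torus.proj d (s t))

variable {n : ℕ} {s : ℝ → Fin d → ℝ} {h : Torus d → ℝ}

theorem SmoothOnTorus.moving (n : ℕ) (hs : ContDiff ℝ ∞ s) (hh : SmoothOnTorus h) :
    SmoothInTime (moving n s h) := by
  have h1 : ContDiff ℝ ∞ fun z : ℝ × (Fin d → ℝ) => (n : ℝ) • z.2 - s z.1 :=
    (contDiff_snd.const_smul (n : ℝ)).sub (hs.comp contDiff_fst)
  have h2 := ContDiff.comp (g := fun y : Fin d → ℝ => h (Torus.proj d y)) hh h1
  unfold SmoothInTime _root_.moving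
  simpa only [Function.comp_def, Torus.proj_sub, Torus.proj_nsmul] using h2

theorem torusPartial_moving (n : ℕ) (s : ℝ → Fin d → ℝ) (hh : SmoothOnTorus h) (i : Fin d) (t : ℝ)
    (x : Torus d) :
    torusPartial i (moving n s h t) x = n * moving n s (torusPartial i h) t x := by
  apply torusPartial_eq_of_hasDerivAt
  have h1 : ∀ r : ℝ, moving n s h t (x + Pi.single i (r : UnitAddCircle)) =
      h (n • x - Torus.proj d (s t) + Pi.single i ((n * r : ℝ) : UnitAddCircle)) := fun r => by
    unfold moving
    congr 1
    rw [smul_add, ← Pi.single_smul, ← nsmul_eq_mul, AddCircle.coe_nsmul]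
    abel
  simp only [h1]
  have h2 := hh.hasDerivAt i (n • x - Torus.proj d (s t)) (n * 0)
  have h3 : HasDerivAt (fun r : ℝ => (n : ℝ) * r) ((n : ℝ) * 1) 0 :=
    (hasDerivAt_id (0 : ℝ)).const_mul (n : ℝ)
  have h4 := h2.comp 0 h3
  simpa [mul_comm, moving, Function.comp_def] using h4

theorem timePartial_moving (n : ℕ) (hh : SmoothOnTorus h) {s' : Fin d → ℝ} {t : ℝ}
    (hs : ∀ i, HasDerivAt (fun t => s t i) (s' i) t) (x : Torus d) :
    timePartial (moving n s h) t x = -∑ i, s' i * moving n s (torusPartial i h) t x := by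
  obtain ⟨y, rfl⟩ := Torus.proj_surjective d x
  set F := fun y : Fin d → ℝ => h (Torus.proj d y) with hF
  have e : ∀ (g : Torus d → ℝ) (t : ℝ), moving n s g t (Torus.proj d y) =
      g (Torus.proj d ((n : ℝ) • y - s t)) := fun g t => by
    rw [Torus.proj_sub, Torus.proj_nsmul]; rfl
  have h1 : HasFDerivAt F (fderiv ℝ F ((n : ℝ) • y - s t)) ((n : ℝ) • y - s t) :=
    ((ContDiff.differentiable hh (by simp)) _).hasFDerivAt
  have h2 : HasDerivAt (fun t => (n : ℝ) • y - s t) (-s') t :=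
    (hasDerivAt_pi.2 hs).const_sub _
  have h3 := h1.comp_hasDerivAt t h2
  change HasDerivAt (fun t => h (Torus.proj d ((n : ℝ) • y - s t))) _ t at h3
  unfold timePartial
  simp only [e]
  rw [h3.deriv, map_neg, neg_inj]
  conv_lhs => rw [← Finset.univ_sum_single s', map_sum]
  refine Finset.sum_congr rfl fun i _ => ?_
  rw [torusPartial_proj hh]
  have : (Pi.single i (s' i) : Fin d → ℝ) = s' i • Pi.single i 1 := by
    rw [← Pi.single_smul, smul_eq_mul, mul_one]
  rw [this, map_smul, smul_eq_mul]

theorem continuous_nsmul_sub (n : ℕ) (b : Torus d) : Continuous fun x : Torus d => n • x - b :=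
  (continuous_nsmul n).sub continuous_const

/-- Moving the phase of the oscillating factor costs at most the oscillation of the slow factor
over one period. -/
theorem integral_mul_oscillating_le_of_phase {a g : Torus d → ℝ} (ha : Continuous a)
    (hg : Continuous g) (hg0 : ∀ x, 0 ≤ g x) {L : ℝ} (hL : 0 ≤ L)
    (hlip : ∀ x (v : Fin d → ℝ), ‖v‖ ≤ 1 → a (x + Torus.proj d v) ≤ a x + L * ‖v‖) (hn : 0 < n)
    (b b' : Torus d) : ∫ x, a x * g (n • x - b') ≤
      (∫ x, a x * g (n • x - b)) + L / n * ∫ x, g (n • x - b) := by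
  have hn0 : (0 : ℝ) < n := by exact_mod_cast hn
  have hn1 : (1 : ℝ) ≤ n := by exact_mod_cast hn
  obtain ⟨v, hv, hvb⟩ : ∃ v : Fin d → ℝ, ‖v‖ ≤ 1 ∧ Torus.proj d v = b' - b :=
    Torus.exists_proj_eq (b' - b)
  set z : Torus d := Torus.proj d ((n : ℝ)⁻¹ • v) with hz
  have hnz : n • z = b' - b := by
    rw [hz, ← Torus.proj_nsmul, smul_inv_smul₀ hn0.ne', hvb]
  have hnorm : ‖(n : ℝ)⁻¹ • v‖ ≤ (n : ℝ)⁻¹ := by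
    rw [norm_smul, norm_inv, Real.norm_natCast]
    exact mul_le_of_le_one_right (by positivity) hv
  have hgc : Continuous fun x => g (n • x - b) := hg.comp (continuous_nsmul_sub n b)
  have hc1 : Continuous fun x => a x * g (n • x - b) := ha.mul hgc
  have hc2 : Continuous fun x => L / n * g (n • x - b) := continuous_const.mul hgc
  have hshift : ∫ x, a x * g (n • x - b') = ∫ x, a (x + z) * g (n • x - b) := by
    rw [← integral_add_right_eq_self (fun x => a x * g (n • x - b')) z]
    congr 1
    funext x
    congr 2
    rw [smul_add, hnz]
    abel
  rw [hshift, ← integral_const_mul, ← integral_add (Torus.integrable_of_continuous hc1)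
    (Torus.integrable_of_continuous hc2)]
  refine integral_mono (Torus.integrable_of_continuous
    ((ha.comp (continuous_add_const z)).mul hgc))
    (Torus.integrable_of_continuous (hc1.add hc2)) fun x => ?_
  have h1 : a (x + z) ≤ a x + L / n := by
    refine (hlip x _ (hnorm.trans (inv_le_one_of_one_le₀ hn1))).trans ?_
    rw [div_eq_mul_inv]
    gcongr
  simp only
  rw [← add_mul]
  exact mul_le_mul_of_nonneg_right h1 (hg0 _)

theorem integral_integral_phase {a g : Torus d → ℝ} (ha : Continuous a) (hg : Continuous g)
    (n : ℕ) : ∫ b, ∫ x, a x * g (n • x - b) = (∫ x, a x) * ∫ x, g x := by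
  have hc : Continuous fun z : Torus d × Torus d => a z.2 * g (n • z.2 - z.1) :=
    (ha.comp continuous_snd).mul (hg.comp (((continuous_nsmul n).comp continuous_snd).sub
      continuous_fst))
  rw [integral_integral_swap
    (hc.integrable_of_hasCompactSupport (HasCompactSupport.of_compactSpace _)),
    ← integral_mul_const]
  congr 1
  funext x
  rw [integral_const_mul]
  congr 1
  have : (volume : Measure (Torus d)).IsNegInvariant :=
    Measure.IsAddHaarMeasure.isNegInvariant_of_regular _
  exact integral_sub_left_eq_self g volume (n • x)

theorem integral_oscillating {g : Torus d → ℝ} (hg : Continuous g) (hg0 : ∀ x, 0 ≤ g x)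
    (hn : 0 < n) (b : Torus d) : ∫ x, g (n • x - b) = ∫ x, g x := by
  have h1 : ∀ b b' : Torus d, ∫ x, g (n • x - b') ≤ ∫ x, g (n • x - b) := fun b b' => by
    simpa using integral_mul_oscillating_le_of_phase (a := fun _ => 1) continuous_const hg hg0
      le_rfl (by simp) hn b b'
  have h2 : ∀ b', ∫ x, g (n • x - b') = ∫ x, g (n • x - b) := fun b' =>
    le_antisymm (h1 _ _) (h1 _ _)
  have h3 := integral_integral_phase (a := fun _ : Torus d => 1) continuous_const hg n
  simpa [h2] using h3

/-- Improved Hölder inequality: against a function oscillating at frequency `n`, a Lipschitz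
function is seen through its mean, up to an error `1 / n`. -/
theorem integral_mul_oscillating_le {a g : Torus d → ℝ} (ha : Continuous a)
    (hg : Continuous g) (hg0 : ∀ x, 0 ≤ g x) {L : ℝ} (hL : 0 ≤ L)
    (hlip : ∀ x (v : Fin d → ℝ), ‖v‖ ≤ 1 → a (x + Torus.proj d v) ≤ a x + L * ‖v‖) (hn : 0 < n)
    (b : Torus d) : ∫ x, a x * g (n • x - b) ≤ ((∫ x, a x) + L / n) * ∫ x, g x := by
  have h1 := fun b' => integral_mul_oscillating_le_of_phase ha hg hg0 hL hlip hn b' b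
  simp only [integral_oscillating hg hg0 hn] at h1
  have hc : Continuous fun z : Torus d × Torus d => a z.2 * g (n • z.2 - z.1) :=
    (ha.comp continuous_snd).mul (hg.comp (((continuous_nsmul n).comp continuous_snd).sub
      continuous_fst))
  have hi : Integrable fun b : Torus d => ∫ x, a x * g (n • x - b) :=
    (hc.integrable_of_hasCompactSupport (HasCompactSupport.of_compactSpace _)
      (μ := volume.prod volume)).integral_prod_left
  have h2 : ∫ _ : Torus d, ∫ x, a x * g (n • x - b) ≤
      ∫ b' : Torus d, ((∫ x, a x * g (n • x - b')) + L / n * ∫ x, g x) :=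
    integral_mono (integrable_const _) (hi.add (integrable_const _)) h1
  rw [integral_add hi (integrable_const _), integral_integral_phase ha hg] at h2
  simp only [integral_const, probReal_univ, one_smul] at h2
  linarith

theorem integral_abs_moving (hn : 0 < n) (s : ℝ → Fin d → ℝ) (hh : Continuous h) (t : ℝ) :
    ∫ x, |moving n s h t x| = ∫ x, |h x| :=
  integral_oscillating hh.abs (fun _ => abs_nonneg _) hn _

end Moving

/-! ### Adding pipes to an approximate solution -/

/-- A smooth solution of the continuity equation with a divergence free field, up to the divergence
of a defect `R`: `∂ₜρ + div (ρu) = -div R`. -/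
structure DefectSolution (d : ℕ) where
  ρ : ℝ → Torus d → ℝ
  u : Fin d → ℝ → Torus d → ℝ
  R : Fin d → ℝ → Torus d → ℝ
  smooth_ρ : SmoothInTime ρ
  smooth_u : ∀ i, SmoothInTime (u i)
  smooth_R : ∀ i, SmoothInTime (R i)
  continuity : ∀ t x, timePartial ρ t x + ∑ i, torusPartial i (fun x => ρ t x * u i t x) x +
    ∑ i, torusPartial i (R i t) x = 0
  div_u : ∀ t x, ∑ i, torusPartial i (u i t) x = 0

/-- A finite family of disjoint pipes, oscillating at frequency `n` with amplitude `η` of the field.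
The `α`-th pipe carries the density coefficient `a α` and has the phase `s α`; it is translated with
velocity `v α t • c α`, which is the constant `c α` where the coefficient is nonzero, by `a_mul_v`.
The field is switched on and off by `g`, which equals one where a coefficient is nonzero, by
`a_mul_g`. -/
structure PipeSystem (d : ℕ) (ι : Type) where
  M : ℝ
  μ : ℝ
  n : ℕ
  n_pos : 0 < n
  j : ι → Fin d
  k : ι → Fin d
  P : ∀ α, PipeProfile M μ (j α) (k α)
  c : ι → Fin d → ℝ
  s : ι → ℝ → Fin d → ℝ
  v : ι → ℝ → ℝ
  smooth_s : ∀ α, ContDiff ℝ ∞ (s α)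
  hasDerivAt_s : ∀ α i t, HasDerivAt (fun t => s α t i) (n * (v α t * c α i)) t
  a : ι → ℝ → Torus d → ℝ
  smooth_a : ∀ α, SmoothInTime (a α)
  a_mul_v : ∀ α t x, a α t x * v α t = a α t x
  disjoint : ∀ α β t x, α ≠ β → moving n (s α) (P α).W t x ≠ 0 →
    moving n (s β) (P β).W t x = 0 ∧ moving n (s β) (P β).Θ t x = 0 ∧
      moving n (s β) (P β).H t x = 0
  η : ℝ
  η_pos : 0 < η
  g : ℝ → ℝ
  smooth_g : ContDiff ℝ ∞ g
  a_mul_g : ∀ α t x, a α t x * g t = a α t x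

section Ite

variable {d : ℕ}

theorem SmoothInTime.ite {f : ℝ → Torus d → ℝ} (hf : SmoothInTime f) (p : Prop) [Decidable p] :
    SmoothInTime (fun t x => if p then f t x else 0) := by
  by_cases hp : p
  · simpa [hp] using hf
  · simpa [hp] using SmoothInTime.const 0

theorem sum_torusPartial_ite (j : Fin d) (f : Torus d → ℝ) (x : Torus d) :
    ∑ i, torusPartial i (fun x => if j = i then f x else 0) x = torusPartial j f x := by
  rw [Finset.sum_eq_single j]
  · simp
  · intro i _ hi
    simp [Ne.symm hi, torusPartial_const]
  · simp

end Ite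

namespace PipeSystem

variable {d : ℕ} {ι : Type} (S : PipeSystem d ι)

/-- The moving shear flow of the `α`-th pipe. -/
def W (α : ι) : ℝ → Torus d → ℝ := moving S.n (S.s α) (S.P α).W

/-- The moving density profile of the `α`-th pipe. -/
def Θ (α : ι) : ℝ → Torus d → ℝ := moving S.n (S.s α) (S.P α).Θ

/-- The moving primitive of the density profile of the `α`-th pipe. -/
def H (α : ι) : ℝ → Torus d → ℝ := moving S.n (S.s α) (S.P α).H

/-- The moving potential of `Θ W - 1` for the `α`-th pipe. -/
def G (α : ι) (i : Fin d) : ℝ → Torus d → ℝ := moving S.n (S.s α) ((S.P α).G i)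

theorem smooth_W (α : ι) : SmoothInTime (S.W α) := (S.P α).smooth_W.moving _ (S.smooth_s α)

theorem smooth_Θ (α : ι) : SmoothInTime (S.Θ α) := (S.P α).smooth_Θ.moving _ (S.smooth_s α)

theorem smooth_H (α : ι) : SmoothInTime (S.H α) := (S.P α).smooth_H.moving _ (S.smooth_s α)

theorem smooth_G (α : ι) (i : Fin d) : SmoothInTime (S.G α i) :=
  ((S.P α).smooth_G i).moving _ (S.smooth_s α)

theorem n_ne_zero : (S.n : ℝ) ≠ 0 := by exact_mod_cast S.n_pos.ne'

theorem torusPartial_H (α : ι) (t : ℝ) (x : Torus d) :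
    torusPartial (S.k α) (S.H α t) x = S.n * S.Θ α t x := by
  rw [H, torusPartial_moving _ _ (S.P α).smooth_H, Θ, moving, moving, (S.P α).partial_H]

theorem torusPartial_W (α : ι) (t : ℝ) (x : Torus d) :
    torusPartial (S.j α) (S.W α t) x = 0 := by
  rw [W, torusPartial_moving _ _ (S.P α).smooth_W, moving, (S.P α).inv_W.torusPartial_eq_zero,
    mul_zero]

theorem torusPartial_Θ (α : ι) (t : ℝ) (x : Torus d) :
    torusPartial (S.j α) (S.Θ α t) x = 0 := by
  rw [Θ, torusPartial_moving _ _ (S.P α).smooth_Θ, moving, (S.P α).inv_Θ.torusPartial_eq_zero,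
    mul_zero]

theorem torusPartial_G (α : ι) (i : Fin d) (t : ℝ) (x : Torus d) :
    torusPartial (S.j α) (S.G α i t) x = 0 := by
  rw [G, torusPartial_moving _ _ ((S.P α).smooth_G i), moving,
    ((S.P α).inv_G i).torusPartial_eq_zero, mul_zero]

theorem sum_torusPartial_G (α : ι) (t : ℝ) (x : Torus d) :
    ∑ i, torusPartial i (S.G α i t) x = S.n * (S.Θ α t x * S.W α t x - 1) := by
  simp only [G, torusPartial_moving _ _ ((S.P α).smooth_G _), ← Finset.mul_sum]
  simp only [moving, (S.P α).div_G, Θ, W]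

/-- The pipes are transported by their velocities. -/
theorem a_mul_transport_H (α : ι) (t : ℝ) (x : Torus d) :
    S.a α t x * (timePartial (S.H α) t x + ∑ i, S.c α i * torusPartial i (S.H α t) x) = 0 := by
  rw [H, timePartial_moving _ (S.P α).smooth_H fun i => S.hasDerivAt_s α i t]
  simp only [torusPartial_moving _ _ (S.P α).smooth_H]
  rw [← Finset.sum_neg_distrib, ← Finset.sum_add_distrib, Finset.mul_sum]
  refine Finset.sum_eq_zero fun i _ => ?_
  linear_combination (-S.n * S.c α i * moving S.n (S.s α) (torusPartial i (S.P α).H) t x) *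
    S.a_mul_v α t x

/-- The density carried by the `α`-th pipe, in the form of a derivative. -/
noncomputable def densityPart (α : ι) (t : ℝ) (x : Torus d) : ℝ :=
  (S.η * S.n)⁻¹ * torusPartial (S.k α) (fun x => S.a α t x * S.H α t x) x

theorem smooth_densityPart (α : ι) : SmoothInTime (S.densityPart α) :=
  (((S.smooth_a α).mul (S.smooth_H α)).torusPartial _).const_mul _

theorem densityPart_eq (α : ι) (t : ℝ) (x : Torus d) :
    S.densityPart α t x = S.η⁻¹ * (S.a α t x * S.Θ α t x) +
      (S.η * S.n)⁻¹ * (torusPartial (S.k α) (S.a α t) x * S.H α t x) := by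
  have h1 := S.n_ne_zero
  have h2 := S.η_pos.ne'
  rw [densityPart, torusPartial_mul ((S.smooth_a α).slice t) ((S.smooth_H α).slice t),
    torusPartial_H]
  field_simp
  ring

/-- The defect caused by the variation of the coefficient along the motion of the pipe. -/
noncomputable def transportError (α : ι) (t : ℝ) (x : Torus d) : ℝ :=
  (S.η * S.n)⁻¹ * ((timePartial (S.a α) t x + ∑ i, S.c α i * torusPartial i (S.a α t) x) *
    S.H α t x)

theorem smooth_transportError (α : ι) : SmoothInTime (S.transportError α) :=
  (((S.smooth_a α).timePartial.add (SmoothInTime.sum fun i _ =>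
    ((S.smooth_a α).torusPartial i).const_mul _)).mul (S.smooth_H α)).const_mul _

/-- A moving pipe satisfies the transport equation with its own velocity up to a divergence. -/
theorem transport_densityPart (α : ι) (t : ℝ) (x : Torus d) :
    timePartial (S.densityPart α) t x +
      ∑ i, torusPartial i (fun x => S.densityPart α t x * S.c α i) x =
      torusPartial (S.k α) (S.transportError α t) x := by
  set q : ℝ → Torus d → ℝ := fun t x => S.a α t x * S.H α t x with hq
  have hqs : SmoothInTime q := (S.smooth_a α).mul (S.smooth_H α)
  have h1 : timePartial (S.densityPart α) t x =
      (S.η * S.n)⁻¹ * torusPartial (S.k α) (timePartial q t) x := by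
    rw [← timePartial_torusPartial hqs, ← timePartial_const_mul _ (hqs.torusPartial _)]
    rfl
  have h2 : ∀ i, torusPartial i (fun x => S.densityPart α t x * S.c α i) x =
      (S.η * S.n)⁻¹ * torusPartial (S.k α) (fun x => S.c α i * torusPartial i (q t) x) x := by
    intro i
    rw [torusPartial_const_mul _ ((hqs.torusPartial i).slice t), torusPartial_comm (hqs.slice t),
      ← mul_assoc, ← torusPartial_const_mul _ ((hqs.torusPartial (S.k α)).slice t)]
    congr 1
    funext x
    simp only [densityPart, hq]
    ring
  have h3 : S.transportError α t = fun x => (S.η * S.n)⁻¹ * (timePartial q t x +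
      ∑ i, S.c α i * torusPartial i (q t) x) := by
    funext x
    rw [transportError, hq, timePartial_mul (S.smooth_a α) (S.smooth_H α)]
    simp only [torusPartial_mul ((S.smooth_a α).slice t) ((S.smooth_H α).slice t), mul_add,
      Finset.sum_add_distrib]
    have h4 := S.a_mul_transport_H α t x
    have h5 : ∑ i, S.c α i * (torusPartial i (S.a α t) x * S.H α t x) =
        (∑ i, S.c α i * torusPartial i (S.a α t) x) * S.H α t x := by
      rw [Finset.sum_mul]; exact Finset.sum_congr rfl fun i _ => by ring
    have h6 : ∑ i, S.c α i * (S.a α t x * torusPartial i (S.H α t) x) =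
        S.a α t x * ∑ i, S.c α i * torusPartial i (S.H α t) x := by
      rw [Finset.mul_sum]; exact Finset.sum_congr rfl fun i _ => by ring
    rw [h5, h6]
    linear_combination -(S.η * S.n)⁻¹ * h4
  have hs : SmoothOnTorus fun x => ∑ i, S.c α i * torusPartial i (q t) x :=
    (SmoothInTime.sum fun i _ => (hqs.torusPartial i).const_mul _).slice t
  rw [h1, h3, torusPartial_const_mul _ ((hqs.timePartial.slice t).add hs),
    torusPartial_add (hqs.timePartial.slice t) hs,
    torusPartial_sum fun i _ => ((hqs.torusPartial i).const_mul (S.c α i)).slice t]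
  simp only [h2, ← Finset.mul_sum, mul_add]

/-- The defect caused by the oscillation of the product of the density and the field of the `α`-th
pipe about its mean. -/
noncomputable def oscillationError (α : ι) (i : Fin d) (t : ℝ) (x : Torus d) : ℝ :=
  (S.n : ℝ)⁻¹ * (torusPartial (S.j α) (S.a α t) x * S.G α i t x -
    if S.j α = i then ∑ l, torusPartial l (S.a α t) x * S.G α l t x else 0)

theorem smooth_sum_partial_mul_G (α : ι) :
    SmoothInTime fun t x => ∑ l, torusPartial l (S.a α t) x * S.G α l t x :=
  SmoothInTime.sum fun l _ => ((S.smooth_a α).torusPartial l).mul (S.smooth_G α l)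

theorem smooth_oscillationError (α : ι) (i : Fin d) : SmoothInTime (S.oscillationError α i) :=
  ((((S.smooth_a α).torusPartial _).mul (S.smooth_G α i)).sub
    ((S.smooth_sum_partial_mul_G α).ite _)).const_mul _

/-- The mean of the flux of the `α`-th pipe has divergence `∂ⱼ a`. -/
theorem torusPartial_a_mul_Θ_mul_W (α : ι) (t : ℝ) (x : Torus d) :
    torusPartial (S.j α) (fun x => S.a α t x * (S.Θ α t x * S.W α t x)) x =
      torusPartial (S.j α) (S.a α t) x + ∑ i, torusPartial i (S.oscillationError α i t) x := by
  have ha := (S.smooth_a α).slice t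
  have hap := fun i => ((S.smooth_a α).torusPartial i).slice t
  have hG := fun i => (S.smooth_G α i).slice t
  have h1 : torusPartial (S.j α) (fun x => S.a α t x * (S.Θ α t x * S.W α t x)) x =
      torusPartial (S.j α) (S.a α t) x * (S.Θ α t x * S.W α t x) := by
    rw [torusPartial_mul ha (((S.smooth_Θ α).mul (S.smooth_W α)).slice t),
      torusPartial_mul ((S.smooth_Θ α).slice t) ((S.smooth_W α).slice t), torusPartial_Θ,
      torusPartial_W]
    ring
  have h2 : ∀ i, torusPartial i (S.oscillationError α i t) x = (S.n : ℝ)⁻¹ *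
      (torusPartial i (torusPartial (S.j α) (S.a α t)) x * S.G α i t x +
        torusPartial (S.j α) (S.a α t) x * torusPartial i (S.G α i t) x -
        torusPartial i (fun x => if S.j α = i then
          ∑ l, torusPartial l (S.a α t) x * S.G α l t x else 0) x) := by
    intro i
    have h3 := (((S.smooth_sum_partial_mul_G α).ite (S.j α = i)).slice t)
    have h4 := ((((S.smooth_a α).torusPartial (S.j α)).mul (S.smooth_G α i)).slice t)
    unfold oscillationError
    rw [torusPartial_const_mul _ (h4.sub h3), torusPartial_sub h4 h3,
      torusPartial_mul (hap _) (hG i)]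
  have h5 : torusPartial (S.j α) (fun x => ∑ l, torusPartial l (S.a α t) x * S.G α l t x) x =
      ∑ l, torusPartial l (torusPartial (S.j α) (S.a α t)) x * S.G α l t x := by
    rw [torusPartial_sum fun l _ => ((((S.smooth_a α).torusPartial l).mul
      (S.smooth_G α l)).slice t)]
    refine Finset.sum_congr rfl fun l _ => ?_
    rw [torusPartial_mul (hap l) (hG l), torusPartial_G, torusPartial_comm ha]
    ring
  rw [h1, Finset.sum_congr rfl fun i _ => h2 i, ← Finset.mul_sum, Finset.sum_sub_distrib,
    Finset.sum_add_distrib, sum_torusPartial_ite, h5, ← Finset.mul_sum, sum_torusPartial_G]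
  have h1 := S.n_ne_zero
  field_simp
  ring

/-- The defect caused by the slow variation of the coefficient across the pipe. -/
noncomputable def correctorError (α : ι) (t : ℝ) (x : Torus d) : ℝ :=
  (S.n : ℝ)⁻¹ * (torusPartial (S.k α) (S.a α t) x * (S.H α t x * S.W α t x))

theorem smooth_correctorError (α : ι) : SmoothInTime (S.correctorError α) :=
  (((S.smooth_a α).torusPartial _).mul ((S.smooth_H α).mul (S.smooth_W α))).const_mul _

variable (D : DefectSolution d)

theorem smooth_densityPart_mul (α : ι) (i : Fin d) :
    SmoothInTime fun t x => S.densityPart α t x * (D.u i t x - S.c α i) :=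
  (S.smooth_densityPart α).mul ((D.smooth_u i).sub (SmoothInTime.const _))

theorem smooth_error_term (α : ι) (i : Fin d) : SmoothInTime fun t x =>
    ((if S.k α = i then S.transportError α t x else 0) +
    S.densityPart α t x * (D.u i t x - S.c α i) +
    (if S.j α = i then S.correctorError α t x else 0) + S.oscillationError α i t x) :=
  ((((S.smooth_transportError α).ite _).add (S.smooth_densityPart_mul D α i)).add
    ((S.smooth_correctorError α).ite _)).add (S.smooth_oscillationError α i)

variable [Fintype ι]

/-- The density added by the pipes. -/
noncomputable def density (t : ℝ) (x : Torus d) : ℝ := ∑ α, S.densityPart α t x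

/-- The vector field added by the pipes. -/
noncomputable def field (i : Fin d) (t : ℝ) (x : Torus d) : ℝ :=
  ∑ α, S.η * S.g t * if S.j α = i then S.W α t x else 0

theorem smooth_density : SmoothInTime S.density :=
  SmoothInTime.sum fun α _ => S.smooth_densityPart α

theorem smooth_field (i : Fin d) : SmoothInTime (S.field i) :=
  SmoothInTime.sum fun α _ =>
    ((SmoothInTime.of_time S.smooth_g).const_mul _).mul ((S.smooth_W α).ite _)

theorem sum_torusPartial_field (t : ℝ) (x : Torus d) :
    ∑ i, torusPartial i (S.field i t) x = 0 := by
  have h : ∀ i, torusPartial i (S.field i t) x =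
      ∑ α, S.η * S.g t * torusPartial i (fun x => if S.j α = i then S.W α t x else 0) x := by
    intro i
    unfold field
    rw [torusPartial_sum fun α _ => ((((SmoothInTime.of_time S.smooth_g).const_mul _).mul
      ((S.smooth_W α).ite (S.j α = i))).slice t)]
    exact Finset.sum_congr rfl fun α _ =>
      torusPartial_const_mul _ (((S.smooth_W α).ite _).slice t) i x
  simp only [h]
  rw [Finset.sum_comm]
  refine Finset.sum_eq_zero fun α _ => ?_
  rw [← Finset.mul_sum, sum_torusPartial_ite, torusPartial_W, mul_zero]

/-- Since the pipes are disjoint, each density only interacts with the field of its own pipe. -/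
theorem density_mul_field (i : Fin d) (t : ℝ) (x : Torus d) :
    S.density t x * S.field i t x = ∑ α, if S.j α = i then
      S.a α t x * (S.Θ α t x * S.W α t x) + S.correctorError α t x else 0 := by
  have hn := S.n_ne_zero
  have hη := S.η_pos.ne'
  have hg : ∀ α, torusPartial (S.k α) (S.a α t) x * S.g t = torusPartial (S.k α) (S.a α t) x := by
    intro α
    rw [mul_comm, ← torusPartial_const_mul _ ((S.smooth_a α).slice t)]
    congr 1
    funext x
    rw [mul_comm, S.a_mul_g]
  rw [density, Finset.sum_mul]
  refine Finset.sum_congr rfl fun α _ => ?_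
  rw [field, Finset.mul_sum, Finset.sum_eq_single α]
  · by_cases hi : S.j α = i
    · simp only [hi, if_true]
      rw [densityPart_eq, correctorError]
      have e1 : (S.η⁻¹ * (S.a α t x * S.Θ α t x) + (S.η * S.n)⁻¹ *
          (torusPartial (S.k α) (S.a α t) x * S.H α t x)) * (S.η * S.g t * S.W α t x) =
          (S.a α t x * S.g t) * (S.Θ α t x * S.W α t x) + (S.n : ℝ)⁻¹ *
          ((torusPartial (S.k α) (S.a α t) x * S.g t) * (S.H α t x * S.W α t x)) := by
        field_simp
      rw [e1, S.a_mul_g, hg]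
    · simp [hi]
  · intro β _ hβ
    by_cases hW : S.W β t x = 0
    · simp [hW]
    · obtain ⟨-, h1, h2⟩ := S.disjoint β α t x hβ hW
      rw [densityPart_eq, show S.Θ α t x = 0 from h1, show S.H α t x = 0 from h2]
      simp
  · simp

theorem abs_field_le (hg : ∀ t, |S.g t| ≤ 1) (i : Fin d) (t : ℝ) (x : Torus d) :
    |S.field i t x| ≤ S.η := by
  unfold field
  by_cases h : ∃ α, S.W α t x ≠ 0
  · obtain ⟨α, hα⟩ := h
    rw [Finset.sum_eq_single α]
    · by_cases hi : S.j α = i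
      · simp only [hi, if_true]
        rw [abs_mul, abs_mul, abs_of_pos S.η_pos, mul_assoc]
        exact mul_le_of_le_one_right S.η_pos.le
          (mul_le_one₀ (hg t) (abs_nonneg _) ((S.P α).abs_W_le _))
      · simpa [hi] using S.η_pos.le
    · intro β _ hβ
      have : S.W β t x = 0 := (S.disjoint α β t x hβ.symm hα).1
      simp [this]
    · simp
  · push Not at h
    simpa [h] using S.η_pos.le

/-- The defect left after the pipes are added, up to its sign. -/
noncomputable def error (i : Fin d) (t : ℝ) (x : Torus d) : ℝ :=
  ∑ α, ((if S.k α = i then S.transportError α t x else 0) +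
    S.densityPart α t x * (D.u i t x - S.c α i) +
    (if S.j α = i then S.correctorError α t x else 0) + S.oscillationError α i t x) +
  D.ρ t x * S.field i t x

theorem smooth_error (i : Fin d) : SmoothInTime (S.error D i) :=
  (SmoothInTime.sum fun α _ => S.smooth_error_term D α i).add (D.smooth_ρ.mul (S.smooth_field i))

theorem sum_torusPartial_error (t : ℝ) (x : Torus d) :
    ∑ i, torusPartial i (S.error D i t) x =
      ∑ α, (torusPartial (S.k α) (S.transportError α t) x +
        ∑ i, torusPartial i (fun x => S.densityPart α t x * (D.u i t x - S.c α i)) x +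
        torusPartial (S.j α) (S.correctorError α t) x +
        ∑ i, torusPartial i (S.oscillationError α i t) x) +
      ∑ i, torusPartial i (fun x => D.ρ t x * S.field i t x) x := by
  have h : ∀ i, torusPartial i (S.error D i t) x =
      ∑ α, (torusPartial i (fun x => if S.k α = i then S.transportError α t x else 0) x +
        torusPartial i (fun x => S.densityPart α t x * (D.u i t x - S.c α i)) x +
        torusPartial i (fun x => if S.j α = i then S.correctorError α t x else 0) x +
        torusPartial i (S.oscillationError α i t) x) +
      torusPartial i (fun x => D.ρ t x * S.field i t x) x := by
    intro i
    unfold error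
    rw [torusPartial_add ((SmoothInTime.sum fun α _ => S.smooth_error_term D α i).slice t)
      ((D.smooth_ρ.mul (S.smooth_field i)).slice t),
      torusPartial_sum fun α _ => (S.smooth_error_term D α i).slice t]
    congr 1
    refine Finset.sum_congr rfl fun α _ => ?_
    have h1 := ((S.smooth_transportError α).ite (S.k α = i)).slice t
    have h2 := (S.smooth_densityPart_mul D α i).slice t
    have h3 := ((S.smooth_correctorError α).ite (S.j α = i)).slice t
    have h4 := (S.smooth_oscillationError α i).slice t
    rw [torusPartial_add ((h1.add h2).add h3) h4, torusPartial_add (h1.add h2) h3,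
      torusPartial_add h1 h2]
  simp only [h]
  rw [Finset.sum_add_distrib, Finset.sum_comm]
  congr 1
  refine Finset.sum_congr rfl fun α _ => ?_
  rw [Finset.sum_add_distrib, Finset.sum_add_distrib, Finset.sum_add_distrib,
    sum_torusPartial_ite, sum_torusPartial_ite]

/-- The approximate solution obtained by adding the pipes: the products of their densities and
fields cancel the old defect. -/
noncomputable def perturb (hR : ∀ i t x, D.R i t x = ∑ α, if S.j α = i then S.a α t x else 0) :
    DefectSolution d where
  ρ t x := D.ρ t x + S.density t x
  u i t x := D.u i t x + S.field i t x
  R i t x := -S.error D i t x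
  smooth_ρ := D.smooth_ρ.add S.smooth_density
  smooth_u i := (D.smooth_u i).add (S.smooth_field i)
  smooth_R i := (S.smooth_error D i).neg
  div_u t x := by
    simp only [torusPartial_add ((D.smooth_u _).slice t) ((S.smooth_field _).slice t),
      Finset.sum_add_distrib, D.div_u, S.sum_torusPartial_field, add_zero]
  continuity t x := by
    have hρ := D.smooth_ρ
    have hu := D.smooth_u
    have hϑ := S.smooth_density
    have hw := S.smooth_field
    -- the divergence of the new flux
    have e1 : ∀ i, torusPartial i
        (fun x => (D.ρ t x + S.density t x) * (D.u i t x + S.field i t x)) x =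
        torusPartial i (fun x => D.ρ t x * D.u i t x) x +
        torusPartial i (fun x => D.ρ t x * S.field i t x) x +
        ∑ α, (torusPartial i (fun x => S.densityPart α t x * (D.u i t x - S.c α i)) x +
          torusPartial i (fun x => S.densityPart α t x * S.c α i) x) +
        ∑ α, (torusPartial i (fun x => if S.j α = i then
          S.a α t x * (S.Θ α t x * S.W α t x) else 0) x +
          torusPartial i (fun x => if S.j α = i then S.correctorError α t x else 0) x) := by
      intro i
      have s1 : ∀ α, SmoothInTime fun t x => S.densityPart α t x * S.c α i :=
        fun α => (S.smooth_densityPart α).mul (SmoothInTime.const _)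
      have s2 : ∀ α, SmoothInTime fun t x => if S.j α = i then
          S.a α t x * (S.Θ α t x * S.W α t x) else 0 := fun α =>
        ((S.smooth_a α).mul ((S.smooth_Θ α).mul (S.smooth_W α))).ite _
      have s3 := fun α => (S.smooth_correctorError α).ite (S.j α = i)
      have e : (fun x => (D.ρ t x + S.density t x) * (D.u i t x + S.field i t x)) = fun x =>
          D.ρ t x * D.u i t x + D.ρ t x * S.field i t x +
          (∑ α, (S.densityPart α t x * (D.u i t x - S.c α i) + S.densityPart α t x * S.c α i)) +
          ∑ α, ((if S.j α = i then S.a α t x * (S.Θ α t x * S.W α t x) else 0) +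
            if S.j α = i then S.correctorError α t x else 0) := by
        funext x
        have e' : ∑ α, (S.densityPart α t x * (D.u i t x - S.c α i) +
            S.densityPart α t x * S.c α i) = S.density t x * D.u i t x := by
          rw [density, Finset.sum_mul]
          exact Finset.sum_congr rfl fun α _ => by ring
        have e'' : ∑ α, ((if S.j α = i then S.a α t x * (S.Θ α t x * S.W α t x) else 0) +
            if S.j α = i then S.correctorError α t x else 0) =
            S.density t x * S.field i t x := by
          rw [density_mul_field]
          exact Finset.sum_congr rfl fun α _ => by split_ifs <;> simp
        rw [e', e'']
        ring
      have t1 := fun α => ((S.smooth_densityPart_mul D α i).add (s1 α)).slice t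
      have t2 := fun α => ((s2 α).add (s3 α)).slice t
      have t3 := (SmoothInTime.sum (s := Finset.univ)
        fun α _ => (S.smooth_densityPart_mul D α i).add (s1 α)).slice t
      have t4 := (SmoothInTime.sum (s := Finset.univ) fun α _ => (s2 α).add (s3 α)).slice t
      have t5 := (hρ.mul (hu i)).slice t
      have t6 := (hρ.mul (hw i)).slice t
      rw [e, torusPartial_add ((t5.add t6).add t3) t4, torusPartial_add (t5.add t6) t3,
        torusPartial_add t5 t6, torusPartial_sum fun α _ => t1 α,
        torusPartial_sum fun α _ => t2 α]
      congr 1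
      · congr 1
        exact Finset.sum_congr rfl fun α _ =>
          torusPartial_add ((S.smooth_densityPart_mul D α i).slice t) ((s1 α).slice t) i x
      · exact Finset.sum_congr rfl fun α _ =>
          torusPartial_add ((s2 α).slice t) ((s3 α).slice t) i x
    have e2 : ∑ i, torusPartial i (D.R i t) x = ∑ α, torusPartial (S.j α) (S.a α t) x := by
      have : ∀ i, torusPartial i (D.R i t) x =
          ∑ α, torusPartial i (fun x => if S.j α = i then S.a α t x else 0) x := by
        intro i
        rw [← torusPartial_sum fun α _ => ((S.smooth_a α).ite (S.j α = i)).slice t]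
        congr 1
        funext x
        exact hR i t x
      simp only [this]
      rw [Finset.sum_comm]
      exact Finset.sum_congr rfl fun α _ => sum_torusPartial_ite _ _ _
    have e3 : timePartial (fun t x => D.ρ t x + S.density t x) t x =
        timePartial D.ρ t x + ∑ α, timePartial (S.densityPart α) t x := by
      rw [timePartial_add hρ hϑ]
      congr 1
      exact timePartial_sum (fun α _ => S.smooth_densityPart α) t x
    have e4 : ∑ i, torusPartial i (fun x => -S.error D i t x) x =
        -∑ i, torusPartial i (S.error D i t) x := by
      rw [← Finset.sum_neg_distrib]
      refine Finset.sum_congr rfl fun i _ => ?_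
      have := torusPartial_const_mul (-1) ((S.smooth_error D i).slice t) i x
      simpa using this
    have e5 : ∀ α, timePartial (S.densityPart α) t x =
        torusPartial (S.k α) (S.transportError α t) x -
        ∑ i, torusPartial i (fun x => S.densityPart α t x * S.c α i) x := fun α => by
      rw [← transport_densityPart]; ring
    have h0 := D.continuity t x
    rw [e3, e4, sum_torusPartial_error]
    simp only [e1, Finset.sum_add_distrib, e5, Finset.sum_sub_distrib] at h0 ⊢
    rw [e2] at h0
    rw [Finset.sum_comm (f := fun i α => torusPartial i
        (fun x => S.densityPart α t x * (D.u i t x - S.c α i)) x),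
      Finset.sum_comm (f := fun i α => torusPartial i
        (fun x => S.densityPart α t x * S.c α i) x),
      Finset.sum_comm (f := fun i α => torusPartial i (fun x => if S.j α = i then
          S.a α t x * (S.Θ α t x * S.W α t x) else 0) x),
      Finset.sum_comm (f := fun i α => torusPartial i
        (fun x => if S.j α = i then S.correctorError α t x else 0) x)]
    simp only [sum_torusPartial_ite, torusPartial_a_mul_Θ_mul_W, Finset.sum_add_distrib]
    linarith

end PipeSystem

/-! ### Size of the added pipes and of the new defect -/

section L1

variable {d : ℕ}

theorem integral_abs_mul_le {f g : Torus d → ℝ} {C : ℝ} (hf : Continuous f) (hg : Continuous g)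
    (hC : ∀ x, |f x| ≤ C) : ∫ x, |f x * g x| ≤ C * ∫ x, |g x| := by
  rw [← integral_const_mul]
  refine integral_mono (Torus.integrable_of_continuous (hf.mul hg).abs)
    (Torus.integrable_of_continuous (continuous_const.mul hg.abs)) fun x => ?_
  simp only [abs_mul]
  exact mul_le_mul_of_nonneg_right (hC x) (abs_nonneg _)

theorem integral_abs_const_mul (c : ℝ) (f : Torus d → ℝ) :
    ∫ x, |c * f x| = |c| * ∫ x, |f x| := by
  simp only [abs_mul, integral_const_mul]

theorem integral_abs_add_le {f g : Torus d → ℝ} (hf : Continuous f) (hg : Continuous g) :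
    ∫ x, |f x + g x| ≤ (∫ x, |f x|) + ∫ x, |g x| := by
  rw [← integral_add (Torus.integrable_of_continuous hf.abs)
    (Torus.integrable_of_continuous hg.abs)]
  exact integral_mono (Torus.integrable_of_continuous (hf.add hg).abs)
    (Torus.integrable_of_continuous (hf.abs.add hg.abs)) fun x => abs_add_le _ _

theorem integral_abs_sum_le {ι : Type*} (s : Finset ι) {f : ι → Torus d → ℝ}
    (hf : ∀ i ∈ s, Continuous (f i)) : ∫ x, |∑ i ∈ s, f i x| ≤ ∑ i ∈ s, ∫ x, |f i x| := by
  rw [← integral_finsetSum s fun i hi => Torus.integrable_of_continuous (hf i hi).abs]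
  exact integral_mono (Torus.integrable_of_continuous (continuous_finsetSum s hf).abs)
    (Torus.integrable_of_continuous (continuous_finsetSum s fun i hi => (hf i hi).abs))
    fun x => Finset.abs_sum_le_sum_abs _ _

theorem integral_abs_ite_le (p : Prop) [Decidable p] (f : Torus d → ℝ) :
    ∫ x, |if p then f x else 0| ≤ ∫ x, |f x| := by
  split_ifs
  · exact le_rfl
  · simpa using integral_nonneg fun x => abs_nonneg (f x)

/-- Interpolation between `L¹` and `L^∞`. -/
theorem eLpNorm_le_of_abs_le {f : Torus d → ℝ} (hf : Continuous f) {B q p : ℝ} (hB : 0 ≤ B)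
    (hq : 0 ≤ q) (hp : 1 ≤ p) (h1 : ∀ x, |f x| ≤ B) (h2 : ∫ x, |f x| ≤ B * q) :
    eLpNorm f (ENNReal.ofReal p) volume ≤ ENNReal.ofReal (B * q ^ (1 / p)) := by
  have hp0 : 0 < p := by linarith
  have hpow : ∫ x, |f x| ^ p ≤ B ^ p * q := by
    have h3 : ∀ x, |f x| ^ p ≤ B ^ (p - 1) * |f x| := fun x => by
      have : |f x| ^ p = |f x| ^ (p - 1) * |f x| := by
        rcases eq_or_lt_of_le (abs_nonneg (f x)) with h0 | h0
        · rw [← h0, Real.zero_rpow hp0.ne', mul_zero]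
        · rw [Real.rpow_sub_one h0.ne']; field_simp
      rw [this]
      exact mul_le_mul_of_nonneg_right
        (Real.rpow_le_rpow (abs_nonneg _) (h1 x) (by linarith)) (abs_nonneg _)
    have h4 : ∫ x, |f x| ^ p ≤ ∫ x, B ^ (p - 1) * |f x| :=
      integral_mono (Torus.integrable_of_continuous
        (hf.abs.rpow_const fun x => Or.inr hp0.le))
        (Torus.integrable_of_continuous (continuous_const.mul hf.abs)) h3
    rw [integral_const_mul] at h4
    refine h4.trans ((mul_le_mul_of_nonneg_left h2 (Real.rpow_nonneg hB _)).trans (le_of_eq ?_))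
    rcases eq_or_lt_of_le hB with h0 | h0
    · rw [← h0, Real.zero_rpow hp0.ne']; ring
    · rw [Real.rpow_sub_one h0.ne']; field_simp
  rw [eLpNorm_eq_lintegral_rpow_enorm_toReal (by simpa using hp0) ENNReal.ofReal_ne_top,
    ENNReal.toReal_ofReal hp0.le]
  have h5 : ∫⁻ x, ‖f x‖ₑ ^ p = ENNReal.ofReal (∫ x, |f x| ^ p) := by
    rw [ofReal_integral_eq_lintegral_ofReal (Torus.integrable_of_continuous
        (hf.abs.rpow_const fun x => Or.inr hp0.le))
      (Filter.Eventually.of_forall fun x => Real.rpow_nonneg (abs_nonneg _) _)]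
    congr 1
    funext x
    rw [← ENNReal.ofReal_rpow_of_nonneg (abs_nonneg _) hp0.le, Real.enorm_eq_ofReal_abs]
  rw [h5, ENNReal.ofReal_rpow_of_nonneg
    (integral_nonneg fun x => Real.rpow_nonneg (abs_nonneg _) _) (by positivity)]
  refine ENNReal.ofReal_le_ofReal ?_
  refine (Real.rpow_le_rpow (integral_nonneg fun x => Real.rpow_nonneg (abs_nonneg _) _) hpow
    (by positivity)).trans (le_of_eq ?_)
  rw [Real.mul_rpow (by positivity) hq, ← Real.rpow_mul hB, mul_one_div_cancel hp0.ne',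
    Real.rpow_one]

end L1

namespace PipeSystem

variable {d : ℕ} {ι : Type} (S : PipeSystem d ι)

theorem integral_W_le (α : ι) (t : ℝ) : ∫ x, |S.W α t x| ≤ S.M * S.μ⁻¹ ^ (d - 1) := by
  rw [W, integral_abs_moving S.n_pos _ (S.P α).smooth_W.continuous]
  exact (S.P α).integral_W_le

theorem integral_H_le (α : ι) (t : ℝ) : ∫ x, |S.H α t x| ≤ S.M * S.μ⁻¹ := by
  rw [H, integral_abs_moving S.n_pos _ (S.P α).smooth_H.continuous]
  exact (S.P α).integral_H_le

theorem integral_G_le (α : ι) (i : Fin d) (t : ℝ) : ∫ x, |S.G α i t x| ≤ S.M := by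
  rw [G, integral_abs_moving S.n_pos _ ((S.P α).smooth_G i).continuous]
  exact (S.P α).integral_G_le i

theorem abs_W_le (α : ι) (t : ℝ) (x : Torus d) : |S.W α t x| ≤ 1 := (S.P α).abs_W_le _

theorem continuous_W (α : ι) (t : ℝ) : Continuous (S.W α t) := ((S.smooth_W α).slice t).continuous

theorem continuous_Θ (α : ι) (t : ℝ) : Continuous (S.Θ α t) := ((S.smooth_Θ α).slice t).continuous

theorem continuous_H (α : ι) (t : ℝ) : Continuous (S.H α t) := ((S.smooth_H α).slice t).continuous

theorem continuous_G (α : ι) (i : Fin d) (t : ℝ) : Continuous (S.G α i t) :=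
  ((S.smooth_G α i).slice t).continuous

theorem continuous_a (α : ι) (t : ℝ) : Continuous (S.a α t) := ((S.smooth_a α).slice t).continuous

theorem continuous_torusPartial_a (α : ι) (i : Fin d) (t : ℝ) :
    Continuous (torusPartial i (S.a α t)) := (((S.smooth_a α).torusPartial i).slice t).continuous

/-- Bounds at time `t` for the coefficients of a family of pipes: `C` bounds everything that only
involves the slow variables, and `T` the time derivatives. -/
structure Bounds (C T t : ℝ) : Prop where
  C_nonneg : 0 ≤ C
  T_nonneg : 0 ≤ T
  M_nonneg : 0 ≤ S.M
  μ_ge : 1 ≤ S.μ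
  partial_a : ∀ α i x, |torusPartial i (S.a α t) x| ≤ C
  time_a : ∀ α x, |timePartial (S.a α) t x| ≤ T
  velocity : ∀ α i, |S.c α i| ≤ C
  lipschitz : ∀ α x (v : Fin d → ℝ), ‖v‖ ≤ 1 →
    |S.a α t (x + Torus.proj d v)| ≤ |S.a α t x| + C * ‖v‖
  abs_g : ∀ t, |S.g t| ≤ 1

variable {S} {C T t : ℝ}

theorem integral_transportError_le (hb : S.Bounds C T t) (α : ι) :
    ∫ x, |S.transportError α t x| ≤ (S.η * S.n)⁻¹ * ((T + d * (C * C)) * (S.M * S.μ⁻¹)) := by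
  have hη := S.η_pos
  have hn : (0 : ℝ) ≤ S.n := Nat.cast_nonneg _
  have h0 : 0 ≤ (S.η * S.n)⁻¹ := by positivity
  unfold transportError
  rw [integral_abs_const_mul, abs_of_nonneg h0]
  refine mul_le_mul_of_nonneg_left ?_ h0
  have hbound : ∀ x, |timePartial (S.a α) t x + ∑ i, S.c α i * torusPartial i (S.a α t) x| ≤
      T + d * (C * C) := fun x => by
    refine (abs_add_le _ _).trans (add_le_add (hb.time_a α x) ?_)
    refine (Finset.abs_sum_le_sum_abs _ _).trans ?_
    have : ∀ i ∈ Finset.univ, |S.c α i * torusPartial i (S.a α t) x| ≤ C * C := fun i _ => by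
      rw [abs_mul]
      exact mul_le_mul (hb.velocity α i) (hb.partial_a α i x) (abs_nonneg _) hb.C_nonneg
    refine (Finset.sum_le_sum this).trans (le_of_eq ?_)
    simp
  have hc : Continuous fun x => timePartial (S.a α) t x +
      ∑ i, S.c α i * torusPartial i (S.a α t) x :=
    (((S.smooth_a α).timePartial.add (SmoothInTime.sum fun i _ =>
      ((S.smooth_a α).torusPartial i).const_mul _)).slice t).continuous
  have hT : 0 ≤ T + d * (C * C) :=
    add_nonneg hb.T_nonneg (mul_nonneg (Nat.cast_nonneg _) (mul_nonneg hb.C_nonneg hb.C_nonneg))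
  exact (integral_abs_mul_le hc (S.continuous_H α t) hbound).trans
    (mul_le_mul_of_nonneg_left (S.integral_H_le α t) hT)

theorem integral_correctorError_le (hb : S.Bounds C T t) (α : ι) :
    ∫ x, |S.correctorError α t x| ≤ (S.n : ℝ)⁻¹ * (C * (S.M * S.μ⁻¹)) := by
  have h0 : 0 ≤ (S.n : ℝ)⁻¹ := by positivity
  unfold correctorError
  rw [integral_abs_const_mul, abs_of_nonneg h0]
  refine mul_le_mul_of_nonneg_left ?_ h0
  refine (integral_abs_mul_le (S.continuous_torusPartial_a α _ t)
    ((S.continuous_H α t).mul (S.continuous_W α t)) (hb.partial_a α _)).trans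
    (mul_le_mul_of_nonneg_left ?_ hb.C_nonneg)
  have h1 := integral_abs_mul_le (S.continuous_W α t) (S.continuous_H α t) (S.abs_W_le α t)
  simp only [mul_comm (S.W α t _), one_mul] at h1
  exact h1.trans (S.integral_H_le α t)

theorem integral_oscillationError_le (hb : S.Bounds C T t) (α : ι) (i : Fin d) :
    ∫ x, |S.oscillationError α i t x| ≤ (S.n : ℝ)⁻¹ * (C * S.M + d * (C * S.M)) := by
  have h0 : 0 ≤ (S.n : ℝ)⁻¹ := by positivity
  unfold oscillationError
  rw [integral_abs_const_mul, abs_of_nonneg h0]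
  refine mul_le_mul_of_nonneg_left ?_ h0
  have h1 : ∀ l m, ∫ x, |torusPartial l (S.a α t) x * S.G α m t x| ≤ C * S.M := fun l m =>
    (integral_abs_mul_le (S.continuous_torusPartial_a α _ t) (S.continuous_G α m t)
      (hb.partial_a α _)).trans (mul_le_mul_of_nonneg_left (S.integral_G_le α m t) hb.C_nonneg)
  have hc : ∀ l m, Continuous fun x => torusPartial l (S.a α t) x * S.G α m t x := fun l m =>
    (S.continuous_torusPartial_a α _ t).mul (S.continuous_G α m t)
  have h2 : ∫ x, |(if S.j α = i then ∑ l, torusPartial l (S.a α t) x * S.G α l t x else 0)| ≤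
      d * (C * S.M) := by
    refine (integral_abs_ite_le _ _).trans ((integral_abs_sum_le _ fun l _ => hc l l).trans ?_)
    refine (Finset.sum_le_sum fun l _ => h1 l l).trans (le_of_eq ?_)
    simp
  have h3 : Continuous fun x =>
      if S.j α = i then ∑ l, torusPartial l (S.a α t) x * S.G α l t x else 0 :=
    (((S.smooth_sum_partial_mul_G α).ite _).slice t).continuous
  have h4 : ∫ x, |torusPartial (S.j α) (S.a α t) x * S.G α i t x -
      if S.j α = i then ∑ l, torusPartial l (S.a α t) x * S.G α l t x else 0| ≤
      (∫ x, |torusPartial (S.j α) (S.a α t) x * S.G α i t x|) +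
      ∫ x, |-if S.j α = i then ∑ l, torusPartial l (S.a α t) x * S.G α l t x else 0| := by
    simp only [sub_eq_add_neg]
    exact integral_abs_add_le (hc (S.j α) i) h3.neg
  simp only [abs_neg] at h4
  exact h4.trans (add_le_add (h1 _ _) h2)

theorem integral_a_mul_Θ_le (hb : S.Bounds C T t) (α : ι) :
    ∫ x, |S.a α t x * S.Θ α t x| ≤ ((∫ x, |S.a α t x|) + C / S.n) * S.M := by
  have h1 := integral_mul_oscillating_le (S.continuous_a α t).abs
    (S.P α).smooth_Θ.continuous.abs (fun x => abs_nonneg _) hb.C_nonneg (hb.lipschitz α) S.n_pos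
    (Torus.proj d (S.s α t))
  simp only [abs_mul]
  refine h1.trans (mul_le_mul_of_nonneg_left (S.P α).integral_Θ_le ?_)
  exact add_nonneg (integral_nonneg fun x => abs_nonneg _)
    (div_nonneg hb.C_nonneg (Nat.cast_nonneg _))

theorem integral_partial_a_mul_H_le (hb : S.Bounds C T t) (α : ι) :
    ∫ x, |torusPartial (S.k α) (S.a α t) x * S.H α t x| ≤ C * (S.M * S.μ⁻¹) :=
  (integral_abs_mul_le (S.continuous_torusPartial_a α _ t) (S.continuous_H α t)
    (hb.partial_a α _)).trans (mul_le_mul_of_nonneg_left (S.integral_H_le α t) hb.C_nonneg)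

/-- The density tested against a function `f` of size `κ` where the coefficient of the pipe lives,
and of size `C'` elsewhere. -/
theorem integral_densityPart_mul_le (hb : S.Bounds C T t) (α : ι) {f : Torus d → ℝ}
    (hf : Continuous f) {κ C' : ℝ} (hκ : ∀ x, S.a α t x ≠ 0 → |f x| ≤ κ) (hκ0 : 0 ≤ κ)
    (hC' : ∀ x, |f x| ≤ C') (hC'0 : 0 ≤ C') : ∫ x, |S.densityPart α t x * f x| ≤
      κ * (S.η⁻¹ * (((∫ x, |S.a α t x|) + C / S.n) * S.M)) +
        C' * ((S.η * S.n)⁻¹ * (C * (S.M * S.μ⁻¹))) := by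
  have hη := S.η_pos
  have hn : (0 : ℝ) ≤ S.n := Nat.cast_nonneg _
  have h0 : 0 ≤ (S.η * S.n)⁻¹ := by positivity
  have h1 : 0 ≤ S.η⁻¹ := by positivity
  have c1 : Continuous fun x => S.a α t x * S.Θ α t x :=
    (S.continuous_a α t).mul (S.continuous_Θ α t)
  have c2 : Continuous fun x => torusPartial (S.k α) (S.a α t) x * S.H α t x :=
    (S.continuous_torusPartial_a α _ t).mul (S.continuous_H α t)
  have c3 : Continuous fun x => S.densityPart α t x * f x :=
    ((S.smooth_densityPart α).slice t).continuous.mul hf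
  have hpt : ∀ x, |S.densityPart α t x * f x| ≤ κ * S.η⁻¹ * |S.a α t x * S.Θ α t x| +
      C' * (S.η * S.n)⁻¹ * |torusPartial (S.k α) (S.a α t) x * S.H α t x| := fun x => by
    rw [densityPart_eq, add_mul]
    refine (abs_add_le _ _).trans (add_le_add ?_ ?_)
    · by_cases ha : S.a α t x = 0
      · simp [ha]
      · rw [abs_mul, abs_mul, abs_of_nonneg h1]
        have := mul_le_mul_of_nonneg_left (hκ x ha)
          (mul_nonneg h1 (abs_nonneg (S.a α t x * S.Θ α t x)))
        linarith
    · rw [abs_mul, abs_mul, abs_of_nonneg h0]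
      have := mul_le_mul_of_nonneg_left (hC' x)
        (mul_nonneg h0 (abs_nonneg (torusPartial (S.k α) (S.a α t) x * S.H α t x)))
      linarith
  have c4 : Continuous fun x => κ * S.η⁻¹ * |S.a α t x * S.Θ α t x| :=
    continuous_const.mul c1.abs
  have c5 : Continuous fun x =>
      C' * (S.η * S.n)⁻¹ * |torusPartial (S.k α) (S.a α t) x * S.H α t x| :=
    continuous_const.mul c2.abs
  have h2 : ∫ x, |S.densityPart α t x * f x| ≤ ∫ x, (κ * S.η⁻¹ * |S.a α t x * S.Θ α t x| +
      C' * (S.η * S.n)⁻¹ * |torusPartial (S.k α) (S.a α t) x * S.H α t x|) :=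
    integral_mono (Torus.integrable_of_continuous c3.abs)
      (Torus.integrable_of_continuous (c4.add c5)) hpt
  refine h2.trans ?_
  rw [integral_add (Torus.integrable_of_continuous c4) (Torus.integrable_of_continuous c5),
    integral_const_mul, integral_const_mul, mul_assoc, mul_assoc]
  gcongr
  · exact integral_a_mul_Θ_le hb α
  · exact integral_partial_a_mul_H_le hb α

variable [Fintype ι]

theorem integral_density_le (hb : S.Bounds C T t) : ∫ x, |S.density t x| ≤
    (S.η⁻¹ * S.M * ∑ α, ∫ x, |S.a α t x|) + Fintype.card ι *
      (S.η⁻¹ * (C / S.n * S.M) + (S.η * S.n)⁻¹ * (C * (S.M * S.μ⁻¹))) := by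
  refine (integral_abs_sum_le Finset.univ fun α _ =>
    ((S.smooth_densityPart α).slice t).continuous).trans ?_
  have h : ∀ α ∈ Finset.univ, ∫ x, |S.densityPart α t x| ≤
      (S.η⁻¹ * S.M * ∫ x, |S.a α t x|) +
      (S.η⁻¹ * (C / S.n * S.M) + (S.η * S.n)⁻¹ * (C * (S.M * S.μ⁻¹))) := fun α _ => by
    have := integral_densityPart_mul_le hb α (f := fun _ => 1) continuous_const (κ := 1) (C' := 1)
      (by simp) zero_le_one (by simp) zero_le_one
    simp only [mul_one, one_mul] at this
    refine this.trans (le_of_eq (by ring))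
  refine (Finset.sum_le_sum h).trans (le_of_eq ?_)
  rw [Finset.sum_add_distrib, Finset.mul_sum, Finset.sum_const, Finset.card_univ, nsmul_eq_mul]

theorem integral_field_le (hb : S.Bounds C T t) (i : Fin d) : ∫ x, |S.field i t x| ≤
    Fintype.card ι * (S.η * (S.M * S.μ⁻¹ ^ (d - 1))) := by
  have hη := S.η_pos
  unfold field
  refine (integral_abs_sum_le Finset.univ fun α _ =>
    ((((SmoothInTime.of_time S.smooth_g).const_mul S.η).mul
      ((S.smooth_W α).ite (S.j α = i))).slice t).continuous).trans ?_
  have h : ∀ α ∈ Finset.univ, ∫ x, |S.η * S.g t * if S.j α = i then S.W α t x else 0| ≤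
      S.η * (S.M * S.μ⁻¹ ^ (d - 1)) := fun α _ => by
    rw [integral_abs_const_mul, abs_mul, abs_of_pos hη]
    exact mul_le_mul (mul_le_of_le_one_right hη.le (hb.abs_g t))
      ((integral_abs_ite_le _ _).trans (S.integral_W_le α t))
      (integral_nonneg fun x => abs_nonneg _) hη.le
  refine (Finset.sum_le_sum h).trans (le_of_eq ?_)
  simp

theorem torusPartial_field (l i : Fin d) (t : ℝ) (x : Torus d) :
    torusPartial l (S.field i t) x = ∑ α, S.η * S.g t *
      if S.j α = i then S.n * moving S.n (S.s α) (torusPartial l (S.P α).W) t x else 0 := by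
  unfold field
  rw [torusPartial_sum fun α _ => ((((SmoothInTime.of_time S.smooth_g).const_mul S.η).mul
      ((S.smooth_W α).ite (S.j α = i))).slice t)]
  refine Finset.sum_congr rfl fun α _ => ?_
  rw [torusPartial_const_mul _ (((S.smooth_W α).ite _).slice t)]
  congr 1
  split_ifs
  · exact torusPartial_moving _ _ (S.P α).smooth_W l t x
  · exact torusPartial_const l 0 x

theorem abs_torusPartial_field_le (hb : S.Bounds C T t) (l i : Fin d) (x : Torus d) :
    |torusPartial l (S.field i t) x| ≤ Fintype.card ι * (S.η * (S.n * (S.M * S.μ))) := by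
  have hη := S.η_pos
  have hM := hb.M_nonneg
  have hμ : 0 ≤ S.μ := zero_le_one.trans hb.μ_ge
  rw [torusPartial_field]
  refine (Finset.abs_sum_le_sum_abs _ _).trans ?_
  have h : ∀ α ∈ Finset.univ, |S.η * S.g t * if S.j α = i then
      S.n * moving S.n (S.s α) (torusPartial l (S.P α).W) t x else 0| ≤
      S.η * (S.n * (S.M * S.μ)) := fun α _ => by
    rw [abs_mul, abs_mul, abs_of_pos hη]
    refine mul_le_mul (mul_le_of_le_one_right hη.le (hb.abs_g t)) ?_ (abs_nonneg _) hη.le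
    split_ifs
    · rw [abs_mul, Nat.abs_cast]
      exact mul_le_mul_of_nonneg_left ((S.P α).abs_partial_W_le l _) (Nat.cast_nonneg _)
    · rw [abs_zero]; positivity
  refine (Finset.sum_le_sum h).trans (le_of_eq ?_)
  simp

theorem integral_torusPartial_field_le (hb : S.Bounds C T t) (l i : Fin d) :
    ∫ x, |torusPartial l (S.field i t) x| ≤
      Fintype.card ι * (S.η * (S.n * (S.M * S.μ))) * S.μ⁻¹ ^ (d - 1) := by
  have hη := S.η_pos
  have hM := hb.M_nonneg
  have hμ : 0 ≤ S.μ := zero_le_one.trans hb.μ_ge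
  have hs : ∀ α, SmoothOnTorus fun x => S.η * S.g t *
      if S.j α = i then S.n * moving S.n (S.s α) (torusPartial l (S.P α).W) t x else 0 := fun α =>
    ((((SmoothInTime.of_time S.smooth_g).const_mul S.η).mul
      (((((S.P α).smooth_W.torusPartial l).moving S.n (S.smooth_s α)).const_mul S.n).ite
        (S.j α = i))).slice t)
  simp only [torusPartial_field]
  refine (integral_abs_sum_le Finset.univ fun α _ => (hs α).continuous).trans ?_
  have h : ∀ α ∈ Finset.univ, ∫ x, |S.η * S.g t * if S.j α = i then
      S.n * moving S.n (S.s α) (torusPartial l (S.P α).W) t x else 0| ≤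
      S.η * (S.n * (S.M * S.μ * S.μ⁻¹ ^ (d - 1))) := fun α _ => by
    rw [integral_abs_const_mul, abs_mul, abs_of_pos hη]
    refine mul_le_mul (mul_le_of_le_one_right hη.le (hb.abs_g t))
      ((integral_abs_ite_le _ _).trans ?_) (integral_nonneg fun x => abs_nonneg _) hη.le
    rw [integral_abs_const_mul, Nat.abs_cast,
      integral_abs_moving S.n_pos _ ((S.P α).smooth_W.torusPartial l).continuous]
    exact mul_le_mul_of_nonneg_left ((S.P α).integral_partial_W_le l) (Nat.cast_nonneg _)
  refine (Finset.sum_le_sum h).trans (le_of_eq ?_)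
  simp only [Finset.sum_const, Finset.card_univ, nsmul_eq_mul]
  ring

/-- The factor `κ` in front of `‖a‖₁` is the accuracy of the frozen velocities; the remaining terms
tend to zero as first `n` and then `μ` tend to infinity. -/
theorem integral_error_le (hb : S.Bounds C T t) (D : DefectSolution d) {κ : ℝ} (hκ0 : 0 ≤ κ)
    (hκ : ∀ α i x, S.a α t x ≠ 0 → |D.u i t x - S.c α i| ≤ κ)
    (hC : ∀ α i x, |D.u i t x - S.c α i| ≤ C) (hρ : ∀ x, |D.ρ t x| ≤ C) (i : Fin d) :
    ∫ x, |S.error D i t x| ≤ κ * (S.η⁻¹ * S.M * ∑ α, ∫ x, |S.a α t x|) +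
      Fintype.card ι * (κ * (S.η⁻¹ * (C / S.n * S.M)) +
        (S.η * S.n)⁻¹ * ((T + d * (C * C)) * (S.M * S.μ⁻¹)) +
        C * ((S.η * S.n)⁻¹ * (C * (S.M * S.μ⁻¹))) + (S.n : ℝ)⁻¹ * (C * (S.M * S.μ⁻¹)) +
        (S.n : ℝ)⁻¹ * (C * S.M + d * (C * S.M)) + C * (S.η * (S.M * S.μ⁻¹ ^ (d - 1)))) := by
  unfold error
  refine (integral_abs_add_le
    ((SmoothInTime.sum fun α _ => S.smooth_error_term D α i).slice t).continuous
    ((D.smooth_ρ.mul (S.smooth_field i)).slice t).continuous).trans ?_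
  have h1 : ∫ x, |D.ρ t x * S.field i t x| ≤
      C * (Fintype.card ι * (S.η * (S.M * S.μ⁻¹ ^ (d - 1)))) :=
    (integral_abs_mul_le (D.smooth_ρ.slice t).continuous
      ((S.smooth_field i).slice t).continuous hρ).trans
      (mul_le_mul_of_nonneg_left (integral_field_le hb i) hb.C_nonneg)
  have h2 : ∀ α ∈ Finset.univ, ∫ x, |(if S.k α = i then S.transportError α t x else 0) +
      S.densityPart α t x * (D.u i t x - S.c α i) +
      (if S.j α = i then S.correctorError α t x else 0) + S.oscillationError α i t x| ≤
      κ * (S.η⁻¹ * S.M * ∫ x, |S.a α t x|) + (κ * (S.η⁻¹ * (C / S.n * S.M)) +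
        (S.η * S.n)⁻¹ * ((T + d * (C * C)) * (S.M * S.μ⁻¹)) +
        C * ((S.η * S.n)⁻¹ * (C * (S.M * S.μ⁻¹))) + (S.n : ℝ)⁻¹ * (C * (S.M * S.μ⁻¹)) +
        (S.n : ℝ)⁻¹ * (C * S.M + d * (C * S.M))) := fun α _ => by
    have c1 := (((S.smooth_transportError α).ite (S.k α = i)).slice t)
    have c2 := ((S.smooth_densityPart_mul D α i).slice t)
    have c3 := (((S.smooth_correctorError α).ite (S.j α = i)).slice t)
    have c4 := ((S.smooth_oscillationError α i).slice t)
    have e1 := (integral_abs_ite_le (S.k α = i) (S.transportError α t)).trans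
      (integral_transportError_le hb α)
    have e2 := integral_densityPart_mul_le hb α (((D.smooth_u i).sub
      (SmoothInTime.const (S.c α i))).slice t).continuous (hκ α i) hκ0 (hC α i) hb.C_nonneg
    have e3 := (integral_abs_ite_le (S.j α = i) (S.correctorError α t)).trans
      (integral_correctorError_le hb α)
    have e4 := integral_oscillationError_le hb α i
    have i1 := integral_abs_add_le ((c1.add c2).add c3).continuous c4.continuous
    have i2 := integral_abs_add_le (c1.add c2).continuous c3.continuous
    have i3 := integral_abs_add_le c1.continuous c2.continuous
    linarith
  have h3 := (integral_abs_sum_le Finset.univ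
    fun α _ => ((S.smooth_error_term D α i).slice t).continuous).trans (Finset.sum_le_sum h2)
  rw [Finset.sum_add_distrib, ← Finset.mul_sum, ← Finset.mul_sum, Finset.sum_const,
    Finset.card_univ, nsmul_eq_mul] at h3
  linarith

end PipeSystem

/-! ### Cutoffs in time and in the space of velocities -/

/-- A partition of unity `ζ₀ + ζ₁ = 1` of the time axis, and bounded displacements `ξ₀, ξ₁` moving
with unit speed on the support of `ζ₀`, `ζ₁`. -/
theorem exists_time_cutoffs : ∃ (ζ ξ : Bool → ℝ → ℝ) (B : ℝ), 0 ≤ B ∧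
    (∀ b, ContDiff ℝ ∞ (ζ b)) ∧ (∀ b, ContDiff ℝ ∞ (ξ b)) ∧ (∀ b s, 0 ≤ ζ b s) ∧
    (∀ b s, ζ b s ≤ 1) ∧ (∀ s, ζ true s + ζ false s = 1) ∧ (∀ b s, |ξ b s| ≤ B) ∧
    (∀ b s, |deriv (ζ b) s| ≤ B) ∧ ∀ b s, ζ b s * deriv (ξ b) s = ζ b s := by
  set q : ℝ → ℝ := fun y => Real.smoothTransition (y + 1 / 2) with hq
  have hqs : ContDiff ℝ ∞ q := Real.smoothTransition.contDiff.comp (contDiff_id.add contDiff_const)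
  have hq1 : ∀ y, q (-y) + (1 - q (-y)) = 1 := fun y => by ring
  -- `κ` vanishes on the support of `q`
  set κ : ℝ → ℝ := fun y => Real.smoothTransition (-1 / 2 - y) with hκ
  have hκs : ContDiff ℝ ∞ κ := Real.smoothTransition.contDiff.comp (contDiff_const.sub contDiff_id)
  have hper : Function.Periodic (fun r : ℝ => κ (Real.sin r)) (2 * Real.pi) := fun r => by
    simp only [Real.sin_add_two_pi]
  have hκc : Continuous fun r : ℝ => κ (Real.sin r) := hκs.continuous.comp Real.continuous_sin
  have hpi := Real.pi_pos
  set A : ℝ := ∫ r in (0 : ℝ)..(2 * Real.pi), κ (Real.sin r) with hA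
  have hApos : 0 < A := by
    refine intervalIntegral.integral_pos (by positivity) hκc.continuousOn
      (fun r _ => Real.smoothTransition.nonneg _) ⟨3 * Real.pi / 2, ⟨by positivity, by linarith⟩, ?_⟩
    refine Real.smoothTransition.pos_of_pos ?_
    have : Real.sin (3 * Real.pi / 2) = -1 := by
      rw [show 3 * Real.pi / 2 = Real.pi / 2 + Real.pi by ring, Real.sin_add_pi, Real.sin_pi_div_two]
    rw [this]; norm_num
  set c : ℝ := 2 * Real.pi / A with hc
  set ξ₀ : ℝ → ℝ := fun s => s - c * ∫ r in (0 : ℝ)..s, κ (Real.sin r) with hξ₀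
  have hξd : ∀ s, HasDerivAt ξ₀ (1 - c * κ (Real.sin s)) s := fun s =>
    (hasDerivAt_id s).sub ((intervalIntegral.integral_hasDerivAt_right
      (hκc.intervalIntegrable _ _) hκc.aestronglyMeasurable.stronglyMeasurableAtFilter
      hκc.continuousAt).const_mul c)
  have hξderiv : deriv ξ₀ = fun s => 1 - c * κ (Real.sin s) := funext fun s => (hξd s).deriv
  have hξs : ContDiff ℝ ∞ ξ₀ := by
    rw [contDiff_infty_iff_deriv]
    refine ⟨fun s => (hξd s).differentiableAt, ?_⟩
    rw [hξderiv]
    exact contDiff_const.sub (contDiff_const.mul (hκs.comp Real.contDiff_sin))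
  have hξper : Function.Periodic ξ₀ (2 * Real.pi) := fun s => by
    have h1 := intervalIntegral.integral_interval_sub_left
      (hκc.intervalIntegrable (μ := volume) 0 (s + 2 * Real.pi)) (hκc.intervalIntegrable 0 s)
    rw [hper.intervalIntegral_add_eq s 0, zero_add, ← hA] at h1
    have h2 : c * A = 2 * Real.pi := by rw [hc]; field_simp
    simp only [hξ₀]
    rw [sub_eq_iff_eq_add.1 h1]
    linarith
  obtain ⟨B₁, hB₁⟩ : ∃ B, ∀ s, |ξ₀ s| ≤ B := by
    obtain ⟨B, hB⟩ := isCompact_Icc.exists_bound_of_continuousOn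
      (s := Icc 0 (2 * Real.pi)) hξs.continuous.continuousOn
    refine ⟨B, fun s => ?_⟩
    obtain ⟨y, hy, hys⟩ := hξper.exists_mem_Ico₀ (by positivity) s
    rw [hys]
    exact hB y (Ico_subset_Icc_self hy)
  have hq's : ContDiff ℝ ∞ (deriv q) := ((contDiff_infty_iff_deriv).1 hqs).2
  obtain ⟨B₂, hB₂⟩ := (isCompact_Icc (a := (-1 : ℝ)) (b := 1)).exists_bound_of_continuousOn
    hq's.continuous.continuousOn
  have hζd : ∀ s, HasDerivAt (fun s => q (Real.sin s)) (deriv q (Real.sin s) * Real.cos s) s :=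
    fun s => ((hqs.differentiable (by simp) _).hasDerivAt).comp s (Real.hasDerivAt_sin s)
  have hζb : ∀ s, |deriv q (Real.sin s) * Real.cos s| ≤ max B₁ B₂ := fun s => by
    rw [abs_mul]
    have h1 := hB₂ (Real.sin s) ⟨Real.neg_one_le_sin s, Real.sin_le_one s⟩
    exact (mul_le_of_le_one_right (abs_nonneg _) (Real.abs_cos_le_one s)).trans
      (h1.trans (le_max_right _ _))
  refine ⟨fun b => if b then fun s => q (Real.sin s) else fun s => 1 - q (Real.sin s),
    fun b => if b then ξ₀ else fun s => ξ₀ (s + Real.pi), max B₁ B₂,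
    (abs_nonneg _).trans ((hB₁ 0).trans (le_max_left _ _)), ?_, ?_, ?_, ?_, ?_, ?_, ?_, ?_⟩
  · rintro (_ | _)
    · exact contDiff_const.sub (hqs.comp Real.contDiff_sin)
    · exact hqs.comp Real.contDiff_sin
  · rintro (_ | _)
    · exact hξs.comp (contDiff_id.add contDiff_const)
    · exact hξs
  · rintro (_ | _) s
    · exact sub_nonneg.2 (Real.smoothTransition.le_one _)
    · exact Real.smoothTransition.nonneg _
  · rintro (_ | _) s
    · exact sub_le_self _ (Real.smoothTransition.nonneg _)
    · exact Real.smoothTransition.le_one _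
  · intro s
    simp
  · rintro (_ | _) s
    · exact (hB₁ _).trans (le_max_left _ _)
    · exact (hB₁ _).trans (le_max_left _ _)
  · rintro (_ | _) s
    · have : HasDerivAt (fun s => 1 - q (Real.sin s)) (-(deriv q (Real.sin s) * Real.cos s)) s :=
        (hζd s).const_sub 1
      simp only [Bool.false_eq_true, if_false]
      rw [this.deriv, abs_neg]
      exact hζb s
    · simp only [if_true]
      rw [(hζd s).deriv]
      exact hζb s
  · have key : ∀ y, q y * (1 - c * κ y) = q y := fun y => by
      rcases le_total y (-1 / 2) with h | h
      · have : q y = 0 := Real.smoothTransition.zero_of_nonpos (by linarith)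
        rw [this, zero_mul]
      · have : κ y = 0 := Real.smoothTransition.zero_of_nonpos (by linarith)
        rw [this]; ring
    rintro (_ | _) s
    · simp only [Bool.false_eq_true, if_false]
      have h1 : HasDerivAt (fun s => ξ₀ (s + Real.pi)) (1 - c * κ (Real.sin (s + Real.pi))) s :=
        (hξd (s + Real.pi)).comp_add_const s Real.pi
      rw [h1.deriv, Real.sin_add_pi]
      rcases le_total (Real.sin s) (1 / 2) with h | h
      · have : κ (-Real.sin s) = 0 := Real.smoothTransition.zero_of_nonpos (by linarith)
        rw [this]; ring
      · have : q (Real.sin s) = 1 := Real.smoothTransition.one_of_one_le (by linarith)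
        rw [this]; ring
    · simp only [if_true, hξderiv]
      exact key _

/-- A finite smooth partition of unity on a ball of velocities, with small supports. -/
theorem exists_velocity_partition (d : ℕ) (B : ℝ) {κ : ℝ} (hκ : 0 < κ) :
    ∃ (N : ℕ) (c : Fin N → Fin d → ℝ) (χ : Fin N → (Fin d → ℝ) → ℝ),
      (∀ k, ContDiff ℝ ∞ (χ k)) ∧ (∀ k v, 0 ≤ χ k v) ∧
      (∀ k v, χ k v ≠ 0 → ‖v - c k‖ ≤ κ) ∧ ∀ v, ‖v‖ ≤ B → ∑ k, χ k v = 1 := by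
  obtain ⟨F, -, hF⟩ := (isCompact_closedBall (0 : Fin d → ℝ) B).elim_finite_subcover_image
    (b := univ) (c := fun v => Metric.ball v κ) (fun v _ => Metric.isOpen_ball)
    (fun v _ => mem_iUnion₂.2 ⟨v, trivial, Metric.mem_ball_self hκ⟩)
  obtain ⟨hFfin, hcov⟩ := hF
  have e : hFfin.toFinset ≃ Fin hFfin.toFinset.card := hFfin.toFinset.equivFin
  set c : Fin hFfin.toFinset.card → Fin d → ℝ := fun k => (e.symm k : Fin d → ℝ) with hc
  obtain ⟨f, hf⟩ := SmoothPartitionOfUnity.exists_isSubordinate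
    (modelWithCornersSelf ℝ (Fin d → ℝ)) (Metric.isClosed_closedBall (x := (0 : Fin d → ℝ)) (ε := B))
    (fun k => Metric.ball (c k) κ) (fun k => Metric.isOpen_ball) (fun v hv => by
      obtain ⟨w, hw, hvw⟩ := mem_iUnion₂.1 (hcov hv)
      refine mem_iUnion.2 ⟨e ⟨w, hFfin.mem_toFinset.2 hw⟩, ?_⟩
      simpa [hc] using hvw)
  refine ⟨_, c, fun k => f k, fun k => ?_, fun k v => f.nonneg k v, fun k v hv => ?_, fun v hv => ?_⟩
  · exact (f k).contMDiff.contDiff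
  · have := hf k (subset_tsupport _ hv)
    rw [← dist_eq_norm]
    exact (Metric.mem_ball.1 this).le
  · have := f.sum_eq_one (x := v) (by simpa using hv)
    rwa [finsum_eq_sum_of_fintype] at this

theorem exists_window {δ : ℝ} (hδ : 0 < δ) : ∃ g : ℝ → ℝ, ContDiff ℝ ∞ g ∧ (∀ t, |g t| ≤ 1) ∧
    (∀ t ∈ Icc δ (1 - δ), g t = 1) ∧ ∀ t ∉ Icc (δ / 2) (1 - δ / 2), g t = 0 := by
  refine ⟨fun t => Real.smoothTransition (2 / δ * t - 1) *
    Real.smoothTransition (2 / δ * (1 - t) - 1), ?_, fun t => ?_, fun t ht => ?_, fun t ht => ?_⟩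
  · exact (Real.smoothTransition.contDiff.comp ((contDiff_const.mul contDiff_id).sub
      contDiff_const)).mul (Real.smoothTransition.contDiff.comp
        ((contDiff_const.mul (contDiff_const.sub contDiff_id)).sub contDiff_const))
  · rw [abs_of_nonneg (mul_nonneg (Real.smoothTransition.nonneg _)
      (Real.smoothTransition.nonneg _))]
    exact mul_le_one₀ (Real.smoothTransition.le_one _) (Real.smoothTransition.nonneg _)
      (Real.smoothTransition.le_one _)
  · have h1 : ∀ r, δ ≤ r → Real.smoothTransition (2 / δ * r - 1) = 1 := fun r hr => by
      refine Real.smoothTransition.one_of_one_le ?_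
      have : 2 / δ * δ ≤ 2 / δ * r := mul_le_mul_of_nonneg_left hr (by positivity)
      rw [div_mul_cancel₀ _ hδ.ne'] at this
      linarith
    simp only
    rw [h1 t ht.1, h1 (1 - t) (by linarith [ht.2]), one_mul]
  · have h1 : ∀ r, r ≤ δ / 2 → Real.smoothTransition (2 / δ * r - 1) = 0 := fun r hr => by
      refine Real.smoothTransition.zero_of_nonpos ?_
      have : 2 / δ * r ≤ 2 / δ * (δ / 2) := mul_le_mul_of_nonneg_left hr (by positivity)
      have h2 : 2 / δ * (δ / 2) = 1 := by field_simp
      linarith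
    rw [mem_Icc, not_and_or, not_le, not_le] at ht
    simp only
    rcases ht with ht | ht
    · rw [h1 t ht.le, zero_mul]
    · rw [h1 (1 - t) (by linarith), mul_zero]

/-- Distinct multiples of `1 / N` are at distance at least `1 / N` on the circle. -/
theorem inv_le_norm_coe_sub {N : ℕ} {a b : Fin N} (hab : a ≠ b) :
    (N : ℝ)⁻¹ ≤ ‖(((a : ℝ) / N - (b : ℝ) / N : ℝ) : UnitAddCircle)‖ := by
  have hN : (0 : ℝ) < N := by exact_mod_cast a.pos
  rw [UnitAddCircle.norm_eq]
  set m := round ((a : ℝ) / N - (b : ℝ) / N) with hm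
  have h1 : (a : ℝ) / N - (b : ℝ) / N - m = (((a : ℤ) - b - N * m : ℤ) : ℝ) / N := by
    push_cast
    field_simp
  rw [h1, abs_div, abs_of_pos hN, inv_eq_one_div]
  refine div_le_div_of_nonneg_right ?_ hN.le
  have h2 : (a : ℤ) - b - N * m ≠ 0 := by
    intro h
    have ha := a.isLt
    have hb := b.isLt
    have h3 : (N : ℤ) ∣ (a : ℤ) - b := ⟨m, by linarith⟩
    have h4 : (a : ℤ) - b = 0 := Int.eq_zero_of_abs_lt_dvd h3 (by rw [abs_lt]; constructor <;> omega)
    exact hab (Fin.ext (by omega))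
  have h5 := Int.one_le_abs h2
  exact_mod_cast h5

/-! ### One step of the iteration -/

/-- Two pipes of radius `1 / μ` whose phases differ by at least `2 / μ` in every coordinate are
disjoint, since in dimension `d ≥ 3` some coordinate is transversal to both. -/
theorem norm_phase_sub_lt {d : ℕ} (hd : 3 ≤ d) {M μ : ℝ} {j₁ k₁ j₂ k₂ : Fin d}
    (P₁ : PipeProfile M μ j₁ k₁) (P₂ : PipeProfile M μ j₂ k₂) {z s₁ s₂ : Torus d}
    (h₁ : P₁.W (z - s₁) ≠ 0 ∨ P₁.Θ (z - s₁) ≠ 0 ∨ P₁.H (z - s₁) ≠ 0)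
    (h₂ : P₂.W (z - s₂) ≠ 0 ∨ P₂.Θ (z - s₂) ≠ 0 ∨ P₂.H (z - s₂) ≠ 0) :
    ∃ i, ‖s₁ i - s₂ i‖ < 2 * μ⁻¹ := by
  obtain ⟨i, hi⟩ : ∃ i, i ∉ ({j₁, j₂} : Finset (Fin d)) := by
    by_contra! h
    have h1 : Finset.univ ⊆ ({j₁, j₂} : Finset (Fin d)) := fun i _ => h i
    have h2 := Finset.card_le_card h1
    have h3 := Finset.card_le_two (a := j₁) (b := j₂)
    rw [Finset.card_univ, Fintype.card_fin] at h2
    omega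
  rw [Finset.mem_insert, Finset.mem_singleton, not_or] at hi
  refine ⟨i, ?_⟩
  have e₁ := P₁.support _ h₁ i hi.1
  have e₂ := P₂.support _ h₂ i hi.2
  have e : s₁ i - s₂ i = (z - s₂) i - (z - s₁) i := by simp
  rw [e]
  exact (norm_sub_le _ _).trans_lt (by linarith)

/-- One pipe for each direction `j` of the defect, each velocity `c k` and each half of the partition
of unity `ζ (t / τ)` of the time axis. Their phases stay close to distinct points of the diagonal as
long as the displacements `n C τ B` are small. -/
theorem exists_pipeSystem {d : ℕ} (hd : 3 ≤ d) {M μ : ℝ}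
    (hpipe : ∀ j k : Fin d, j ≠ k → Nonempty (PipeProfile M μ j k)) {N n : ℕ} (hn : 0 < n)
    {c : Fin N → Fin d → ℝ} {C B τ η : ℝ} (hτ : 0 < τ) (hη : 0 < η) (hc : ∀ k i, |c k i| ≤ C)
    {ζ ξ : Bool → ℝ → ℝ} (hζs : ∀ b, ContDiff ℝ ∞ (ζ b)) (hξs : ∀ b, ContDiff ℝ ∞ (ξ b))
    (hξB : ∀ b s, |ξ b s| ≤ B) (hζξ : ∀ b s, ζ b s * deriv (ξ b) s = ζ b s)
    {f : Fin d → Fin N → ℝ → Torus d → ℝ} (hf : ∀ j k, SmoothInTime (f j k))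
    {g : ℝ → ℝ} (hg : ContDiff ℝ ∞ g) (hfg : ∀ j k t x, f j k t x * g t = f j k t x)
    (hsmall : 2 * μ⁻¹ + 2 * (n * (C * (τ * B))) ≤
      (Fintype.card (Fin d × Fin N × Bool) : ℝ)⁻¹) :
    ∃ S : PipeSystem d (Fin d × Fin N × Bool), S.M = M ∧ S.μ = μ ∧ S.n = n ∧ S.η = η ∧ S.g = g ∧
      (∀ α, S.j α = α.1) ∧ (∀ α, S.c α = c α.2.1) ∧
      S.a = fun α t x => ζ α.2.2 (t / τ) * f α.1 α.2.1 t x := by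
  have hk : ∀ j : Fin d, ∃ k, j ≠ k := fun j => by
    have : Nontrivial (Fin d) := Fin.nontrivial_iff_two_le.2 (by omega)
    obtain ⟨k, hk⟩ := exists_ne j
    exact ⟨k, hk.symm⟩
  choose k hk using hk
  have P := fun j => (hpipe j (k j) (hk j)).some
  set e := Fintype.equivFin (Fin d × Fin N × Bool) with he
  -- the phases: small displacements around distinct base points
  set s : Fin d × Fin N × Bool → ℝ → Fin d → ℝ := fun α t i =>
    n * (c α.2.1 i * (τ * ξ α.2.2 (t / τ))) + (e α : ℝ) / Fintype.card (Fin d × Fin N × Bool)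
    with hs
  have hss : ∀ α, ContDiff ℝ ∞ (s α) := fun α => contDiff_pi.2 fun i =>
    (contDiff_const.mul (contDiff_const.mul (contDiff_const.mul
      ((hξs _).comp (contDiff_id.div_const τ))))).add contDiff_const
  have hsd : ∀ α i t, HasDerivAt (fun t => s α t i)
      (n * (deriv (ξ α.2.2) (t / τ) * c α.2.1 i)) t := fun α i t => by
    have h1 : HasDerivAt (fun t => ξ α.2.2 (t / τ)) (deriv (ξ α.2.2) (t / τ) * (1 / τ)) t :=
      (((hξs α.2.2).differentiable (by simp) _).hasDerivAt).comp t
        ((hasDerivAt_id t).div_const τ)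
    have h2 := ((((h1.const_mul τ).const_mul (c α.2.1 i)).const_mul (n : ℝ))).add_const
      ((e α : ℝ) / Fintype.card (Fin d × Fin N × Bool))
    exact h2.congr_deriv (by field_simp)
  have hdisj : ∀ α β t x, α ≠ β → moving n (s α) (P α.1).W t x ≠ 0 →
      ¬ ((P β.1).W (n • x - Torus.proj d (s β t)) ≠ 0 ∨
        (P β.1).Θ (n • x - Torus.proj d (s β t)) ≠ 0 ∨
        (P β.1).H (n • x - Torus.proj d (s β t)) ≠ 0) := fun α β t x hαβ h1 h2 => by
    obtain ⟨i, hi⟩ := norm_phase_sub_lt hd (P α.1) (P β.1) (Or.inl h1) h2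
    have h3 := inv_le_norm_coe_sub (e.injective.ne hαβ)
    set r : ℝ := n * (c α.2.1 i * (τ * ξ α.2.2 (t / τ))) -
      n * (c β.2.1 i * (τ * ξ β.2.2 (t / τ))) with hr
    have h4 : Torus.proj d (s α t) i - Torus.proj d (s β t) i =
        (((e α : ℝ) / Fintype.card (Fin d × Fin N × Bool) -
          (e β : ℝ) / Fintype.card (Fin d × Fin N × Bool) : ℝ) : UnitAddCircle) +
        (r : UnitAddCircle) := by
      simp only [Torus.proj, hs, ← AddCircle.coe_sub, ← AddCircle.coe_add]
      congr 1
      rw [hr]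
      ring
    rw [h4] at hi
    have h5 : ‖(r : UnitAddCircle)‖ ≤ |r| := by
      rw [UnitAddCircle.norm_eq]
      exact (round_le r 0).trans (by simp)
    have hC0 : 0 ≤ C := (abs_nonneg _).trans (hc α.2.1 i)
    have h6 : ∀ γ : Fin d × Fin N × Bool, |n * (c γ.2.1 i * (τ * ξ γ.2.2 (t / τ)))| ≤
        n * (C * (τ * B)) := fun γ => by
      rw [abs_mul, abs_mul, abs_mul, Nat.abs_cast, abs_of_pos hτ]
      exact mul_le_mul_of_nonneg_left (mul_le_mul (hc _ _)
        (mul_le_mul_of_nonneg_left (hξB _ _) hτ.le) (mul_nonneg hτ.le (abs_nonneg _)) hC0)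
        (Nat.cast_nonneg _)
    have h7 : |r| ≤ 2 * (n * (C * (τ * B))) := (abs_sub _ _).trans (by linarith [h6 α, h6 β])
    have h8 := norm_sub_norm_le
      ((((e α : ℝ) / Fintype.card (Fin d × Fin N × Bool) -
          (e β : ℝ) / Fintype.card (Fin d × Fin N × Bool) : ℝ) : UnitAddCircle))
      (-(r : UnitAddCircle))
    rw [norm_neg, sub_neg_eq_add] at h8
    linarith
  refine ⟨{
    M := M
    μ := μ
    n := n
    n_pos := hn
    j := fun α => α.1
    k := fun α => k α.1
    P := fun α => P α.1
    c := fun α => c α.2.1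
    s := s
    v := fun α t => deriv (ξ α.2.2) (t / τ)
    smooth_s := hss
    hasDerivAt_s := hsd
    a := fun α t x => ζ α.2.2 (t / τ) * f α.1 α.2.1 t x
    smooth_a := fun α => (SmoothInTime.of_time
      ((hζs _).comp (contDiff_id.div_const τ))).mul (hf _ _)
    a_mul_v := fun α t x => by
      rw [mul_right_comm, hζξ]
    disjoint := fun α β t x hαβ h => by
      have := hdisj α β t x hαβ h
      push Not at this
      exact this
    η := η
    η_pos := hη
    g := g
    smooth_g := hg
    a_mul_g := fun α t x => by rw [mul_assoc, hfg] }, rfl, rfl, rfl, rfl, rfl, fun _ => rfl,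
    fun _ => rfl, rfl⟩

/-- The velocity and the defect vanish outside of the time interval `[δ, 1 - δ]`. -/
def DefectSolution.SupportedIn {d : ℕ} (D : DefectSolution d) (δ : ℝ) : Prop :=
  ∀ t ∉ Icc δ (1 - δ), ∀ i x, D.u i t x = 0 ∧ D.R i t x = 0

theorem SmoothInTime.exists_uniform_bound {d : ℕ} {κ : Type*} [Finite κ]
    {f : κ → ℝ → Torus d → ℝ} (hf : ∀ k, SmoothInTime (f k)) :
    ∃ C, 0 ≤ C ∧ ∀ k, ∀ t ∈ Icc (0 : ℝ) 1, ∀ x, |f k t x| ≤ C := by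
  choose C hC0 hC using fun k => (hf k).exists_bound
  obtain ⟨A, hA⟩ := Finite.exists_le C
  exact ⟨max A 0, le_max_right _ _, fun k t ht x =>
    (hC k t ht x).trans ((hA k).trans (le_max_left _ _))⟩

theorem SmoothInTime.exists_uniform_lipschitz {d : ℕ} {κ : Type*} [Finite κ]
    {f : κ → ℝ → Torus d → ℝ} (hf : ∀ k, SmoothInTime (f k)) :
    ∃ L, 0 ≤ L ∧ ∀ k, ∀ t ∈ Icc (0 : ℝ) 1, ∀ (x : Torus d) (v : Fin d → ℝ), ‖v‖ ≤ 1 →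
      |f k t (x + Torus.proj d v) - f k t x| ≤ L * ‖v‖ := by
  choose C hC0 hC using fun k => (hf k).exists_lipschitz
  obtain ⟨A, hA⟩ := Finite.exists_le C
  exact ⟨max A 0, le_max_right _ _, fun k t ht x v hv => (hC k t ht x v hv).trans
    (mul_le_mul_of_nonneg_right ((hA k).trans (le_max_left _ _)) (norm_nonneg _))⟩

/-- The gradient of a pipe, of size `μ` on a set of measure `μ ^ (1 - d)`, tends to zero in `Lᵖ`
for `p < d - 1`. -/
theorem tendsto_mul_inv_pow_rpow {d : ℕ} (hd : 3 ≤ d) {p : ℝ} (hp1 : 1 ≤ p)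
    (hp : p < (d : ℝ) - 1) :
    Filter.Tendsto (fun μ : ℝ => μ * (μ⁻¹ ^ (d - 1)) ^ (1 / p)) Filter.atTop (𝓝 0) := by
  have hp0 : 0 < p := by linarith
  have hy : 0 < ((d : ℝ) - 1) / p - 1 := by
    rw [sub_pos, one_lt_div hp0]; exact hp
  refine (tendsto_rpow_neg_atTop hy).congr' ?_
  filter_upwards [Filter.eventually_gt_atTop (0 : ℝ)] with μ hμ
  rw [← Real.rpow_natCast, ← Real.rpow_mul (inv_nonneg.2 hμ.le), Real.inv_rpow hμ.le,
    ← Real.rpow_neg hμ.le]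
  nth_rewrite 2 [← Real.rpow_one μ]
  rw [← Real.rpow_add hμ, Nat.cast_sub (by omega)]
  congr 1
  push_cast
  ring

/-- The choice of the parameters: the oscillation frequency `n` is large, the switching time `τ` is
small depending on `n`, and the concentration `μ` is large depending on `n` and `τ`. -/
theorem exists_parameters {d : ℕ} (hd : 3 ≤ d) {K M C B η κ κ' p : ℝ} (hK : 0 < K)
    (hC : 0 ≤ C) (hB : 0 ≤ B) (hκ : 0 < κ) (hp1 : 1 ≤ p) (hp : p < (d : ℝ) - 1) :
    ∃ (n : ℕ) (τ μ : ℝ), 0 < n ∧ 0 < τ ∧ 1 ≤ μ ∧ 2 * μ⁻¹ + 2 * (n * (C * (τ * B))) ≤ K⁻¹ ∧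
      K * (η⁻¹ * (C / n * M) + (η * n)⁻¹ * (C * (M * μ⁻¹))) ≤ κ ∧
      K * (κ' * (η⁻¹ * (C / n * M)) +
        (η * n)⁻¹ * ((C * (B / τ) + C + d * (C * C)) * (M * μ⁻¹)) +
        C * ((η * n)⁻¹ * (C * (M * μ⁻¹))) + (n : ℝ)⁻¹ * (C * (M * μ⁻¹)) +
        (n : ℝ)⁻¹ * (C * M + d * (C * M)) + C * (η * (M * μ⁻¹ ^ (d - 1)))) ≤ κ ∧
      K * (η * (n * (M * μ))) * (μ⁻¹ ^ (d - 1)) ^ (1 / p) ≤ κ := by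
  have t1 : Filter.Tendsto (fun n : ℕ => K * (η⁻¹ * (C / n * M))) Filter.atTop (𝓝 0) := by
    simpa using (((tendsto_const_div_atTop_nhds_zero_nat C).mul_const M).const_mul η⁻¹).const_mul K
  have t2 : Filter.Tendsto (fun n : ℕ => K * (κ' * (η⁻¹ * (C / n * M)) +
      (n : ℝ)⁻¹ * (C * M + d * (C * M)))) Filter.atTop (𝓝 0) := by
    simpa using (((((tendsto_const_div_atTop_nhds_zero_nat C).mul_const M).const_mul
      η⁻¹).const_mul κ').add
      (tendsto_inv_atTop_nhds_zero_nat.mul_const (C * M + d * (C * M)))).const_mul K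
  obtain ⟨n, hn1, hn2, hn0⟩ := ((t1.eventually_le_const (half_pos hκ)).and
    ((t2.eventually_le_const (half_pos hκ)).and (Filter.eventually_gt_atTop 0))).exists
  have hn : (0 : ℝ) < n := by exact_mod_cast hn0
  set τ : ℝ := K⁻¹ / (4 * (n * C * B + 1)) with hτ
  have hnCB : 0 ≤ n * C * B := by positivity
  have hτ0 : 0 < τ := by positivity
  have hτ1 : 2 * (n * (C * (τ * B))) ≤ K⁻¹ / 2 := by
    have : 2 * (n * (C * (τ * B))) = K⁻¹ / 2 * (n * C * B / (n * C * B + 1)) := by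
      rw [hτ]; field_simp; ring
    rw [this]
    exact mul_le_of_le_one_right (by positivity) ((div_le_one (by positivity)).2 (by linarith))
  have s0 : Filter.Tendsto (fun μ : ℝ => μ⁻¹) Filter.atTop (𝓝 0) := tendsto_inv_atTop_zero
  have s1 : Filter.Tendsto (fun μ : ℝ => 2 * μ⁻¹) Filter.atTop (𝓝 0) := by
    simpa using s0.const_mul 2
  have s2 : Filter.Tendsto (fun μ : ℝ => K * ((η * n)⁻¹ * (C * (M * μ⁻¹)))) Filter.atTop
      (𝓝 0) := by
    simpa using (((s0.const_mul M).const_mul C).const_mul (η * n)⁻¹).const_mul K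
  have s3 : Filter.Tendsto (fun μ : ℝ => K * (
        (η * n)⁻¹ * ((C * (B / τ) + C + d * (C * C)) * (M * μ⁻¹)) +
        C * ((η * n)⁻¹ * (C * (M * μ⁻¹))) + (n : ℝ)⁻¹ * (C * (M * μ⁻¹)) +
        C * (η * (M * μ⁻¹ ^ (d - 1))))) Filter.atTop (𝓝 0) := by
    have h1 := (((s0.const_mul M).const_mul (C * (B / τ) + C + d * (C * C))).const_mul (η * n)⁻¹)
    have h2 := ((((s0.const_mul M).const_mul C).const_mul (η * n)⁻¹).const_mul C)
    have h3 := (((s0.const_mul M).const_mul C).const_mul (n : ℝ)⁻¹)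
    have h4 := (((s0.pow (d - 1)).const_mul M).const_mul η).const_mul C
    have h5 := (((h1.add h2).add h3).add h4).const_mul K
    rw [zero_pow (by omega)] at h5
    simpa only [mul_zero, add_zero] using h5
  have s4 : Filter.Tendsto (fun μ : ℝ => K * (η * (n * (M * μ))) * (μ⁻¹ ^ (d - 1)) ^ (1 / p))
      Filter.atTop (𝓝 0) := by
    have h1 := (tendsto_mul_inv_pow_rpow hd hp1 hp).const_mul (K * (η * (n * M)))
    rw [mul_zero] at h1
    refine h1.congr fun μ => by ring
  obtain ⟨μ, h1, h2, h3, h4, h5⟩ := ((s1.eventually_le_const (half_pos (inv_pos.2 hK))).and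
    ((s2.eventually_le_const (half_pos hκ)).and ((s3.eventually_le_const (half_pos hκ)).and
    ((s4.eventually_le_const hκ).and (Filter.eventually_ge_atTop 1))))).exists
  refine ⟨n, τ, μ, hn0, hτ0, h5, by linarith, by linarith, by linarith, h4⟩

namespace PipeSystem

variable {d : ℕ} {ι : Type} [Fintype ι] (S : PipeSystem d ι)

theorem density_eq_zero {t : ℝ} (h : ∀ α x, S.a α t x = 0) (x : Torus d) :
    S.density t x = 0 := by
  refine Finset.sum_eq_zero fun α _ => ?_
  have ha : S.a α t = fun _ => 0 := funext (h α)
  rw [densityPart_eq, ha, torusPartial_const]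
  ring

theorem field_eq_zero {t : ℝ} (h : S.g t = 0) (i : Fin d) (x : Torus d) :
    S.field i t x = 0 := by
  simp [field, h]

theorem error_eq_zero (D : DefectSolution d) {t : ℝ} (h : ∀ᶠ s in 𝓝 t, ∀ α x, S.a α s x = 0)
    (hg : S.g t = 0) (i : Fin d) (x : Torus d) : S.error D i t x = 0 := by
  rw [error, field_eq_zero S hg, mul_zero, add_zero]
  refine Finset.sum_eq_zero fun α _ => ?_
  have ha : S.a α t = fun _ => 0 := funext (h.self_of_nhds α)
  have ht : timePartial (S.a α) t x = 0 := by
    have : (fun s => S.a α s x) =ᶠ[𝓝 t] fun _ => 0 := h.mono fun s hs => hs α x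
    rw [timePartial, this.deriv_eq, deriv_const]
  simp [transportError, densityPart_eq, correctorError, oscillationError, ha, ht,
    torusPartial_const]

end PipeSystem

/-- The iteration step. The defect of an approximate solution is cancelled up to an arbitrarily
small new one; the change of the density is controlled by the old defect, and the change of the
vector field is small in `L^∞ ∩ W^{1,p}`. -/
theorem exists_perturbation {d : ℕ} (hd : 3 ≤ d) : ∃ M : ℝ, 0 ≤ M ∧
    ∀ (D : DefectSolution d) (δ r η κ p : ℝ), 0 < δ → D.SupportedIn δ →
      (∀ t ∈ Icc (0 : ℝ) 1, ∀ i, ∫ x, |D.R i t x| ≤ r) → 0 < η → 0 < κ → 1 ≤ p →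
      p < (d : ℝ) - 1 → ∃ D' : DefectSolution d, D'.SupportedIn (δ / 2) ∧
        (∀ t ∈ Icc (0 : ℝ) 1, ∫ x, |D'.ρ t x - D.ρ t x| ≤ M / η * r + κ) ∧
        (∀ i t x, |D'.u i t x - D.u i t x| ≤ η) ∧
        (∀ l i, ∀ t ∈ Icc (0 : ℝ) 1,
          eLpNorm (fun x => torusPartial l (D'.u i t) x - torusPartial l (D.u i t) x)
            (ENNReal.ofReal p) volume ≤ ENNReal.ofReal κ) ∧
        (∀ t ∈ Icc (0 : ℝ) 1, ∀ i, ∫ x, |D'.R i t x| ≤ κ) ∧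
        ∀ t ∉ Icc δ (1 - δ), ∀ x, D'.ρ t x = D.ρ t x := by
  obtain ⟨M, hM, hpipe⟩ := exists_pipeProfile d
  refine ⟨M * d, by positivity, fun D δ r η κ p hδ hD hr hη hκ hp1 hp => ?_⟩
  have hr0 : 0 ≤ r := (integral_nonneg fun x => abs_nonneg _).trans
    (hr 0 ⟨le_rfl, zero_le_one⟩ ⟨0, by omega⟩)
  obtain ⟨ζ, ξ, B, hB, hζs, hξs, hζ0, hζ1, hζsum, hξB, hζB, hζξ⟩ := exists_time_cutoffs
  obtain ⟨g, hgs, hg1, hgδ, hgδ'⟩ := exists_window hδ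
  obtain ⟨Cu, hCu0, hCu⟩ := SmoothInTime.exists_uniform_bound D.smooth_u
  have hCu' : ∀ t ∈ Icc (0 : ℝ) 1, ∀ x, ‖fun i => D.u i t x‖ ≤ Cu := fun t ht x =>
    (pi_norm_le_iff_of_nonneg hCu0).2 fun i => hCu i t ht x
  set κ' : ℝ := κ / (2 * (η⁻¹ * M * (d * r) + 1)) with hκ'
  have hq : 0 ≤ η⁻¹ * M * (d * r) := by positivity
  have hκ'0 : 0 < κ' := by positivity
  obtain ⟨N, c, χ, hχs, hχ0, hχc, hχsum⟩ := exists_velocity_partition d Cu hκ'0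
  have hN : Nonempty (Fin N) := by
    by_contra h
    rw [not_nonempty_iff] at h
    have := hχsum 0 (by simpa using hCu0)
    simp at this
  set f : Fin d → Fin N → ℝ → Torus d → ℝ := fun j k t x =>
    χ k (fun i => D.u i t x) * D.R j t x with hf
  have hfs : ∀ j k, SmoothInTime (f j k) := fun j k =>
    (SmoothInTime.comp_pi (hχs k) D.smooth_u).mul (D.smooth_R j)
  obtain ⟨C₁, hC₁0, hC₁⟩ := SmoothInTime.exists_uniform_bound
    (f := fun jk : Fin d × Fin N => f jk.1 jk.2) fun jk => hfs _ _
  obtain ⟨C₂, hC₂0, hC₂⟩ := SmoothInTime.exists_uniform_bound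
    (f := fun jk : (Fin d × Fin N) × Fin d => fun t => torusPartial jk.2 (f jk.1.1 jk.1.2 t))
    fun jk => (hfs _ _).torusPartial _
  obtain ⟨C₃, hC₃0, hC₃⟩ := SmoothInTime.exists_uniform_bound
    (f := fun jk : Fin d × Fin N => timePartial (f jk.1 jk.2)) fun jk => (hfs _ _).timePartial
  obtain ⟨L, hL0, hL⟩ := SmoothInTime.exists_uniform_lipschitz
    (f := fun jk : Fin d × Fin N => f jk.1 jk.2) fun jk => hfs _ _
  obtain ⟨C₄', hC₄'⟩ := Finite.exists_le fun ki : Fin N × Fin d => |c ki.1 ki.2|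
  obtain ⟨C₅, hC₅0, hC₅⟩ := D.smooth_ρ.exists_bound
  set C₄ : ℝ := max C₄' 0 with hC₄d
  have hC₄0 : 0 ≤ C₄ := le_max_right _ _
  have hC₄ : ∀ k i, |c k i| ≤ C₄ := fun k i => (hC₄' (k, i)).trans (le_max_left _ _)
  set C : ℝ := C₁ + C₂ + C₃ + L + C₄ + Cu + C₅ with hC
  have hC0 : 0 ≤ C := by positivity
  have hK : (0 : ℝ) < Fintype.card (Fin d × Fin N × Bool) := by
    have : Nonempty (Fin d) := ⟨⟨0, by omega⟩⟩
    exact_mod_cast Fintype.card_pos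
  obtain ⟨n, τ, μ, hn, hτ, hμ, hsmall, p1, p2, p3⟩ := exists_parameters hd (M := M) (η := η)
    (κ' := κ') hK hC0 hB (half_pos hκ) hp1 hp
  have hfR : ∀ j k t x, D.R j t x = 0 → f j k t x = 0 := fun j k t x h => by
    simp only [hf, h, mul_zero]
  obtain ⟨S, hSM, hSμ, hSn, hSη, hSg, hSj, hSc, hSa⟩ := exists_pipeSystem hd (hpipe μ hμ) hn
    (C := C) hτ hη (fun k i => (hC₄ k i).trans (by linarith)) hζs hξs hξB hζξ hfs hgs
    (fun j k t x => by
      by_cases ht : t ∈ Icc δ (1 - δ)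
      · rw [hgδ t ht, mul_one]
      · rw [hfR j k t x (hD t ht j x).2, zero_mul]) hsmall
  have hSa' : ∀ α t x, S.a α t x = ζ α.2.2 (t / τ) * f α.1 α.2.1 t x := fun α t x => by rw [hSa]
  have ha0 : ∀ t ∉ Icc δ (1 - δ), ∀ α x, S.a α t x = 0 := fun t ht α x => by
    rw [hSa', hfR _ _ _ _ (hD t ht _ x).2, mul_zero]
  have hI : ∀ t ∈ Icc δ (1 - δ), t ∈ Icc (0 : ℝ) 1 := fun t ht =>
    ⟨hδ.le.trans ht.1, ht.2.trans (by linarith)⟩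
  have hsum : ∀ (F : Fin d × Fin N × Bool → ℝ) (R : Fin d → ℝ) (y : Fin N → ℝ) (z : Bool → ℝ),
      (∀ α, F α = z α.2.2 * (y α.2.1 * R α.1)) → ∑ k, y k = 1 → z true + z false = 1 →
      ∑ α, F α = ∑ j, R j := fun F R y z h hy hz => by
    rw [Fintype.sum_prod_type]
    refine Finset.sum_congr rfl fun j _ => ?_
    rw [Fintype.sum_prod_type]
    simp only [h, Fintype.sum_bool, hz, one_mul, ← Finset.sum_mul, hy]
  have hR : ∀ i t x, D.R i t x = ∑ α, if S.j α = i then S.a α t x else 0 := fun i t x => by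
    by_cases ht : t ∈ Icc δ (1 - δ)
    · rw [hsum _ (fun j => if j = i then D.R j t x else 0) (fun k => χ k fun i => D.u i t x)
        (fun b => ζ b (t / τ)) (fun α => ?_) (hχsum _ (hCu' t (hI t ht) x)) (hζsum _)]
      · simp
      · simp only [hSj, hSa', hf]
        split_ifs <;> simp
    · rw [(hD t ht i x).2]
      simp [ha0 t ht]
  have hsuma : ∀ t ∈ Icc (0 : ℝ) 1, ∑ α, ∫ x, |S.a α t x| ≤ d * r := fun t ht => by
    rw [← integral_finsetSum _ fun α _ => Torus.integrable_of_continuous (S.continuous_a α t).abs]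
    have : ∀ x, ∑ α, |S.a α t x| = ∑ j, |D.R j t x| := fun x =>
      hsum _ _ (fun k => χ k fun i => D.u i t x) (fun b => ζ b (t / τ)) (fun α => by
        rw [hSa', abs_mul, abs_of_nonneg (hζ0 _ _), hf, abs_mul, abs_of_nonneg (hχ0 _ _)])
        (hχsum _ (hCu' t ht x)) (hζsum _)
    simp only [this]
    rw [integral_finsetSum _ fun j _ =>
      Torus.integrable_of_continuous ((D.smooth_R j).slice t).continuous.abs]
    refine (Finset.sum_le_sum fun j _ => hr t ht j).trans (le_of_eq (by simp))
  have hζa : ∀ b s y, |ζ b s * y| ≤ |y| := fun b s y => by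
    rw [abs_mul, abs_of_nonneg (hζ0 b s)]
    exact mul_le_of_le_one_left (abs_nonneg _) (hζ1 b s)
  have hb : ∀ t ∈ Icc (0 : ℝ) 1, S.Bounds C (C * (B / τ) + C) t := fun t ht =>
    { C_nonneg := hC0
      T_nonneg := by positivity
      M_nonneg := hSM ▸ hM
      μ_ge := hSμ ▸ hμ
      partial_a := fun α i x => by
        rw [hSa, torusPartial_const_mul _ ((hfs _ _).slice t)]
        exact (hζa _ _ _).trans ((hC₂ ((α.1, α.2.1), i) t ht x).trans (by linarith))
      time_a := fun α x => by
        have hζt : SmoothInTime fun t (_ : Torus d) => ζ α.2.2 (t / τ) :=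
          SmoothInTime.of_time ((hζs _).comp (contDiff_id.div_const τ))
        have h1 : timePartial (fun t (_ : Torus d) => ζ α.2.2 (t / τ)) t x =
            deriv (ζ α.2.2) (t / τ) * (1 / τ) :=
          ((((hζs α.2.2).differentiable (by simp) _).hasDerivAt).comp t
            ((hasDerivAt_id t).div_const τ)).deriv
        rw [hSa, timePartial_mul hζt (hfs _ _), h1]
        refine (abs_add_le _ _).trans (add_le_add ?_
          ((hζa _ _ _).trans ((hC₃ (α.1, α.2.1) t ht x).trans (by linarith))))
        rw [abs_mul, abs_mul, abs_of_pos (one_div_pos.2 hτ), mul_comm C]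
        refine mul_le_mul ?_ ((hC₁ (α.1, α.2.1) t ht x).trans (by linarith)) (abs_nonneg _)
          (by positivity)
        rw [div_eq_mul_one_div B]
        exact mul_le_mul_of_nonneg_right (hζB _ _) (one_div_nonneg.2 hτ.le)
      velocity := fun α i => by
        rw [hSc]
        exact (hC₄ _ i).trans (by linarith)
      lipschitz := fun α x v hv => by
        have h1 := hL (α.1, α.2.1) t ht x v hv
        have h2 := hζa α.2.2 (t / τ) (f α.1 α.2.1 t (x + Torus.proj d v) - f α.1 α.2.1 t x)
        have h3 := abs_sub_abs_le_abs_sub (S.a α t (x + Torus.proj d v)) (S.a α t x)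
        have h4 : L * ‖v‖ ≤ C * ‖v‖ :=
          mul_le_mul_of_nonneg_right (by linarith) (norm_nonneg v)
        rw [mul_sub, ← hSa', ← hSa'] at h2
        linarith
      abs_g := fun t => by rw [hSg]; exact hg1 t }
  have hmain : ∀ t ∈ Icc (0 : ℝ) 1,
      η⁻¹ * M * ∑ α, ∫ x, |S.a α t x| ≤ η⁻¹ * M * (d * r) := fun t ht =>
    mul_le_mul_of_nonneg_left (hsuma t ht) (by positivity)
  have hgap : ∀ t ∉ Icc (δ / 2) (1 - δ / 2), t ∉ Icc δ (1 - δ) ∧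
      ∀ᶠ s in 𝓝 t, ∀ α x, S.a α s x = 0 := fun t ht => by
    have ht' : t ∉ Icc δ (1 - δ) := fun h => ht ⟨by linarith [h.1], by linarith [h.2]⟩
    exact ⟨ht', Filter.mem_of_superset
      (isClosed_Icc.isOpen_compl.mem_nhds ht') fun s hs => ha0 s hs⟩
  have hS1 : ∀ t, |S.g t| ≤ 1 := fun t => by rw [hSg]; exact hg1 t
  refine ⟨S.perturb D hR, fun t ht i x => ?_, fun t ht => ?_, fun i t x => ?_,
    fun l i t ht => ?_, fun t ht i => ?_, fun t ht x => ?_⟩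
  · have hg0 : S.g t = 0 := by rw [hSg]; exact hgδ' t ht
    obtain ⟨h1, h2⟩ := hgap t ht
    refine ⟨?_, ?_⟩
    · change D.u i t x + S.field i t x = 0
      rw [(hD t h1 i x).1, S.field_eq_zero hg0, add_zero]
    · change -S.error D i t x = 0
      rw [S.error_eq_zero D h2 hg0, neg_zero]
  · have h1 := PipeSystem.integral_density_le (hb t ht)
    have h2 := hmain t ht
    rw [hSM, hSμ, hSn, hSη] at h1
    have h3 : M * d / η * r = η⁻¹ * M * (d * r) := by field_simp
    have h4 : ∀ x, (S.perturb D hR).ρ t x - D.ρ t x = S.density t x := fun x =>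
      add_sub_cancel_left _ _
    simp only [h4]
    linarith
  · have h : (S.perturb D hR).u i t x - D.u i t x = S.field i t x := add_sub_cancel_left _ _
    rw [h, ← hSη]
    exact S.abs_field_le hS1 i t x
  · have h : (fun x => torusPartial l ((S.perturb D hR).u i t) x - torusPartial l (D.u i t) x) =
        torusPartial l (S.field i t) := funext fun x => by
      change torusPartial l (fun x => D.u i t x + S.field i t x) x - _ = _
      rw [torusPartial_add ((D.smooth_u i).slice t) ((S.smooth_field i).slice t),
        add_sub_cancel_left]
    rw [h]
    have h1 := PipeSystem.abs_torusPartial_field_le (hb t ht) l i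
    have h2 := PipeSystem.integral_torusPartial_field_le (hb t ht) l i
    rw [hSM, hSμ, hSn, hSη] at h1 h2
    have hμ0 : 0 ≤ μ := zero_le_one.trans hμ
    refine (eLpNorm_le_of_abs_le (((S.smooth_field i).torusPartial l).slice t).continuous
      (by positivity) (by positivity) hp1 h1 h2).trans (ENNReal.ofReal_le_ofReal ?_)
    linarith
  · have h : ∀ x, |(S.perturb D hR).R i t x| = |S.error D i t x| := fun x => abs_neg _
    simp only [h]
    have h1 := PipeSystem.integral_error_le (hb t ht) D hκ'0.le (fun α i x ha => ?_)
      (fun α i x => ?_) (fun x => (hC₅ t ht x).trans (by linarith)) i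
    · rw [hSM, hSμ, hSn, hSη] at h1
      have h2 := mul_le_mul_of_nonneg_left (hmain t ht) hκ'0.le
      have h3 : κ' * (η⁻¹ * M * (d * r)) ≤ κ / 2 := by
        have : κ' * (η⁻¹ * M * (d * r)) =
            κ / 2 * (η⁻¹ * M * (d * r) / (η⁻¹ * M * (d * r) + 1)) := by
          rw [hκ']; generalize η⁻¹ * M * (d * r) = q at *; field_simp
        rw [this]
        exact mul_le_of_le_one_right (by positivity)
          ((div_le_one (by positivity)).2 (by linarith))
      linarith
    · have h2 : χ α.2.1 (fun i => D.u i t x) ≠ 0 := fun h => ha (by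
        rw [hSa', hf]; simp only [h]; ring)
      rw [hSc]
      exact (norm_le_pi_norm ((fun i => D.u i t x) - c α.2.1) i).trans (hχc _ _ h2)
    · rw [hSc]
      refine (abs_sub _ _).trans ?_
      linarith [hCu i t ht x, hC₄ α.2.1 i]
  · change D.ρ t x + S.density t x = D.ρ t x
    rw [S.density_eq_zero (ha0 t ht), add_zero]

/-! ### The iteration -/

/-- An approximate solution with vanishing field which interpolates between the densities `0` and
`ρbar`. -/
theorem exists_initial {d : ℕ} {ρbar : Torus d → ℝ} (hsmooth : SmoothOnTorus ρbar)
    (hmean : ∫ x, ρbar x = 0) : ∃ D : DefectSolution d, D.SupportedIn (1 / 4) ∧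
      (∀ i t x, D.u i t x = 0) ∧ (∀ x, D.ρ 0 x = 0) ∧ ∀ x, D.ρ 1 x = ρbar x := by
  obtain ⟨V, hVs, hV, -, -⟩ := exists_antidivergence hsmooth hmean
  set κ : ℝ → ℝ := fun t => Real.smoothTransition (3 * t - 1) with hκ
  have hκs : ContDiff ℝ ∞ κ := Real.smoothTransition.contDiff.comp
    ((contDiff_const.mul contDiff_id).sub contDiff_const)
  have hκ's : ContDiff ℝ ∞ (deriv κ) := (contDiff_infty_iff_deriv.1 hκs).2
  have h0 : ∀ t ≤ 1 / 3, κ t = 0 := fun t ht =>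
    Real.smoothTransition.zero_of_nonpos (by linarith)
  have h1 : ∀ t, 2 / 3 ≤ t → κ t = 1 := fun t ht =>
    Real.smoothTransition.one_of_one_le (by linarith)
  have hρ : SmoothInTime fun t x => κ t * ρbar x :=
    (SmoothInTime.of_time hκs).mul (SmoothInTime.of_space hsmooth)
  refine ⟨{
    ρ := fun t x => κ t * ρbar x
    u := fun _ _ _ => 0
    R := fun i t x => -deriv κ t * V i x
    smooth_ρ := hρ
    smooth_u := fun _ => SmoothInTime.const 0
    smooth_R := fun i => (SmoothInTime.of_time hκ's.neg).mul (SmoothInTime.of_space (hVs i))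
    continuity := fun t x => ?_
    div_u := fun t x => Finset.sum_eq_zero fun i _ => torusPartial_const i 0 x },
    fun t ht i x => ⟨rfl, ?_⟩, fun _ _ _ => rfl, fun x => ?_, fun x => ?_⟩
  · have e1 : timePartial (fun t x => κ t * ρbar x) t x = deriv κ t * ρbar x :=
      (((hκs.differentiable (by simp) t).hasDerivAt).mul_const _).deriv
    have e2 : ∀ i, torusPartial i (fun x => -deriv κ t * V i x) x =
        -deriv κ t * torusPartial i (V i) x := fun i => torusPartial_const_mul _ (hVs i) i x
    simp only [e1, e2, mul_zero, torusPartial_const, Finset.sum_const_zero, ← Finset.mul_sum, hV]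
    ring
  · have hderiv : deriv κ t = 0 := by
      rcases lt_or_ge t (1 / 4) with h | h
      · have : κ =ᶠ[𝓝 t] fun _ => 0 := by
          filter_upwards [Iio_mem_nhds h] with s hs using h0 s (by linarith [mem_Iio.1 hs])
        rw [this.deriv_eq, deriv_const]
      · have h' : 1 - 1 / 4 < t := by
          by_contra! h'
          exact ht ⟨h, h'⟩
        have : κ =ᶠ[𝓝 t] fun _ => 1 := by
          filter_upwards [Ioi_mem_nhds h'] with s hs using h1 s (by linarith [mem_Ioi.1 hs])
        rw [this.deriv_eq, deriv_const]
    simp [hderiv]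
  · simp [h0 0 (by norm_num)]
  · simp [h1 1 (by norm_num)]

theorem exists_seq_of_forall_exists_succ {α : Type*} {P : ℕ → α → Prop} {Q : ℕ → α → α → Prop}
    {x : α} (hx : P 0 x) (h : ∀ n x, P n x → ∃ y, P (n + 1) y ∧ Q n x y) :
    ∃ f : ℕ → α, f 0 = x ∧ (∀ n, P n (f n)) ∧ ∀ n, Q n (f n) (f (n + 1)) := by
  choose next h1 h2 using h
  let F : (n : ℕ) → {x // P n x} := fun n =>
    Nat.rec ⟨x, hx⟩ (fun n y => ⟨next n y.1 y.2, h1 n y.1 y.2⟩) n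
  exact ⟨fun n => (F n).1, rfl, fun n => (F n).2, fun n => h2 n (F n).1 (F n).2⟩

/-- A sequence of approximate solutions joining `0` to `ρbar` whose defects tend to zero. The
exponents `d - 1 - 1 / (q + 1)` of the Sobolev norms exhaust the range `p < d - 1`. -/
theorem exists_approximation {d : ℕ} (hd : 3 ≤ d) {ε : ℝ} (hε : 0 < ε) {ρbar : Torus d → ℝ}
    (hsmooth : SmoothOnTorus ρbar) (hmean : ∫ x, ρbar x = 0) :
    ∃ (D : ℕ → DefectSolution d) (A r : ℝ), (∀ i t x, (D 0).u i t x = 0) ∧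
      (∀ q x, (D q).ρ 0 x = 0) ∧ (∀ q x, (D q).ρ 1 x = ρbar x) ∧
      (∀ q, ∀ t ∈ Icc (0 : ℝ) 1, ∀ i, ∫ x, |(D q).R i t x| ≤ r / 4 ^ q) ∧
      (∀ q, ∀ t ∈ Icc (0 : ℝ) 1, ∫ x, |(D (q + 1)).ρ t x - (D q).ρ t x| ≤ A / 2 / 2 ^ q) ∧
      (∀ q i t x, |(D (q + 1)).u i t x - (D q).u i t x| ≤ ε / 2 / 2 ^ q) ∧
      ∀ q l i, ∀ t ∈ Icc (0 : ℝ) 1,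
        eLpNorm (fun x => torusPartial l ((D (q + 1)).u i t) x - torusPartial l ((D q).u i t) x)
          (ENNReal.ofReal ((d : ℝ) - 1 - 1 / (q + 1))) volume ≤ ENNReal.ofReal (2 / 2 / 2 ^ q) := by
  obtain ⟨M, hM, hstep⟩ := exists_perturbation hd
  obtain ⟨D₀, hD₀, hu₀, hρ0, hρ1⟩ := exists_initial hsmooth hmean
  obtain ⟨C, hC0, hC⟩ := SmoothInTime.exists_uniform_bound D₀.smooth_R
  have hd' : (3 : ℝ) ≤ d := by exact_mod_cast hd
  -- the defect decays faster than the field, so that the density stays summable in `L¹`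
  set r : ℝ := C + 1 with hr
  have hr1 : 1 ≤ r := by linarith
  have hR₀ : ∀ t ∈ Icc (0 : ℝ) 1, ∀ i, ∫ x, |D₀.R i t x| ≤ r := fun t ht i => by
    refine (integral_mono (Torus.integrable_of_continuous
      ((D₀.smooth_R i).slice t).continuous.abs) (integrable_const C) (hC i t ht)).trans ?_
    simp [hr]
  set P : ℕ → DefectSolution d → Prop := fun q D => D.SupportedIn (1 / 4 / 2 ^ q) ∧
    (∀ t ∈ Icc (0 : ℝ) 1, ∀ i, ∫ x, |D.R i t x| ≤ r / 4 ^ q) ∧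
    (∀ x, D.ρ 0 x = 0) ∧ ∀ x, D.ρ 1 x = ρbar x with hP
  set A : ℝ := 2 * (2 * M * r / ε + 1) with hA
  obtain ⟨D, hD0, hDP, hDQ⟩ := exists_seq_of_forall_exists_succ (P := P) (x := D₀)
    (Q := fun q D D' => (∀ t ∈ Icc (0 : ℝ) 1, ∫ x, |D'.ρ t x - D.ρ t x| ≤ A / 2 / 2 ^ q) ∧
      (∀ i t x, |D'.u i t x - D.u i t x| ≤ ε / 2 / 2 ^ q) ∧
      ∀ l i, ∀ t ∈ Icc (0 : ℝ) 1,
        eLpNorm (fun x => torusPartial l (D'.u i t) x - torusPartial l (D.u i t) x)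
          (ENNReal.ofReal ((d : ℝ) - 1 - 1 / (q + 1))) volume ≤ ENNReal.ofReal (2 / 2 / 2 ^ q))
    ⟨by simpa using hD₀, by simpa using hR₀, hρ0, hρ1⟩ fun q D hD => by
    obtain ⟨hD1, hD2, hD3, hD4⟩ := hD
    have h2q : (0 : ℝ) < 2 ^ q := by positivity
    have h24 : (1 : ℝ) / 4 ^ (q + 1) ≤ 1 / 2 ^ q := by
      refine one_div_le_one_div_of_le h2q ?_
      calc (2 : ℝ) ^ q ≤ 4 ^ q := pow_le_pow_left₀ (by norm_num) (by norm_num) q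
        _ ≤ 4 ^ (q + 1) := pow_le_pow_right₀ (by norm_num) (Nat.le_succ q)
    have hq : (1 : ℝ) / (q + 1) ≤ 1 := by
      rw [div_le_one (by positivity)]; linarith [(Nat.cast_nonneg q : (0 : ℝ) ≤ q)]
    have hq0 : (0 : ℝ) < 1 / (q + 1) := by positivity
    obtain ⟨D', g1, g2, g3, g4, g5, g6⟩ := hstep D (1 / 4 / 2 ^ q) (r / 4 ^ q) (ε / 2 / 2 ^ q)
      (1 / 4 ^ (q + 1)) ((d : ℝ) - 1 - 1 / (q + 1)) (by positivity) hD1 hD2 (by positivity)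
      (by positivity) (by linarith) (by linarith)
    have hδ : (0 : ℝ) < 1 / 4 / 2 ^ q := by positivity
    refine ⟨D', ⟨?_, fun t ht i => (g5 t ht i).trans ?_, fun x => ?_, fun x => ?_⟩,
      fun t ht => (g2 t ht).trans ?_, g3, fun l i t ht => (g4 l i t ht).trans ?_⟩
    · rw [pow_succ, ← div_div]; exact g1
    · gcongr
    · rw [g6 0 (fun h => by linarith [h.1]), hD3]
    · rw [g6 1 (fun h => by linarith [h.2]), hD4]
    · have h4 : M / (ε / 2 / 2 ^ q) * (r / 4 ^ q) = 2 * M * r / ε / 2 ^ q := by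
        have : (4 : ℝ) ^ q = 2 ^ q * 2 ^ q := by rw [← mul_pow]; norm_num
        rw [this]
        field_simp
      have h5 : A / 2 / 2 ^ q = 2 * M * r / ε / 2 ^ q + 1 / 2 ^ q := by
        rw [hA]; ring
      linarith
    · refine ENNReal.ofReal_le_ofReal ?_
      simpa using h24
  exact ⟨D, A, r, hD0 ▸ hu₀, fun q => (hDP q).2.2.1, fun q => (hDP q).2.2.2,
    fun q => (hDP q).2.1, fun q => (hDQ q).1, fun q => (hDQ q).2.1, fun q => (hDQ q).2.2⟩

/-! ### Curves of functions -/

section Curves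

variable {d : ℕ}

/-- The restriction of a function on `ℝ × 𝕋ᵈ` to the time interval `[0, 1]`. -/
def SmoothInTime.toC {f : ℝ → Torus d → ℝ} (hf : SmoothInTime f) : C(I × Torus d, ℝ) where
  toFun z := f z.1 z.2
  continuous_toFun := hf.continuous.comp
    ((continuous_subtype_val.comp continuous_fst).prodMk continuous_snd)

/-- A continuous function on `[0,1] × 𝕋ᵈ` as a continuous curve in `Lᵖ`. -/
noncomputable def lpCurve (p : ℝ≥0∞) [Fact (1 ≤ p)] (G : C(I × Torus d, ℝ)) :
    C(I, Lp ℝ p (volume : Measure (Torus d))) :=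
  (⟨ContinuousMap.toLp p volume ℝ, (ContinuousMap.toLp p volume ℝ).continuous⟩ :
    C(C(Torus d, ℝ), Lp ℝ p (volume : Measure (Torus d)))).comp G.curry

variable {p : ℝ≥0∞} [Fact (1 ≤ p)]

theorem continuous_lpCurve :
    Continuous (lpCurve p : C(I × Torus d, ℝ) → C(I, Lp ℝ p (volume : Measure (Torus d)))) :=
  (ContinuousMap.continuous_postcomp _).comp ContinuousMap.continuous_curry

theorem coeFn_lpCurve (G : C(I × Torus d, ℝ)) (t : I) :
    lpCurve p G t =ᵐ[volume] fun x => G (t, x) :=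
  ContinuousMap.coeFn_toLp volume (G.curry t)

theorem dist_lpCurve_apply (G G' : C(I × Torus d, ℝ)) (t : I) :
    dist (lpCurve p G t) (lpCurve p G' t) =
      (eLpNorm (fun x => G (t, x) - G' (t, x)) p volume).toReal := by
  rw [Lp.dist_def]
  congr 1
  refine eLpNorm_congr_ae ?_
  filter_upwards [coeFn_lpCurve (p := p) G t, coeFn_lpCurve (p := p) G' t] with x h1 h2
  rw [Pi.sub_apply, h1, h2]

theorem integral_lpCurve_mul (G : C(I × Torus d, ℝ)) (t : I) (ψ : Torus d → ℝ) :
    ∫ x, lpCurve p G t x * ψ x = ∫ x, G (t, x) * ψ x := by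
  refine integral_congr_ae ?_
  filter_upwards [coeFn_lpCurve (p := p) G t] with x h
  rw [h]

theorem abs_integral_Lp_mul_le (f : Lp ℝ p (volume : Measure (Torus d)))
    (ψ : C(Torus d, ℝ)) : |∫ x, f x * ψ x| ≤ ‖f‖ * ‖ψ‖ := by
  have hf : Integrable f := (Lp.memLp f).integrable Fact.out
  have h1 : |∫ x, f x * ψ x| ≤ ∫ x, ‖f x‖ * ‖ψ‖ := by
    refine norm_integral_le_of_norm_le (f := fun x => f x * ψ x) (hf.norm.mul_const _)
      (Filter.Eventually.of_forall fun x => ?_)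
    rw [norm_mul]
    exact mul_le_mul_of_nonneg_left (ψ.norm_coe_le_norm x) (norm_nonneg _)
  rw [integral_mul_const] at h1
  refine h1.trans (mul_le_mul_of_nonneg_right ?_ (norm_nonneg _))
  rw [Lp.norm_def, integral_norm_eq_lintegral_enorm hf.1, ← eLpNorm_one_eq_lintegral_enorm]
  exact ENNReal.toReal_mono (Lp.eLpNorm_ne_top f)
    (eLpNorm_le_eLpNorm_of_exponent_le Fact.out hf.1)

theorem abs_integral_Lp_mul_sub_le (f f' : Lp ℝ p (volume : Measure (Torus d)))
    (ψ ψ' : C(Torus d, ℝ)) : |(∫ x, f x * ψ x) - ∫ x, f' x * ψ' x| ≤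
      dist f f' * ‖ψ‖ + ‖f'‖ * dist ψ ψ' := by
  have h1 : (∫ x, f x * ψ x) - ∫ x, f' x * ψ' x =
      (∫ x, (f - f') x * ψ x) + ∫ x, f' x * (ψ - ψ') x := by
    have e1 : ∫ x, (f - f') x * ψ x = (∫ x, f x * ψ x) - ∫ x, f' x * ψ x := by
      rw [← integral_sub (integrable_Lp_mul f ψ.continuous) (integrable_Lp_mul f' ψ.continuous)]
      refine integral_congr_ae ?_
      filter_upwards [Lp.coeFn_sub f f'] with x hx
      rw [hx, Pi.sub_apply, sub_mul]
    have e2 : ∫ x, f' x * (ψ - ψ') x = (∫ x, f' x * ψ x) - ∫ x, f' x * ψ' x := by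
      rw [← integral_sub (integrable_Lp_mul f' ψ.continuous) (integrable_Lp_mul f' ψ'.continuous)]
      simp only [ContinuousMap.sub_apply, mul_sub]
    rw [e1, e2]; ring
  rw [h1, dist_eq_norm, dist_eq_norm]
  exact (abs_add_le _ _).trans (add_le_add (abs_integral_Lp_mul_le _ _)
    (abs_integral_Lp_mul_le _ _))

theorem continuous_integral_Lp_mul :
    Continuous fun z : Lp ℝ p (volume : Measure (Torus d)) × C(Torus d, ℝ) =>
      ∫ x, z.1 x * z.2 x := by
  refine continuous_iff_continuousAt.2 fun z => tendsto_iff_dist_tendsto_zero.2 ?_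
  refine squeeze_zero (fun _ => dist_nonneg)
    (fun w => abs_integral_Lp_mul_sub_le w.1 z.1 w.2 z.2) ?_
  have h : Continuous fun w : Lp ℝ p (volume : Measure (Torus d)) × C(Torus d, ℝ) =>
      dist w.1 z.1 * ‖w.2‖ + ‖z.1‖ * dist w.2 z.2 := by fun_prop
  have h2 := h.tendsto z
  simpa using h2

theorem isClosed_sobolevW1 : IsClosed (SobolevW1 d p : Set
    (Lp ℝ p (volume : Measure (Torus d)) × (Fin d → Lp ℝ p (volume : Measure (Torus d))))) := by
  have h : (SobolevW1 d p : Set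
      (Lp ℝ p (volume : Measure (Torus d)) × (Fin d → Lp ℝ p (volume : Measure (Torus d))))) =
      ⋂ (i : Fin d) (φ : Torus d → ℝ) (_ : SmoothOnTorus φ),
        {w | ∫ x, w.1 x * torusPartial i φ x = -∫ x, w.2 i x * φ x} := by
    ext w
    simp only [mem_iInter]
    rfl
  rw [h]
  refine isClosed_iInter fun i => isClosed_iInter fun φ => isClosed_iInter fun hφ => ?_
  have key : ∀ ψ : Torus d → ℝ, Continuous ψ →
      Continuous fun f : Lp ℝ p (volume : Measure (Torus d)) => ∫ x, f x * ψ x := fun ψ hψ =>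
    continuous_integral_Lp_mul.comp (continuous_id.prodMk (continuous_const (y := ⟨ψ, hψ⟩)))
  exact isClosed_eq ((key _ (hφ.continuous_torusPartial i)).comp continuous_fst)
    ((key _ hφ.continuous).comp ((continuous_apply i).comp continuous_snd)).neg

theorem mem_sobolevW1 {f : ℝ → Torus d → ℝ} (hf : SmoothInTime f) (t : I) :
    (lpCurve p hf.toC t, fun l => lpCurve p (hf.torusPartial l).toC t) ∈ SobolevW1 d p := by
  intro i φ hφ
  have h1 := integral_lpCurve_mul (p := p) hf.toC t (torusPartial i φ)
  have h2 := integral_lpCurve_mul (p := p) (hf.torusPartial i).toC t φ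
  refine h1.trans ?_
  refine Eq.trans ?_ (congrArg Neg.neg h2.symm)
  have := integral_torusPartial_mul (hf.slice t) hφ i
  change ∫ x, f t x * torusPartial i φ x = -∫ x, torusPartial i (f t) x * φ x
  linarith

theorem integral_unitInterval (f : ℝ → ℝ) : ∫ t : I, f t = ∫ t in (0 : ℝ)..1, f t := by
  rw [intervalIntegral.integral_of_le zero_le_one, ← integral_Icc_eq_integral_Ioc]
  exact integral_subtype_comap measurableSet_Icc f

theorem continuous_integral_continuousMap {X : Type*} [TopologicalSpace X] [CompactSpace X]
    [MeasurableSpace X] [BorelSpace X] (μ : Measure X) [IsProbabilityMeasure μ] :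
    Continuous fun G : C(X, ℝ) => ∫ x, G x ∂μ := by
  refine LipschitzWith.continuous (K := 1) (LipschitzWith.of_dist_le_mul fun G G' => ?_)
  have hi : ∀ G : C(X, ℝ), Integrable G μ := fun G =>
    G.continuous.integrable_of_hasCompactSupport (HasCompactSupport.of_compactSpace G)
  rw [dist_eq_norm, ← integral_sub (hi G) (hi G'), NNReal.coe_one, one_mul]
  refine (norm_integral_le_of_norm_le_const (C := dist G G')
    (Filter.Eventually.of_forall fun x => ?_)).trans (by simp)
  rw [← dist_eq_norm]
  exact ContinuousMap.dist_apply_le_dist x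

end Curves

/-! ### The weak formulation -/

section Weak

variable {d : ℕ}

/-- The weak formulation at a fixed time, for smooth approximate solutions. -/
theorem DefectSolution.integral_mul_transport (D : DefectSolution d) {ψ : ℝ → Torus d → ℝ}
    (hψ : SmoothInTime ψ) (t : ℝ) :
    ∫ x, D.ρ t x * (timePartial ψ t x + ∑ i, D.u i t x * torusPartial i (ψ t) x) =
      (∫ x, timePartial (fun t x => D.ρ t x * ψ t x) t x) -
        ∑ i, ∫ x, D.R i t x * torusPartial i (ψ t) x := by
  have hρ := D.smooth_ρ
  have hflux : ∀ i, SmoothInTime fun t x => D.ρ t x * D.u i t x := fun i => hρ.mul (D.smooth_u i)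
  have hψi := fun i => hψ.torusPartial i
  have s1 : SmoothInTime fun t x => D.ρ t x * timePartial ψ t x := hρ.mul hψ.timePartial
  have s2 : ∀ i, SmoothInTime fun t x => D.ρ t x * D.u i t x * torusPartial i (ψ t) x :=
    fun i => (hflux i).mul (hψi i)
  have s3 : ∀ i, SmoothInTime fun t x => torusPartial i (fun x => D.ρ t x * D.u i t x) x * ψ t x :=
    fun i => ((hflux i).torusPartial i).mul hψ
  have s4 : ∀ i, SmoothInTime fun t x => torusPartial i (D.R i t) x * ψ t x := fun i =>
    ((D.smooth_R i).torusPartial i).mul hψ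
  have i1 := (s1.slice t).integrable
  have i2 : ∀ i ∈ Finset.univ, Integrable fun x => D.ρ t x * D.u i t x * torusPartial i (ψ t) x :=
    fun i _ => ((s2 i).slice t).integrable
  have i3 : ∀ i ∈ Finset.univ, Integrable fun x =>
      torusPartial i (fun x => D.ρ t x * D.u i t x) x * ψ t x := fun i _ =>
    ((s3 i).slice t).integrable
  have i4 : ∀ i ∈ Finset.univ, Integrable fun x => torusPartial i (D.R i t) x * ψ t x :=
    fun i _ => ((s4 i).slice t).integrable
  have e1 : ∀ x, D.ρ t x * (timePartial ψ t x + ∑ i, D.u i t x * torusPartial i (ψ t) x) =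
      D.ρ t x * timePartial ψ t x + ∑ i, D.ρ t x * D.u i t x * torusPartial i (ψ t) x := fun x => by
    rw [mul_add, Finset.mul_sum]
    simp only [mul_assoc]
  have e2 : ∀ x, timePartial (fun t x => D.ρ t x * ψ t x) t x = D.ρ t x * timePartial ψ t x -
      ∑ i, torusPartial i (fun x => D.ρ t x * D.u i t x) x * ψ t x -
      ∑ i, torusPartial i (D.R i t) x * ψ t x := fun x => by
    rw [timePartial_mul hρ hψ, ← Finset.sum_mul, ← Finset.sum_mul]
    linear_combination ψ t x * D.continuity t x
  have i5 : Integrable fun x => D.ρ t x * timePartial ψ t x -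
      ∑ i, torusPartial i (fun x => D.ρ t x * D.u i t x) x * ψ t x :=
    i1.sub (integrable_finsetSum _ i3)
  simp only [e1, e2]
  rw [integral_add i1 (integrable_finsetSum _ i2),
    integral_sub i5 (integrable_finsetSum _ i4),
    integral_sub i1 (integrable_finsetSum _ i3), integral_finsetSum _ i2,
    integral_finsetSum _ i3, integral_finsetSum _ i4]
  have h3 : ∀ i, ∫ x, torusPartial i (fun x => D.ρ t x * D.u i t x) x * ψ t x =
      -∫ x, D.ρ t x * D.u i t x * torusPartial i (ψ t) x := fun i =>
    integral_torusPartial_mul ((hflux i).slice t) (hψ.slice t) i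
  have h4 : ∀ i, ∫ x, torusPartial i (D.R i t) x * ψ t x =
      -∫ x, D.R i t x * torusPartial i (ψ t) x := fun i =>
    integral_torusPartial_mul ((D.smooth_R i).slice t) (hψ.slice t) i
  simp only [h3, h4, Finset.sum_neg_distrib]
  ring

theorem integral_integral_timePartial {f : ℝ → Torus d → ℝ} (hf : SmoothInTime f)
    (h0 : ∀ x, f 0 x = 0) (h1 : ∀ x, f 1 x = 0) : ∫ t : I, ∫ x, timePartial f t x = 0 := by
  rw [integral_integral_swap]
  · have : ∀ x, ∫ t : I, timePartial f t x = 0 := fun x => by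
      rw [integral_unitInterval fun t => timePartial f t x,
        intervalIntegral.integral_eq_sub_of_hasDerivAt (f := fun t => f t x)
          (fun t _ => hf.hasDerivAt t x), h0, h1, sub_zero]
      refine Continuous.intervalIntegrable ?_ _ _
      exact hf.timePartial.continuous.comp (continuous_id.prodMk continuous_const)
    simp [this]
  · exact hf.timePartial.toC.continuous.integrable_of_hasCompactSupport
      (HasCompactSupport.of_compactSpace _)

theorem IsTestFunction.smoothInTime {φ : ℝ × Torus d → ℝ} (hφ : IsTestFunction φ) :
    SmoothInTime fun t x => φ (t, x) := hφ.smooth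

theorem IsTestFunction.eq_zero {φ : ℝ × Torus d → ℝ} (hφ : IsTestFunction φ) {t : ℝ}
    (ht : t ∉ Ioo (0 : ℝ) 1) (x : Torus d) : φ (t, x) = 0 := by
  by_contra h
  exact ht (hφ.tsupport_subset (subset_tsupport _ h)).1

/-- The field of an approximate solution on `[0, 1] × 𝕋ᵈ`. -/
noncomputable def DefectSolution.velocity (D : DefectSolution d) :
    C(I × Torus d, EuclideanSpace ℝ (Fin d)) where
  toFun z := WithLp.toLp 2 fun i => D.u i z.1 z.2
  continuous_toFun := (PiLp.continuous_toLp 2 _).comp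
    (continuous_pi fun i => (D.smooth_u i).toC.continuous)

/-- The `i`-th component of a continuous vector field. -/
def component (i : Fin d) (u : C(I × Torus d, EuclideanSpace ℝ (Fin d))) : C(I × Torus d, ℝ) where
  toFun z := u z i
  continuous_toFun := (EuclideanSpace.proj (𝕜 := ℝ) i).continuous.comp u.continuous

theorem continuous_component (i : Fin d) : Continuous (component i) :=
  ContinuousMap.continuous_postcomp ⟨fun v : EuclideanSpace ℝ (Fin d) => v i,
    (EuclideanSpace.proj (𝕜 := ℝ) i).continuous⟩

/-- The derivative `u · ∇φ` along a continuous vector field, as a continuous function. -/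
noncomputable def transportMap {φ : ℝ × Torus d → ℝ} (hφ : IsTestFunction φ)
    (u : C(I × Torus d, EuclideanSpace ℝ (Fin d))) : C(I × Torus d, ℝ) :=
  ∑ i, component i u * (hφ.smoothInTime.torusPartial i).toC

theorem transportMap_apply {φ : ℝ × Torus d → ℝ} (hφ : IsTestFunction φ)
    (u : C(I × Torus d, EuclideanSpace ℝ (Fin d))) (t : I) (x : Torus d) :
    transportMap hφ u (t, x) = transportTerm u φ t x := by
  simp only [transportMap, transportTerm, ContinuousMap.coe_sum, Finset.sum_apply,
    ContinuousMap.mul_apply]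
  rfl

theorem continuous_transportMap {φ : ℝ × Torus d → ℝ} (hφ : IsTestFunction φ) :
    Continuous (transportMap hφ) :=
  continuous_finsetSum _ fun i _ => (continuous_component i).mul continuous_const

theorem DefectSolution.integral_transportTerm (D : DefectSolution d) {φ : ℝ × Torus d → ℝ}
    (hφ : IsTestFunction φ) (t : I) : ∫ x, transportTerm D.velocity φ t x = 0 := by
  have hψ := hφ.smoothInTime
  have h1 : ∀ i ∈ Finset.univ, Integrable fun x => D.u i t x *
      torusPartial i (fun y => φ ((t : ℝ), y)) x := fun i _ =>
    (((D.smooth_u i).mul (hψ.torusPartial i)).slice t).integrable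
  have h2 : ∀ i ∈ Finset.univ, Integrable fun x => torusPartial i (D.u i t) x *
      φ ((t : ℝ), x) := fun i _ =>
    ((((D.smooth_u i).torusPartial i).mul hψ).slice t).integrable
  have h3 : ∀ i, ∫ x, D.u i t x * torusPartial i (fun y => φ ((t : ℝ), y)) x =
      -∫ x, torusPartial i (D.u i t) x * φ ((t : ℝ), x) := fun i => by
    rw [integral_torusPartial_mul ((D.smooth_u i).slice t) (hψ.slice t) i, neg_neg]
  change ∫ x, ∑ i, D.u i t x * torusPartial i (fun y => φ ((t : ℝ), y)) x = 0
  rw [integral_finsetSum _ h1]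
  simp only [h3]
  rw [Finset.sum_neg_distrib, ← integral_finsetSum _ h2]
  simp [← Finset.sum_mul, D.div_u]

/-- The error in the weak formulation is bounded by the `L¹` norm of the defect. -/
theorem DefectSolution.abs_integral_weak_le (D : DefectSolution d) {φ : ℝ × Torus d → ℝ}
    (hφ : IsTestFunction φ) {r C : ℝ} (hr : ∀ t ∈ Icc (0 : ℝ) 1, ∀ i, ∫ x, |D.R i t x| ≤ r)
    (hC : ∀ i, ∀ t ∈ Icc (0 : ℝ) 1, ∀ x, |torusPartial i (fun y => φ (t, y)) x| ≤ C) (hC0 : 0 ≤ C) :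
    |∫ t : I, ∫ x, lpCurve 1 D.smooth_ρ.toC t x *
      (timeDeriv φ t x + transportTerm D.velocity φ t x)| ≤ d * (C * r) := by
  have hψ := hφ.smoothInTime
  have e : ∀ t : I, ∫ x, lpCurve 1 D.smooth_ρ.toC t x *
      (timeDeriv φ t x + transportTerm D.velocity φ t x) =
      (∫ x, timePartial (fun t x => D.ρ t x * φ (t, x)) t x) -
        ∑ i, ∫ x, D.R i t x * torusPartial i (fun y => φ ((t : ℝ), y)) x := fun t => by
    rw [integral_lpCurve_mul]
    exact D.integral_mul_transport hψ t
  have s1 : SmoothInTime fun t x => D.ρ t x * φ (t, x) := D.smooth_ρ.mul hψ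
  have s2 := fun i => (D.smooth_R i).mul (hψ.torusPartial i)
  have c : ∀ {f : ℝ → Torus d → ℝ} (hf : SmoothInTime f), Integrable fun t : I => ∫ x, f t x :=
    fun hf => Integrable.integral_prod_left (hf.toC.continuous.integrable_of_hasCompactSupport
      (HasCompactSupport.of_compactSpace _))
  simp only [e]
  rw [integral_sub (c s1.timePartial) (integrable_finsetSum _ fun i _ => c (s2 i)),
    integral_integral_timePartial s1 (fun x => by rw [hφ.eq_zero (by simp), mul_zero])
      (fun x => by rw [hφ.eq_zero (by simp), mul_zero]), zero_sub, abs_neg, ← Real.norm_eq_abs]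
  refine (norm_integral_le_of_norm_le_const (C := d * (C * r)) (Filter.Eventually.of_forall
    fun t => ?_)).trans (by simp)
  have hsum : ∑ _i : Fin d, C * r = d * (C * r) := by simp
  refine (Finset.abs_sum_le_sum_abs _ _).trans ((Finset.sum_le_sum fun i _ => ?_).trans hsum.le)
  have h1 := integral_abs_mul_le ((hψ.torusPartial i).slice t).continuous
    ((D.smooth_R i).slice t).continuous (hC i t t.2)
  refine (abs_integral_le_integral_abs).trans ?_
  have h2 : ∀ x, |D.R i t x * torusPartial i (fun y => φ ((t : ℝ), y)) x| =
      |torusPartial i (fun y => φ ((t : ℝ), y)) x * D.R i t x| := fun x => by rw [mul_comm]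
  simp only [h2]
  exact h1.trans (mul_le_mul_of_nonneg_left (hr t t.2 i) hC0)

/-- Limits of approximate solutions whose defects tend to zero in `L¹` are weak solutions. -/
theorem isWeakSolution_of_tendsto {D : ℕ → DefectSolution d}
    {ρ : C(I, Lp ℝ 1 (volume : Measure (Torus d)))} {u : C(I × Torus d, EuclideanSpace ℝ (Fin d))}
    {r : ℕ → ℝ} (hρ : Filter.Tendsto (fun q => lpCurve 1 (D q).smooth_ρ.toC) Filter.atTop (𝓝 ρ))
    (hu : Filter.Tendsto (fun q => (D q).velocity) Filter.atTop (𝓝 u))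
    (hr : ∀ q, ∀ t ∈ Icc (0 : ℝ) 1, ∀ i, ∫ x, |(D q).R i t x| ≤ r q)
    (hr0 : Filter.Tendsto r Filter.atTop (𝓝 0)) : IsWeakSolution ρ u := by
  refine ⟨fun φ hφ => ?_, fun φ hφ => ?_⟩
  · set Ψ : C(I × Torus d, EuclideanSpace ℝ (Fin d)) → C(I × Torus d, ℝ) := fun u =>
      hφ.smoothInTime.timePartial.toC + transportMap hφ u with hΨ
    have hΨc : Continuous Ψ := continuous_const.add (continuous_transportMap hφ)
    have hΨa : ∀ u t x, Ψ u (t, x) = timeDeriv φ t x + transportTerm u φ t x := fun u t x => by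
      rw [← transportMap_apply hφ]; rfl
    -- the pairing of the density with the test function, as a continuous function of time
    set F : C(I, Lp ℝ 1 (volume : Measure (Torus d))) → C(I × Torus d, ℝ) → C(I, ℝ) := fun ρ G =>
      ⟨fun t => ∫ x, ρ t x * G.curry t x, continuous_integral_Lp_mul.comp
        (ρ.continuous.prodMk G.curry.continuous)⟩ with hF
    have hFd : ∀ ρ ρ' G G', dist (F ρ G) (F ρ' G') ≤
        dist ρ ρ' * ‖G.curry‖ + ‖ρ'‖ * dist G.curry G'.curry := fun ρ ρ' G G' => by
      refine (ContinuousMap.dist_le (by positivity)).2 fun t => ?_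
      refine (abs_integral_Lp_mul_sub_le _ _ _ _).trans ?_
      gcongr
      · exact ContinuousMap.dist_apply_le_dist t
      · exact G.curry.norm_coe_le_norm t
      · exact ρ'.norm_coe_le_norm t
      · exact ContinuousMap.dist_apply_le_dist t
    have hc : Filter.Tendsto (fun q => (Ψ (D q).velocity).curry) Filter.atTop (𝓝 (Ψ u).curry) :=
      ((ContinuousMap.continuous_curry.comp hΨc).tendsto u).comp hu
    have hFt : Filter.Tendsto (fun q => F (lpCurve 1 (D q).smooth_ρ.toC) (Ψ (D q).velocity))
        Filter.atTop (𝓝 (F ρ (Ψ u))) := by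
      refine tendsto_iff_dist_tendsto_zero.2 (squeeze_zero (fun _ => dist_nonneg)
        (fun q => hFd _ _ _ _) ?_)
      have h1 := ((tendsto_iff_dist_tendsto_zero.1 hρ).mul
          (Filter.Tendsto.norm (f := fun q => (Ψ (D q).velocity).curry) hc)).add
        (((tendsto_iff_dist_tendsto_zero (f := fun q => (Ψ (D q).velocity).curry)).1
          hc).const_mul ‖ρ‖)
      simpa using h1
    have hI := ((continuous_integral_continuousMap (volume : Measure I)).tendsto _).comp hFt
    have hFi : ∀ ρ u, ∫ t : I, F ρ (Ψ u) t =
        ∫ t : I, ∫ x, ρ t x * (timeDeriv φ t x + transportTerm u φ t x) := fun ρ u => by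
      refine integral_congr_ae (Filter.Eventually.of_forall fun t => ?_)
      exact integral_congr_ae (Filter.Eventually.of_forall fun x =>
        congrArg (ρ t x * ·) (hΨa u t x))
    obtain ⟨C, hC0, hC⟩ := SmoothInTime.exists_uniform_bound
      fun i : Fin d => hφ.smoothInTime.torusPartial i
    have h0 : Filter.Tendsto (fun q => ∫ t : I, F (lpCurve 1 (D q).smooth_ρ.toC)
        (Ψ (D q).velocity) t) Filter.atTop (𝓝 0) := by
      refine squeeze_zero_norm (fun q => ?_) (a := fun q => d * (C * r q)) ?_
      · rw [hFi]
        exact (D q).abs_integral_weak_le hφ (hr q) hC hC0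
      · simpa using (hr0.const_mul C).const_mul (d : ℝ)
    rw [← hFi]
    exact tendsto_nhds_unique hI h0
  · have key : ∀ t : I, ∫ x, transportTerm u φ t x = 0 := fun t => by
      have h1 : Continuous fun u : C(I × Torus d, EuclideanSpace ℝ (Fin d)) =>
          ∫ x, (transportMap hφ u).curry t x :=
        (continuous_integral_continuousMap (volume : Measure (Torus d))).comp
          ((continuous_eval_const t).comp
            (ContinuousMap.continuous_curry.comp (continuous_transportMap hφ)))
      have h2 : ∀ u, ∫ x, (transportMap hφ u).curry t x = ∫ x, transportTerm u φ t x := fun u => by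
        congr 1
        funext x
        exact transportMap_apply hφ u t x
      have h3 := (h1.tendsto u).comp hu
      simp only [h2] at h3
      refine tendsto_nhds_unique h3 (tendsto_const_nhds.congr fun q => ?_)
      exact ((D q).integral_transportTerm hφ t).symm
    simp [key]

end Weak

/-! ### Convergence -/

section Limit

variable {d : ℕ}

theorem EuclideanSpace.norm_le_sum_abs (v : EuclideanSpace ℝ (Fin d)) : ‖v‖ ≤ ∑ i, |v i| := by
  rw [EuclideanSpace.norm_eq, Real.sqrt_le_left (Finset.sum_nonneg fun i _ => abs_nonneg _)]
  simpa using Finset.sum_sq_le_sq_sum_of_nonneg (s := Finset.univ) (f := fun i => |v i|)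
    fun i _ => abs_nonneg _

theorem dist_lpCurve_one_le {f f' : ℝ → Torus d → ℝ} (hf : SmoothInTime f) (hf' : SmoothInTime f')
    {A : ℝ} (hA0 : 0 ≤ A) (hA : ∀ t ∈ Icc (0 : ℝ) 1, ∫ x, |f' t x - f t x| ≤ A) :
    dist (lpCurve 1 hf.toC) (lpCurve 1 hf'.toC) ≤ A := by
  rw [dist_comm]
  refine (ContinuousMap.dist_le hA0).2 fun t => ?_
  rw [dist_lpCurve_apply, eLpNorm_one_eq_lintegral_enorm]
  change (∫⁻ x, ‖f' t x - f t x‖ₑ).toReal ≤ A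
  rw [← integral_norm_eq_lintegral_enorm
      ((hf'.sub hf).slice t).continuous.aestronglyMeasurable]
  exact hA t t.2

theorem dist_lpCurve_le {p : ℝ≥0∞} [Fact (1 ≤ p)] {f f' : ℝ → Torus d → ℝ} (hf : SmoothInTime f)
    (hf' : SmoothInTime f') {s A : ℝ} (hps : p ≤ ENNReal.ofReal s) (hA0 : 0 ≤ A)
    (hA : ∀ t ∈ Icc (0 : ℝ) 1, eLpNorm (fun x => f' t x - f t x) (ENNReal.ofReal s) volume ≤
      ENNReal.ofReal A) :
    dist (lpCurve p hf.toC) (lpCurve p hf'.toC) ≤ A := by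
  rw [dist_comm]
  refine (ContinuousMap.dist_le hA0).2 fun t => ?_
  rw [dist_lpCurve_apply]
  refine ENNReal.toReal_le_of_le_ofReal hA0 ((eLpNorm_le_eLpNorm_of_exponent_le hps
    ((hf'.sub hf).slice t).continuous.aestronglyMeasurable).trans (hA t t.2))

theorem component_velocity (D : DefectSolution d) (i : Fin d) :
    component i D.velocity = (D.smooth_u i).toC := rfl

/-- A uniform limit of smooth fields whose gradients converge in `C([0,1]; Lᵖ)` belongs to
`C([0,1]; W^{1,p})`. -/
theorem inCW1_of_tendsto {p : ℝ≥0∞} [Fact (1 ≤ p)] {D : ℕ → DefectSolution d}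
    {u : C(I × Torus d, EuclideanSpace ℝ (Fin d))}
    (hu : Filter.Tendsto (fun q => (D q).velocity) Filter.atTop (𝓝 u))
    (hgrad : ∀ i l, ∃ G : C(I, Lp ℝ p (volume : Measure (Torus d))), Filter.Tendsto
      (fun q => lpCurve p (((D q).smooth_u i).torusPartial l).toC) Filter.atTop (𝓝 G)) :
    InCW1 p u := by
  intro i
  choose G hG using hgrad i
  have h1 : Filter.Tendsto (fun q => lpCurve p ((D q).smooth_u i).toC) Filter.atTop
      (𝓝 (lpCurve p (component i u))) := by
    have h2 : Filter.Tendsto (fun q => component i (D q).velocity) Filter.atTop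
        (𝓝 (component i u)) := ((continuous_component i).tendsto u).comp hu
    simp only [component_velocity] at h2
    exact (continuous_lpCurve.tendsto (component i u)).comp h2
  have h1t : ∀ t, Filter.Tendsto (fun q => lpCurve p ((D q).smooth_u i).toC t) Filter.atTop
      (𝓝 (lpCurve p (component i u) t)) := fun t =>
    ((continuous_eval_const t).tendsto (lpCurve p (component i u))).comp h1
  have hGt : ∀ t, Filter.Tendsto (fun q => fun l =>
      lpCurve p (((D q).smooth_u i).torusPartial l).toC t) Filter.atTop
      (𝓝 (fun l => G l t)) := fun t =>
    tendsto_pi_nhds.2 fun l => ((continuous_eval_const t).tendsto (G l)).comp (hG l)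
  have hmem : ∀ t, (lpCurve p (component i u) t, fun l => G l t) ∈ SobolevW1 d p := fun t => by
    have h2 : Filter.Tendsto (fun q => (lpCurve p ((D q).smooth_u i).toC t, fun l =>
        lpCurve p (((D q).smooth_u i).torusPartial l).toC t)) Filter.atTop
        (𝓝 (lpCurve p (component i u) t, fun l => G l t)) :=
      (h1t t).prodMk_nhds (hGt t)
    exact isClosed_sobolevW1.mem_of_tendsto h2 (Filter.Eventually.of_forall fun q =>
      mem_sobolevW1 ((D q).smooth_u i) t)
  refine ⟨⟨fun t => ⟨_, hmem t⟩, ?_⟩, fun t => coeFn_lpCurve (component i u) t⟩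
  exact Continuous.subtype_mk ((lpCurve p (component i u)).continuous.prodMk
    (continuous_pi fun l => (G l).continuous)) _

theorem eventually_le_ofReal_sub {p : ℝ≥0∞} (hp : p < (d : ℝ≥0∞) - 1) :
    ∃ q₀ : ℕ, ∀ q, p ≤ ENNReal.ofReal ((d : ℝ) - 1 - 1 / ((q + q₀ : ℕ) + 1)) := by
  have hd1 : (d : ℝ≥0∞) - 1 = ENNReal.ofReal ((d : ℝ) - 1) := by
    rw [ENNReal.ofReal_sub _ zero_le_one, ENNReal.ofReal_natCast, ENNReal.ofReal_one]
  rw [hd1] at hp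
  have h1 : Filter.Tendsto (fun q : ℕ => ENNReal.ofReal ((d : ℝ) - 1 - 1 / ((q : ℝ) + 1)))
      Filter.atTop (𝓝 (ENNReal.ofReal ((d : ℝ) - 1))) := by
    refine ENNReal.tendsto_ofReal ?_
    simpa using tendsto_one_div_add_atTop_nhds_zero_nat.const_sub ((d : ℝ) - 1)
  obtain ⟨q₀, hq₀⟩ := Filter.eventually_atTop.1 (h1.eventually_const_le hp)
  exact ⟨q₀, fun q => hq₀ (q + q₀) (Nat.le_add_left _ _)⟩

end Limit

theorem theorem1 (d : ℕ) (hd : 3 ≤ d) (ε : ℝ) (hε : 0 < ε)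
    (ρbar : Torus d → ℝ) (hsmooth : SmoothOnTorus ρbar) (hmean : ∫ x, ρbar x = 0) :
    ∃ (ρ : C(I, Lp ℝ 1 (volume : Measure (Torus d))))
      (u : C(I × Torus d, EuclideanSpace ℝ (Fin d))),
      (∀ (p : ℝ≥0∞) [Fact (1 ≤ p)], p < (d : ℝ≥0∞) - 1 → InCW1 p u) ∧
      IsWeakSolution ρ u ∧
      ρ 0 = 0 ∧
      ρ 1 =ᵐ[volume] ρbar ∧
      ∀ (t : I) (x : Torus d), ‖u (t, x)‖ ≤ ε := by
  have hd0 : (0 : ℝ) < d := by exact_mod_cast (by omega : 0 < d)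
  obtain ⟨D, A, r, hu₀, h0, h1, hR, hρ, hu, hDu⟩ :=
    exists_approximation hd (div_pos hε hd0) hsmooth hmean
  have hA : ∀ q : ℕ, 0 ≤ A / 2 / 2 ^ q := fun q =>
    (integral_nonneg fun x => abs_nonneg _).trans (hρ q 0 ⟨le_rfl, zero_le_one⟩)
  obtain ⟨ρ, hρlim⟩ := cauchySeq_tendsto_of_complete (cauchySeq_of_le_geometric_two
    (f := fun q => lpCurve 1 (D q).smooth_ρ.toC) (C := A) fun q =>
      dist_lpCurve_one_le _ _ (hA q) (hρ q))
  have hud : ∀ q, dist (D q).velocity (D (q + 1)).velocity ≤ ε / 2 / 2 ^ q := fun q => by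
    rw [dist_comm]
    refine (ContinuousMap.dist_le (by positivity)).2 fun z => ?_
    rw [dist_eq_norm]
    refine (EuclideanSpace.norm_le_sum_abs _).trans
      ((Finset.sum_le_sum fun i _ => hu q i z.1 z.2).trans (le_of_eq ?_))
    rw [Finset.sum_const, Finset.card_univ, Fintype.card_fin, nsmul_eq_mul]
    field_simp
  obtain ⟨u, hulim⟩ := cauchySeq_tendsto_of_complete (cauchySeq_of_le_geometric_two hud)
  refine ⟨ρ, u, fun p _ hp => ?_, ?_, ?_, ?_, fun t x => ?_⟩
  · obtain ⟨q₀, hq₀⟩ := eventually_le_ofReal_sub hp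
    refine inCW1_of_tendsto (D := fun q => D (q + q₀))
      (hulim.comp (Filter.tendsto_add_atTop_nat q₀)) fun i l => ?_
    refine cauchySeq_tendsto_of_complete (cauchySeq_of_le_geometric_two (C := 2) fun q => ?_)
    have h2 : (2 : ℝ) / 2 / 2 ^ (q + q₀) ≤ 2 / 2 / 2 ^ q :=
      div_le_div_of_nonneg_left (by norm_num) (by positivity)
        (pow_le_pow_right₀ (by norm_num) (Nat.le_add_right _ _))
    have h3 := dist_lpCurve_le (((D (q + q₀)).smooth_u i).torusPartial l)
      (((D (q + q₀ + 1)).smooth_u i).torusPartial l) (hq₀ q)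
      (by positivity : (0 : ℝ) ≤ 2 / 2 / 2 ^ (q + q₀)) (hDu (q + q₀) l i)
    have h4 : q + 1 + q₀ = q + q₀ + 1 := by omega
    simp only [h4]
    exact h3.trans h2
  · refine isWeakSolution_of_tendsto hρlim hulim hR ?_
    have h2 : Filter.Tendsto (fun q : ℕ => r * (1 / 4 : ℝ) ^ q) Filter.atTop (𝓝 (r * 0)) :=
      (tendsto_pow_atTop_nhds_zero_of_lt_one (by norm_num) (by norm_num)).const_mul r
    rw [mul_zero] at h2
    refine h2.congr fun q => ?_
    rw [one_div, inv_pow, ← div_eq_mul_inv]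
  · refine tendsto_nhds_unique (((continuous_eval_const (0 : I)).tendsto ρ).comp hρlim)
      (tendsto_const_nhds.congr fun q => ?_)
    refine (Lp.ext ?_).symm
    filter_upwards [coeFn_lpCurve (p := 1) (D q).smooth_ρ.toC 0,
      Lp.coeFn_zero ℝ 1 (volume : Measure (Torus d))] with x h2 h3
    rw [h3]
    exact h2.trans (h0 q x)
  · set b : Lp ℝ 1 (volume : Measure (Torus d)) :=
      ContinuousMap.toLp 1 volume ℝ ⟨ρbar, hsmooth.continuous⟩ with hb
    have hbe : b =ᵐ[volume] ρbar := ContinuousMap.coeFn_toLp volume _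
    have h2 : ρ 1 = b := by
      refine tendsto_nhds_unique (((continuous_eval_const (1 : I)).tendsto ρ).comp hρlim)
        (tendsto_const_nhds.congr fun q => ?_)
      refine (Lp.ext ?_).symm
      filter_upwards [coeFn_lpCurve (p := 1) (D q).smooth_ρ.toC 1, hbe] with x h2 h3
      rw [h3]
      exact h2.trans (h1 q x)
    rw [h2]
    exact hbe
  · have h2 := (ContinuousMap.dist_apply_le_dist (t, x)).trans
      (dist_le_of_le_geometric_two_of_tendsto₀ hud hulim)
    have h3 : (D 0).velocity (t, x) = 0 := by
      ext i
      exact hu₀ i t x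
    rwa [h3, dist_zero_left] at h2
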